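/- Let $d\ge 2$, let $\Omega\subset\mathbb R^d$ be a bounded domain whose boundary $\Gamma=\partial\Omega$ is a smooth closed hypersurface, with outer unit normal $n$. Let $\mathcal X=C^\infty(\Gamma,\mathbb R^d)$ be the Fréchet space of smooth deformations, with the norms $\|r\|_k=\sup_{m\le k}\sup_{x}|D^m r(x)|$ (infimum over smooth extensions of $r$ to $\mathbb R^d$), the induced distance $d_\infty(r,s)=\sum_{k\ge0}2^{-k}\frac{\|r-s\|_k}{1+\|r-s\|_k}$, and the balls $B^\infty(0,\varepsilon)=\{r\in\mathcal X:\ d_\infty(0,r)<\varepsilon\}$. For $r\in\mathcal X$ put $\Gamma_r=\{x+r(x):x\in\Gamma\}$ and $(\tau_r v)(x)=v(x+r(x))$ for $x\in\Gamma$ and functions $v$ on $\Gamma_r$. Let $n_r$ be the unit normal on $\Gamma_r$ with $\tau_r n_r=w_r/\|w_r\|$, $w_r=\operatorname{cof}(\mathrm{Id}+Dr)\,n$, let $\mathcal N(r)=\tau_r n_r$, and let $\nabla_{\Gamma_r}v=\nabla\tilde v-(\nabla\tilde v\cdot n_r)\,n_r$ be the tangential gradient on $\Gamma_r$ ($\tilde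 v$ a smooth extension of $v$). For $t\in\mathbb R$ let $H^t(\Gamma)$ be the Sobolev space of complex-valued functions (distributions) on $\Gamma$, and $\mathbf H^t(\Gamma)=H^t(\Gamma)^d$. There is an $\varepsilon>0$ such that $\mathrm{Id}+r$ is a diffeomorphism from $\Gamma$ onto $\Gamma_r$ for every $r\in B^\infty(0,\varepsilon)$. For every such $\varepsilon$ and every $t\in\mathbb R$ the following holds. 1. For $r\in B^\infty(0,\varepsilon)$, $\mathcal N(r)$ is smooth, and $\mathcal G(r)=\tau_r\nabla_{\Gamma_r}\tau_r^{-1}$ maps $C^\infty(\Gamma,\mathbb C)$ to $C^\infty(\Gamma,\mathbb C)^d$ and extends to a bounded operator, again denoted $\mathcal G(r)$, from $H^{t+1}(\Gamma)$ to $\mathbf H^t(\Gamma)$. Multiplication by a smooth function is bounded on $H^t(\Gamma)$. 2. The mapping $\mathcal G: B^\infty(0,\varepsilon)\to\mathscr L(H^{t+1}(\Gamma),\mathbf H^t(\Gamma))$ is $C^\infty$-Gâteaux differentiable. Here $f$ is called $C^1$-Gâteaux differentiable on an open set $U$ if $df[r;\xi]=\lim_{s\to0}\frac{f(r+s\xi)-f(r)}{s}$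 exists for all $r\in U$, $\xi\in\mathcal X$, is linear and continuous in $\xi$, and is continuous in $(r,\xi)\in U\times\mathcal X$; it is $C^{m+1}$ if it is $C^m$ and $r\mapsto d^mf[r;\xi_1,\dots,\xi_m]$ is $C^1$ for all fixed $\xi_1,\dots,\xi_m$; it is $C^\infty$ if it is $C^m$ for all $m$. 3. For $r_0\in B^\infty(0,\varepsilon)$, $\xi\in C^\infty(\Gamma,\mathbb R^d)$ and $u\in H^{t+1}(\Gamma)$ the first derivative is $$d\mathcal G[r_0,\xi]u=-[\mathcal G(r_0)\xi]\,\mathcal G(r_0)u+\bigl(\mathcal G(r_0)u\cdot[\mathcal G(r_0)\xi]\mathcal N(r_0)\bigr)\,\mathcal N(r_0),$$ where $[\mathcal G(r_0)\xi]$ is the matrix whose $i$-th column is $\mathcal G(r_0)\xi_i$ and $a\cdot b=\sum_k a_kb_k$. -/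

import Mathlib

open Set Filter Topology MeasureTheory
open scoped ContDiff SchwartzMap

namespace ShapeCalculus

noncomputable section

/-! ### Gâteaux calculus in topological vector spaces -/

section Gateaux

variable {X Y : Type*} [AddCommGroup X] [Module ℝ X] [TopologicalSpace X]
  [AddCommGroup Y] [Module ℝ Y] [TopologicalSpace Y]

/-- `y` is the Gâteaux semiderivative of `f` at `r` in the direction `ξ`:
`y = lim_{s → 0} (f (r + s ξ) - f r) / s` in the topology of `Y`. -/
def HasGateauxSemideriv (f : X → Y) (r ξ : X) (y : Y) : Prop :=
  Tendsto (fun s : ℝ => s⁻¹ • (f (r + s • ξ) - f r)) (𝓝[≠] 0) (𝓝 y)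

/-- `f` is continuously Gâteaux differentiable on `U` with derivative `f'`: every `f' r` is a
continuous linear map whose values are the semiderivatives of `f` at `r`, and
`(r, ξ) ↦ f' r ξ` is jointly continuous on `U × X`. -/
structure HasContGateauxDerivOn (U : Set X) (f : X → Y) (f' : X → X →L[ℝ] Y) : Prop where
  hasSemideriv : ∀ r ∈ U, ∀ ξ : X, HasGateauxSemideriv f r ξ (f' r ξ)
  continuousOn : ContinuousOn (fun p : X × X => f' p.1 p.2) (U ×ˢ (univ : Set X))

/-- `f` is `C^m`-Gâteaux differentiable on `U`. For `m + 1` this says that `f` is continuously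
Gâteaux differentiable and that `r ↦ df[r; ξ]` is `C^m`-Gâteaux differentiable for each fixed `ξ`;
unfolding the recursion, all the maps `r ↦ d^k f[r; ξ₁, …, ξ_k]` with `k ≤ m` exist and are
continuously Gâteaux differentiable. -/
def IsGateauxCm : ℕ → Set X → (X → Y) → Prop
  | 0, U, f => ContinuousOn f U
  | m + 1, U, f => ∃ f' : X → X →L[ℝ] Y, HasContGateauxDerivOn U f f' ∧
      ∀ ξ : X, IsGateauxCm m U (fun r => f' r ξ)

/-- `f` is `C^∞`-Gâteaux differentiable on `U`. -/
def IsGateauxSmooth (U : Set X) (f : X → Y) : Prop := ∀ m : ℕ, IsGateauxCm m U f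

end Gateaux

/-- Euclidean space `ℝ^d`. -/
abbrev Space (d : ℕ) : Type := EuclideanSpace ℝ (Fin d)

/-- The points of a compact set, as a type. -/
abbrev Pts {d : ℕ} (Γ : TopologicalSpace.Compacts (Space d)) : Type := ↥(Γ : Set (Space d))

/-! ### Bounded domains with smooth boundary -/

/-- `ρ` is a smooth local defining function of `Ω` at `x`: near `x` the set `Ω` is `{ρ < 0}`, and
the gradient of `ρ` at `x` does not vanish. -/
structure IsLocalDefiningFunction {d : ℕ} (Ω : Set (Space d))
    (x : Space d) (ρ : Space d → ℝ) : Prop where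
  smooth : ContDiff ℝ ∞ ρ
  eq_zero : ρ x = 0
  gradient_ne : gradient ρ x ≠ 0
  mem_iff : ∀ᶠ y in 𝓝 x, y ∈ Ω ↔ ρ y < 0

/-- Bounded domains of `ℝ^d` whose boundary is a smooth closed hypersurface. -/
structure SmoothDomain (d : ℕ) where
  carrier : Set (Space d)
  isOpen : IsOpen carrier
  isConnected : IsConnected carrier
  isBounded : Bornology.IsBounded carrier
  smooth_frontier : ∀ x ∈ frontier carrier, ∃ ρ, IsLocalDefiningFunction carrier x ρ

/-- The boundary `Γ` of a bounded domain, as a compact set. -/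
def SmoothDomain.boundary {d : ℕ} (Ω : SmoothDomain d) :
    TopologicalSpace.Compacts (Space d) where
  carrier := frontier Ω.carrier
  isCompact' := Ω.isBounded.closure.isCompact_closure.of_isClosed_subset isClosed_frontier
    (frontier_subset_closure.trans subset_closure)

/-- `ν` is the outer unit normal of `Ω` at the boundary point `x`: the normalized gradient of a
local defining function. -/
def IsOuterUnitNormal {d : ℕ} (Ω : Set (Space d))
    (x ν : Space d) : Prop :=
  ∃ ρ, IsLocalDefiningFunction Ω x ρ ∧ ν = ‖gradient ρ x‖⁻¹ • gradient ρ x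

open Classical in
/-- The outer unit normal vector field `n` on `Γ`. -/
def SmoothDomain.normal {d : ℕ} (Ω : SmoothDomain d) (x : Ω.boundary) :
    Space d :=
  if h : ∃ ν, IsOuterUnitNormal Ω.carrier x ν then h.choose else 0

/-! ### Smooth functions on a compact subset of `ℝ^d` -/

section SmoothFunctions

variable {d : ℕ} {F : Type*} [NormedAddCommGroup F] [NormedSpace ℝ F]

/-- `g` is a smooth extension of `f`, defined on the set `S`, to the whole space. -/
def IsSmoothExtension {S : Set (Space d)} (f : S → F)
    (g : Space d → F) : Prop :=
  ContDiff ℝ ∞ g ∧ ∀ x : S, g x = f x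

open Classical in
/-- A chosen smooth extension of `f` to the whole space (zero if there is none). -/
def smoothExtension {S : Set (Space d)} (f : S → F) :
    Space d → F :=
  if h : ∃ g, IsSmoothExtension f g then h.choose else 0

variable (𝕜 : Type*) [RCLike 𝕜] [NormedSpace 𝕜 F] [SMulCommClass ℝ 𝕜 F]

variable (F) in
/-- The space `C^∞(Γ, F)`: functions on `Γ` that are restrictions of smooth functions on `ℝ^d`. -/
def smoothFun (Γ : Set (Space d)) : Submodule 𝕜 (Γ → F) where
  carrier := {f | ∃ g, IsSmoothExtension f g}
  add_mem' := by
    rintro f₁ f₂ ⟨g₁, h₁, e₁⟩ ⟨g₂, h₂, e₂⟩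
    exact ⟨g₁ + g₂, h₁.add h₂, fun x => by simp [e₁, e₂]⟩
  zero_mem' := ⟨0, contDiff_const, fun x => rfl⟩
  smul_mem' := by
    rintro c f ⟨g, h, e⟩
    exact ⟨c • g, h.const_smul c, fun x => by simp [e]⟩

end SmoothFunctions

/-! ### The Fréchet space of deformations -/

/-- The space `C^∞(Γ, ℝ^d)` of deformations of `Γ`, which carries its Fréchet topology (below). -/
def Deformation {d : ℕ} (Γ : TopologicalSpace.Compacts (Space d)) : Type :=
  smoothFun (Space d) ℝ (Γ : Set (Space d))

namespace Deformation

variable {d : ℕ} {Γ : TopologicalSpace.Compacts (Space d)}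

instance : AddCommGroup (Deformation Γ) :=
  inferInstanceAs (AddCommGroup
    (smoothFun (Space d) ℝ (Γ : Set (Space d))))

instance : Module ℝ (Deformation Γ) :=
  inferInstanceAs (Module ℝ
    (smoothFun (Space d) ℝ (Γ : Set (Space d))))

/-- The function `Γ → ℝ^d` underlying a deformation. -/
def toFun (r : Deformation Γ) : Pts Γ → Space d :=
  r.1

/-- The upper bounds for `sup_{m ≤ k} sup_{x ∈ ℝ^d} |D^m g(x)|`, over smooth extensions `g` of `r`
to the whole space. -/
def normBounds (k : ℕ) (r : Deformation Γ) : Set ℝ :=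
  {C | 0 ≤ C ∧ ∃ g, IsSmoothExtension r.toFun g ∧
    ∀ m ≤ k, ∀ x, ‖iteratedFDeriv ℝ m g x‖ ≤ C}

theorem normBounds_nonempty (k : ℕ) (r : Deformation Γ) : (normBounds k r).Nonempty := by
  obtain ⟨g, hg, e⟩ : ∃ g, IsSmoothExtension r.toFun g := r.2
  obtain ⟨R, hR, hΓ⟩ := Γ.isCompact.isBounded.subset_closedBall_lt 0 0
  let b : ContDiffBump (0 : Space d) := ⟨R, R + 1, hR, by linarith⟩
  have hb : ContDiff ℝ ∞ (fun x => b x • g x) := b.contDiff.smul hg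
  have hc : HasCompactSupport (fun x => b x • g x) := b.hasCompactSupport.smul_right
  have hB : ∀ m : ℕ, ∃ C, ∀ x, ‖iteratedFDeriv ℝ m (fun x => b x • g x) x‖ ≤ C := fun m =>
    (hc.iteratedFDeriv m).exists_bound_of_continuous
      (hb.continuous_iteratedFDeriv (by exact_mod_cast le_top))
  choose C hC using hB
  have hC0 : ∀ m, 0 ≤ C m := fun m => (norm_nonneg _).trans (hC m 0)
  refine ⟨∑ m ∈ Finset.range (k + 1), C m, Finset.sum_nonneg fun m _ => hC0 m,
    fun x => b x • g x, ⟨hb, fun x => ?_⟩, fun m hm x => (hC m x).trans ?_⟩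
  · have : b (x : Space d) = 1 := b.one_of_mem_closedBall (hΓ x.2)
    simp [this, e]
  · exact Finset.single_le_sum (f := C) (fun m _ => hC0 m)
      (Finset.mem_range.2 (Nat.lt_succ_of_le hm))

theorem normBounds_bddBelow (k : ℕ) (r : Deformation Γ) : BddBelow (normBounds k r) :=
  ⟨0, fun _ h => h.1⟩

/-- The seminorm `‖r‖_k = sup_{m ≤ k} sup_x |D^m r(x)|`; since `r` is only given on `Γ`, the
infimum over all smooth extensions of `r` to the whole space is taken. -/
def kNorm (k : ℕ) : Seminorm ℝ (Deformation Γ) :=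
  Seminorm.ofSMulLE (fun r => sInf (normBounds k r))
    (by
      refine le_antisymm (csInf_le (normBounds_bddBelow k _) ⟨le_rfl, 0, ⟨contDiff_const,
        fun x => rfl⟩, fun m _ x => ?_⟩) (le_csInf (normBounds_nonempty k _) fun _ h => h.1)
      simp)
    (by
      intro r s
      refine le_of_forall_pos_le_add fun ε hε => ?_
      obtain ⟨A, ⟨hA0, g, ⟨hg, eg⟩, hA⟩, hAlt⟩ :=
        Real.lt_sInf_add_pos (normBounds_nonempty k r) (half_pos hε)
      obtain ⟨B, ⟨hB0, h, ⟨hh, eh⟩, hB⟩, hBlt⟩ :=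
        Real.lt_sInf_add_pos (normBounds_nonempty k s) (half_pos hε)
      have : sInf (normBounds k (r + s)) ≤ A + B := by
        refine csInf_le (normBounds_bddBelow k _) ⟨add_nonneg hA0 hB0, g + h,
          ⟨hg.add hh, fun x => ?_⟩, fun m hm x => ?_⟩
        · simp only [Pi.add_apply, eg, eh]
          rfl
        · rw [iteratedFDeriv_add_apply (hg.of_le (by exact_mod_cast le_top)).contDiffAt
            (hh.of_le (by exact_mod_cast le_top)).contDiffAt]
          exact (norm_add_le _ _).trans (add_le_add (hA m hm x) (hB m hm x))
      linarith)
    (by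
      intro c r
      refine le_of_forall_pos_le_add fun ε hε => ?_
      have hpos : 0 < ε / (‖c‖ + 1) := by positivity
      obtain ⟨A, ⟨hA0, g, ⟨hg, eg⟩, hA⟩, hAlt⟩ :=
        Real.lt_sInf_add_pos (normBounds_nonempty k r) hpos
      have h1 : sInf (normBounds k (c • r)) ≤ ‖c‖ * A := by
        refine csInf_le (normBounds_bddBelow k _) ⟨by positivity, c • g,
          ⟨hg.const_smul c, fun x => ?_⟩, fun m hm x => ?_⟩
        · simp only [Pi.smul_apply, eg]
          rfl
        · rw [iteratedFDeriv_const_smul_apply (hg.of_le (by exact_mod_cast le_top)).contDiffAt,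
            norm_smul]
          exact mul_le_mul_of_nonneg_left (hA m hm x) (norm_nonneg c)
      have h2 : ‖c‖ * A ≤ ‖c‖ * (sInf (normBounds k r) + ε / (‖c‖ + 1)) :=
        mul_le_mul_of_nonneg_left hAlt.le (norm_nonneg c)
      have h3 : ‖c‖ * (ε / (‖c‖ + 1)) ≤ ε := by
        rw [← mul_div_assoc, div_le_iff₀ (by positivity)]
        nlinarith [norm_nonneg c]
      linarith [mul_add ‖c‖ (sInf (normBounds k r)) (ε / (‖c‖ + 1))])

/-- The Fréchet topology of `C^∞(Γ, ℝ^d)`, generated by the norms `‖·‖_k`, `k ∈ ℕ`. -/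
instance : TopologicalSpace (Deformation Γ) :=
  (SeminormFamily.moduleFilterBasis (𝕜 := ℝ) (F := Deformation Γ) (fun k : ℕ => kNorm k)).topology

theorem withSeminorms :
    WithSeminorms (𝕜 := ℝ) (E := Deformation Γ) (fun k : ℕ => kNorm k) := ⟨rfl⟩

/-- The distance `d_∞` induced by the family of norms `‖·‖_k`. -/
def dInfty (r s : Deformation Γ) : ℝ :=
  ∑' k : ℕ, (1 / 2 : ℝ) ^ k * (kNorm k (s - r) / (1 + kNorm k (s - r)))

variable (Γ) in
/-- The ball `B^∞(0, ε)`. -/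
def ball (ε : ℝ) : Set (Deformation Γ) := {r | dInfty 0 r < ε}

/-- The transformation `Id + r`, from `Γ` to `ℝ^d`. -/
def map (r : Deformation Γ) (x : Pts Γ) :
    Space d := x + r.toFun x

/-- The deformed surface `Γ_r = (Id + r) Γ`. -/
def surface (r : Deformation Γ) : Set (Space d) := range r.map

/-- `Id + r` is a diffeomorphism from `Γ` onto `Γ_r`: it has an inverse `Γ_r → Γ` which is the
restriction of a smooth map. -/
def IsDiffeo (r : Deformation Γ) : Prop :=
  ∃ s : Space d → Space d, ContDiff ℝ ∞ s ∧
    ∀ x, s (r.map x) = x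

/-- The pullback `τ_r`, `(τ_r v)(x) = v (x + r(x))`. -/
def pullback {F : Type*} (r : Deformation Γ) (v : r.surface → F) :
    Pts Γ → F := fun x => v ⟨r.map x, mem_range_self x⟩

/-- The inverse `τ_r⁻¹` of the pullback, `(τ_r⁻¹ u)(x + r(x)) = u(x)`. -/
def pushforward {F : Type*} (r : Deformation Γ) (u : Pts Γ → F) :
    r.surface → F := fun y => u y.2.choose

/-- The matrix `Id + D r(x)`, for a smooth extension of `r` to the whole space. -/
def jacobian (r : Deformation Γ) (x : Pts Γ) :
    Matrix (Fin d) (Fin d) ℝ :=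
  1 + Matrix.of fun i j => fderiv ℝ (smoothExtension r.toFun) x (EuclideanSpace.single j 1) i

end Deformation

/-! ### Normal vector and tangential gradient on the deformed surface -/

section Gradient

variable {d : ℕ} (Ω : SmoothDomain d)

/-- `w_r = cof(Id + D r) n` on `Γ`, where `cof A` is the matrix of cofactors of `A`. -/
def normalW (r : Deformation Ω.boundary)
    (x : Pts Ω.boundary) : Space d :=
  WithLp.toLp 2 (((r.jacobian x).adjugate.transpose).mulVec (Ω.normal x).ofLp)

/-- The outer unit normal vector `n_r = τ_r⁻¹ (w_r / ‖w_r‖)` on `Γ_r`. -/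
def deformedNormal (r : Deformation Ω.boundary) : r.surface → Space d :=
  r.pushforward fun x => ‖normalW Ω r x‖⁻¹ • normalW Ω r x

/-- `N(r) = τ_r n_r`. -/
def normalN (r : Deformation Ω.boundary) :
    Pts Ω.boundary → Space d :=
  r.pullback (deformedNormal Ω r)

/-- The tangential gradient `∇ũ - (∇ũ · ν) ν` on a hypersurface `S` with unit normal field `ν`,
where `ũ` is a smooth extension of `u` to the whole space. -/
def tangentialGradient {S : Set (Space d)} (ν : S → Space d)
    (u : S → ℂ) (y : S) (i : Fin d) : ℂ :=
  fderiv ℝ (smoothExtension u) y (EuclideanSpace.single i 1) -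
    (∑ k, fderiv ℝ (smoothExtension u) y (EuclideanSpace.single k 1) * (ν y k : ℂ)) * (ν y i : ℂ)

/-- The `i`-th component of `τ_r ∇_{Γ_r} τ_r⁻¹ u` for a smooth function `u` on `Γ`. -/
def pulledGradient (r : Deformation Ω.boundary) (i : Fin d)
    (u : Pts Ω.boundary → ℂ) :
    Pts Ω.boundary → ℂ :=
  r.pullback fun y => tangentialGradient (deformedNormal Ω r) (r.pushforward u) y i

/-- The matrix `[G(r) ξ]`, whose `i`-th column is `G(r) ξ_i`. -/
def pulledGradientMatrix (r ξ : Deformation Ω.boundary) (j i : Fin d) :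
    Pts Ω.boundary → ℂ :=
  pulledGradient Ω r j fun x => (ξ.toFun x i : ℂ)

end Gradient

/-! ### Sobolev spaces on a hypersurface -/

section Sobolev

variable {d : ℕ}

/-- A local parametrization of the hypersurface `Γ` together with a cutoff function: `param` is a
diffeomorphism of the open set `source ⊆ ℝ^{d-1}` onto the relatively open part `Γ ∩ target` of
`Γ`, and `cutoff` is a smooth function with compact support in `source`. -/
structure LocalPatch (Γ : Set (Space d)) where
  source : Set (Space (d - 1))
  target : Set (Space d)
  param : Space (d - 1) → Space d
  coord : Space d → Space (d - 1)
  isOpen_source : IsOpen source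
  isOpen_target : IsOpen target
  contDiffOn_param : ContDiffOn ℝ ∞ param source
  contDiffOn_coord : ContDiffOn ℝ ∞ coord target
  image_param : param '' source = Γ ∩ target
  left_inv : ∀ y ∈ source, coord (param y) = y
  cutoff : Space (d - 1) → ℝ
  contDiff_cutoff : ContDiff ℝ ∞ cutoff
  hasCompactSupport_cutoff : HasCompactSupport cutoff
  tsupport_cutoff : tsupport cutoff ⊆ source

open Classical in
/-- The localization `χ · (f ∘ φ)` of a function `f` on `Γ`, extended by zero to `ℝ^{d-1}`, where
`φ` is the parametrization and `χ` the cutoff function of the patch. -/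
def LocalPatch.localize {Γ : Set (Space d)} (p : LocalPatch Γ) (f : Γ → ℂ)
    (y : Space (d - 1)) : ℂ :=
  if h : p.param y ∈ Γ then (p.cutoff y : ℂ) * f ⟨p.param y, h⟩ else 0

namespace LocalPatch

variable {Γ : Set (Space d)} (p : LocalPatch Γ)

theorem localize_eq (f : Γ → ℂ) {g : Space d → ℂ} (hg : IsSmoothExtension f g) :
    p.localize f = fun y => (p.cutoff y : ℂ) * g (p.param y) := by
  funext y
  unfold localize
  split_ifs with h
  · rw [← hg.2 ⟨p.param y, h⟩]
  · have : y ∉ p.source := fun hy =>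
      h ((p.image_param ▸ mem_image_of_mem p.param hy : p.param y ∈ Γ ∩ p.target).1)
    have h0 : p.cutoff y = 0 :=
      image_eq_zero_of_notMem_tsupport fun hy => this (p.tsupport_cutoff hy)
    simp [h0]

theorem contDiff_localize (f : Γ → ℂ) (hf : ∃ g, IsSmoothExtension f g) :
    ContDiff ℝ ∞ (p.localize f) := by
  obtain ⟨g, hg⟩ := hf
  rw [p.localize_eq f hg, contDiff_iff_contDiffAt]
  intro y
  by_cases hy : y ∈ tsupport p.cutoff
  · have hφ : ContDiffAt ℝ ∞ p.param y :=
      p.contDiffOn_param.contDiffAt (p.isOpen_source.mem_nhds (p.tsupport_cutoff hy))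
    exact (Complex.ofRealCLM.contDiff.contDiffAt.comp y p.contDiff_cutoff.contDiffAt).mul
      (hg.1.contDiffAt.comp y hφ)
  · have : (fun y => (p.cutoff y : ℂ) * g (p.param y)) =ᶠ[𝓝 y] fun _ => 0 := by
      filter_upwards [(notMem_tsupport_iff_eventuallyEq.1 hy)] with z hz
      simp [hz]
    exact contDiffAt_const.congr_of_eventuallyEq this

theorem hasCompactSupport_localize (f : Γ → ℂ) : HasCompactSupport (p.localize f) := by
  refine p.hasCompactSupport_cutoff.mono fun y hy hc => hy ?_
  unfold localize
  split_ifs <;> simp [hc]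

/-- Localization as a linear map from `C^∞(Γ)` to the Schwartz space of `ℝ^{d-1}`. -/
def toSchwartz : smoothFun ℂ ℂ Γ →ₗ[ℂ] 𝓢(Space (d - 1), ℂ) where
  toFun f := (p.hasCompactSupport_localize f.1).toSchwartzMap (p.contDiff_localize f.1 f.2)
  map_add' f g := by
    ext y
    simp only [HasCompactSupport.toSchwartzMap_toFun, add_apply, localize]
    split_ifs <;> simp [mul_add]
  map_smul' c f := by
    ext y
    simp only [HasCompactSupport.toSchwartzMap_toFun, smul_apply, localize]
    split_ifs <;> simp [mul_left_comm]

end LocalPatch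

/-- The Bessel potential of order `t`, with Fourier symbol `(1 + |x|²)^{t/2}`, from the Schwartz
space to `L²`; thus `‖sobolevLift t g‖` is the norm of `g` in the Sobolev space `H^t(ℝ^n)`. -/
def sobolevLift {n : ℕ} (t : ℝ) :
    𝓢(Space n, ℂ) →ₗ[ℂ] Lp ℂ 2 (volume : Measure (Space n)) :=
  (SchwartzMap.toLpCLM ℂ ℂ 2 volume).toLinearMap ∘ₗ
    (SchwartzMap.fourierMultiplierCLM ℂ
      (fun x : Space n => (((1 + ‖x‖ ^ 2) ^ (t / 2) : ℝ) : ℂ))).toLinearMap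

/-- The space `C^∞(Γ, ℂ)` with the topology of `H^t(Γ)` (below). -/
def SmoothSobolev (Γ : Set (Space d)) (_t : ℝ) : Type := smoothFun ℂ ℂ Γ

namespace SmoothSobolev

variable {Γ : Set (Space d)} {t : ℝ}

instance : AddCommGroup (SmoothSobolev Γ t) := inferInstanceAs (AddCommGroup (smoothFun ℂ ℂ Γ))

instance : Module ℂ (SmoothSobolev Γ t) := inferInstanceAs (Module ℂ (smoothFun ℂ ℂ Γ))

/-- The function underlying an element of `C^∞(Γ, ℂ)`. -/
def toFun (f : SmoothSobolev Γ t) : Γ → ℂ := f.1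

variable (Γ t) in
/-- All the local Bessel potentials of a smooth function on `Γ`; the norm of the `p`-th component
is the `H^t(ℝ^{d-1})`-norm of the localization by the patch `p`. -/
def lift : SmoothSobolev Γ t →ₗ[ℂ]
    (LocalPatch Γ → Lp ℂ 2 (volume : Measure (Space (d - 1)))) :=
  LinearMap.pi fun p => sobolevLift t ∘ₗ p.toSchwartz

/-- The uniform structure on `C^∞(Γ, ℂ)` given by the seminorms
`f ↦ ‖χ · (f ∘ φ)‖_{H^t(ℝ^{d-1})}`, over all parametrizations `φ` and cutoff functions `χ`. -/
instance : UniformSpace (SmoothSobolev Γ t) := UniformSpace.comap (lift Γ t) inferInstance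

instance : IsUniformAddGroup (SmoothSobolev Γ t) := IsUniformAddGroup.comap (lift Γ t)

instance : UniformContinuousConstSMul ℂ (SmoothSobolev Γ t) where
  uniformContinuous_const_smul c := by
    refine uniformContinuous_comap' ?_
    have : (⇑(lift Γ t) ∘ fun x : SmoothSobolev Γ t => c • x) =
        (fun x => c • x) ∘ ⇑(lift Γ t) := by
      funext x
      simp
    rw [this]
    have hc : UniformContinuous (fun x : LocalPatch Γ →
        Lp ℂ 2 (volume : Measure (Space (d - 1))) => c • x) :=
      uniformContinuous_pi.2 fun p =>
        (uniformContinuous_const_smul c).comp (Pi.uniformContinuous_proj _ p)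
    exact hc.comp uniformContinuous_comap

end SmoothSobolev

/-- The Sobolev space `H^t(Γ)`, `t ∈ ℝ`: the completion of `C^∞(Γ, ℂ)` for the topology given by
the `H^t(ℝ^{d-1})`-norms of all localizations in local parametrizations. For a compact smooth
hypersurface finitely many patches suffice to generate this topology, so that `H^t(Γ)` is
the usual Hilbertizable space, and the topology on continuous linear maps (uniform convergence on
bounded sets) is the operator norm topology. -/
abbrev Sobolev (Γ : Set (Space d)) (t : ℝ) : Type :=
  UniformSpace.Completion (SmoothSobolev Γ t)

/-- `H^t(Γ)^d`, the Sobolev space of vector functions. -/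
abbrev VectorSobolev (Γ : Set (Space d)) (t : ℝ) : Type :=
  Fin d → Sobolev Γ t

variable {Γ : Set (Space d)}

/-- The operator `A` maps smooth functions on `Γ` to smooth functions on `Γ`, and `T` is a
continuous linear map `H^s(Γ) → H^t(Γ)` that agrees with `A` on smooth functions. As the smooth
functions are dense, there is at most one such `T`. -/
def IsSobolevExtension {s t : ℝ} (A : (Γ → ℂ) → (Γ → ℂ)) (T : Sobolev Γ s →L[ℂ] Sobolev Γ t) :
    Prop :=
  ∀ u : SmoothSobolev Γ s, ∃ v : SmoothSobolev Γ t, v.toFun = A u.toFun ∧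
    T (u : Sobolev Γ s) = (v : Sobolev Γ t)

open Classical in
/-- The extension of an operator `A` on smooth functions to a continuous linear map
`H^s(Γ) → H^t(Γ)` (zero if there is none). -/
def sobolevExtension (s t : ℝ) (A : (Γ → ℂ) → (Γ → ℂ)) : Sobolev Γ s →L[ℂ] Sobolev Γ t :=
  if h : ∃ T : Sobolev Γ s →L[ℂ] Sobolev Γ t, IsSobolevExtension A T then h.choose else 0

/-- Multiplication by a smooth function `a`, as an operator on `H^t(Γ)`. -/
def mulOp (t : ℝ) (a : Γ → ℂ) : Sobolev Γ t →L[ℂ] Sobolev Γ t :=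
  sobolevExtension t t fun f => a * f

end Sobolev

/-- The operator `G(r) = τ_r ∇_{Γ_r} τ_r⁻¹` from `H^{t+1}(Γ)` to `H^t(Γ)^d`. -/
def gradOp {d : ℕ} (Ω : SmoothDomain d) (t : ℝ) (r : Deformation Ω.boundary) :
    Sobolev (Ω.boundary : Set (Space d)) (t + 1) →L[ℂ]
      VectorSobolev (Ω.boundary : Set (Space d)) t :=
  ContinuousLinearMap.pi fun i => sobolevExtension (t + 1) t (pulledGradient Ω r i)

/-- The value at `u` of the first derivative of `G` at `r` in the direction `ξ`:
`-[G(r) ξ] G(r) u + (G(r) u · [G(r) ξ] N(r)) N(r)`. -/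
def gradDeriv {d : ℕ} (Ω : SmoothDomain d) (t : ℝ) (r ξ : Deformation Ω.boundary)
    (u : Sobolev (Ω.boundary : Set (Space d)) (t + 1)) :
    VectorSobolev (Ω.boundary : Set (Space d)) t := fun j =>
  -(∑ i, mulOp t (pulledGradientMatrix Ω r ξ j i) (gradOp Ω t r u i)) +
    mulOp t (fun x => (normalN Ω r x j : ℂ))
      (∑ k, mulOp t (fun x => ∑ i, pulledGradientMatrix Ω r ξ k i x * (normalN Ω r x i : ℂ))
        (gradOp Ω t r u k))

/-- `ε` is so small that `Id + r` is a diffeomorphism from `Γ` onto `Γ_r` for all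
`r ∈ B^∞(0, ε)`. -/
def IsAdmissibleRadius {d : ℕ} (Ω : SmoothDomain d) (ε : ℝ) : Prop :=
  0 < ε ∧ ∀ r ∈ Deformation.ball Ω.boundary ε, r.IsDiffeo

end

end ShapeCalculus

open ShapeCalculus

/-! Pulled back to the fixed surface Γ, the deformed tangential gradient is the fixed tangential
gradient followed by multiplication with a matrix of smooth functions: G(r) = B(r) ∇_Γ. All
dependence on r sits in B(r), so the theorem splits into algebra over C^∞(Γ) and two mapping
properties of Sobolev spaces.

The algebra: let D_k be the derivative along the tangential projection of e_k, H = 1 + (D_k r_j)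
with row index j and column index k, S = Hᵀ - n nᵀ and w = cof(H) n. Since Id + Dr differs from H by
a matrix u nᵀ, and such a rank one term does not change cof(·) n, this w is w_r
(`normalWVec_apply`). If q is the full gradient on Γ_r of an extension of the pushed forward
function, the chain rule gives ∇_Γ u = S q, while G(r) u = (1 - w wᵀ / (w·w)) q. The matrix B = (S +
n wᵀ)⁻¹ (1 - n nᵀ) satisfies B S = 1 - w wᵀ / (w·w), whence G(r) u = B ∇_Γ u (`pulledGradient_eq`).
Here det (S + n wᵀ) = w·w, which has no zeros because Id + r is a diffeomorphism
(`normalW_ne_zero`).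

Smoothness: r ↦ D_k r_j is continuous and linear into the Fréchet algebra C^∞(Γ), in which
multiplication and inversion of units are continuous (`SmoothAlgebra.continuousAt_ringInverse`). The
entries of B are rational in the D_k r_j with invertible denominator w·w, hence C^∞ by the product
and quotient rules. Finally a ↦ (multiplication by a) is a continuous linear map from C^∞(Γ) to the
operators on H^t(Γ) (`continuous_sobolevMul`), and D_k : H^{t+1}(Γ) → H^t(Γ) is bounded
(`continuous_smoothGrad`). Both rest on one estimate in ℝ^{d-1}, obtained from the inequalities of
Peetre and Young (`norm_sobolevLift_mul_le`).

The derivative is found without differentiating the formula for B: linearizing wᵀ B = 0, S B = 1 - n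
nᵀ and S w = 0 determines B' (`eq_of_linearized`). With S' = (D_k ξ_i) one has B S' = [G(r) ξ], and
w wᵀ / (w·w) = N Nᵀ, which turns B' into the stated formula. -/

namespace ShapeCalculus

noncomputable section

/-! ### Sobolev norm estimates on ℝ^n -/

open FourierTransform

/-- The symbol of the Bessel potential. -/
def besselSymbol {n : ℕ} (t : ℝ) (x : Space n) : ℝ := (1 + ‖x‖ ^ 2) ^ (t / 2)

theorem besselSymbol_nonneg {n : ℕ} (t : ℝ) (x : Space n) : 0 ≤ besselSymbol t x := by
  unfold besselSymbol; positivity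

theorem hasTemperateGrowth_besselSymbol {n : ℕ} (t : ℝ) :
    (fun x : Space n => (besselSymbol t x : ℂ)).HasTemperateGrowth := by
  unfold besselSymbol
  fun_prop

/-- Plancherel: the estimates below become pointwise or convolution estimates on the Fourier side.
-/
theorem norm_sobolevLift {n : ℕ} (t : ℝ) (g : 𝓢(Space n, ℂ)) :
    ‖sobolevLift t g‖ =
      ‖(SchwartzMap.smulLeftCLM ℂ (fun x : Space n => (besselSymbol t x : ℂ)) (𝓕 g)).toLp 2‖ := by
  rw [← SchwartzMap.norm_fourier_toL2_eq, ← FourierTransform.fourier_fourierInv_eq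
    (E := 𝓢(Space n, ℂ)) (F := 𝓢(Space n, ℂ)) (SchwartzMap.smulLeftCLM ℂ
    (fun x : Space n => (besselSymbol t x : ℂ)) (𝓕 g)), SchwartzMap.norm_fourier_toL2_eq,
    SchwartzMap.norm_fourier_toL2_eq]
  rfl

theorem norm_smulLeftCLM_besselSymbol {n : ℕ} (t : ℝ) (f : 𝓢(Space n, ℂ)) (x : Space n) :
    ‖SchwartzMap.smulLeftCLM ℂ (fun x : Space n => (besselSymbol t x : ℂ)) f x‖ =
      besselSymbol t x * ‖f x‖ := by
  rw [SchwartzMap.smulLeftCLM_apply_apply (hasTemperateGrowth_besselSymbol t), norm_smul,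
    Complex.norm_real, Real.norm_of_nonneg (besselSymbol_nonneg t x)]

theorem norm_toLp_two_le {n : ℕ} {f g : 𝓢(Space n, ℂ)} {C : ℝ}
    (h : ∀ x, ‖f x‖ ≤ C * ‖g x‖) : ‖f.toLp 2‖ ≤ C * ‖g.toLp 2‖ := by
  refine Lp.norm_le_mul_norm_of_ae_le_mul ?_
  filter_upwards [f.coeFn_toLp 2, g.coeFn_toLp 2] with x hf hg
  rw [hf, hg]
  exact h x

/-- Peetre's inequality. -/
theorem besselSymbol_le_mul {n : ℕ} (t : ℝ) (x y : Space n) :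
    besselSymbol t x ≤ 2 ^ (|t| / 2) * besselSymbol |t| y * besselSymbol t (x - y) := by
  have key : ∀ x y : Space n, 1 + ‖x‖ ^ 2 ≤ 2 * (1 + ‖y‖ ^ 2) * (1 + ‖x - y‖ ^ 2) := by
    intro x y
    have h1 : ‖x‖ ≤ ‖y‖ + ‖x - y‖ := by
      simpa using norm_add_le y (x - y)
    have h2 := pow_le_pow_left₀ (norm_nonneg x) h1 2
    nlinarith [sq_nonneg (‖y‖ - ‖x - y‖), mul_nonneg (sq_nonneg ‖y‖) (sq_nonneg ‖x - y‖)]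
  unfold besselSymbol
  rcases le_total 0 t with ht | ht
  · rw [abs_of_nonneg ht, ← Real.mul_rpow (by positivity) (by positivity),
      ← Real.mul_rpow (by positivity) (by positivity)]
    exact Real.rpow_le_rpow (by positivity) (key x y) (by positivity)
  -- For negative t the elementary inequality is used with the roles of x and x - y exchanged,
  -- raised to the power -t/2, and inverted.
  · have h3 := key (x - y) (-y)
    rw [norm_neg, sub_neg_eq_add, sub_add_cancel] at h3
    have h4 := Real.rpow_le_rpow (by positivity) h3 (by linarith : 0 ≤ -t / 2)
    rw [Real.mul_rpow (by positivity) (by positivity),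
      Real.mul_rpow (by positivity) (by positivity)] at h4
    rw [abs_of_nonpos ht]
    have e : ∀ z : Space n, (1 + ‖z‖ ^ 2) ^ (t / 2) = ((1 + ‖z‖ ^ 2) ^ (-t / 2))⁻¹ := by
      intro z
      rw [← Real.rpow_neg (by positivity)]
      congr 1; ring
    rw [e x, e (x - y), ← div_eq_mul_inv, inv_eq_one_div, div_le_div_iff₀ (by positivity)
      (by positivity), one_mul]
    exact h4

/-- Young's inequality `L¹ * L² ⊆ L²`. -/
theorem lintegral_sq_convolution_le {n : ℕ} {k h : Space n → ENNReal} (hk : Measurable k)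
    (hh : Measurable h) :
    ∫⁻ x, (∫⁻ y, k y * h (x - y)) ^ 2 ≤ (∫⁻ y, k y) ^ 2 * ∫⁻ x, h x ^ 2 := by
  -- Cauchy–Schwarz after splitting k = k^{1/2} · k^{1/2}; Tonelli and translation invariance then
  -- finish.
  have cs : ∀ x, (∫⁻ y, k y * h (x - y)) ^ 2 ≤ (∫⁻ y, k y) * ∫⁻ y, k y * h (x - y) ^ 2 := by
    intro x
    have h1 := ENNReal.lintegral_mul_le_Lp_mul_Lq (volume : Measure (Space n))
      (p := 2) (q := 2) Real.HolderConjugate.two_two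
      (f := fun y => k y ^ (1 / 2 : ℝ)) (g := fun y => k y ^ (1 / 2 : ℝ) * h (x - y))
      (by fun_prop) (by fun_prop)
    have e1 : ∀ y, ((fun y => k y ^ (1 / 2 : ℝ)) * fun y => k y ^ (1 / 2 : ℝ) * h (x - y)) y =
        k y * h (x - y) := by
      intro y
      simp only [Pi.mul_apply]
      rw [← mul_assoc, ← ENNReal.rpow_add_of_nonneg _ _ (by norm_num) (by norm_num)]
      norm_num
    have e2 : ∀ y, (k y ^ (1 / 2 : ℝ)) ^ (2 : ℝ) = k y := by
      intro y
      rw [← ENNReal.rpow_mul]; norm_num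
    have e3 : ∀ y, (k y ^ (1 / 2 : ℝ) * h (x - y)) ^ (2 : ℝ) = k y * h (x - y) ^ 2 := by
      intro y
      rw [ENNReal.mul_rpow_of_nonneg _ _ (by norm_num), e2]
      norm_num
    simp only [e1, e2, e3] at h1
    calc _ ≤ ((∫⁻ y, k y) ^ (1 / 2 : ℝ) * (∫⁻ y, k y * h (x - y) ^ 2) ^ (1 / 2 : ℝ)) ^ 2 := by
          gcongr
      _ = _ := by
          rw [mul_pow, ← ENNReal.rpow_natCast, ← ENNReal.rpow_natCast, ← ENNReal.rpow_mul,
            ← ENNReal.rpow_mul]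
          norm_num
  calc _ ≤ ∫⁻ x, (∫⁻ y, k y) * ∫⁻ y, k y * h (x - y) ^ 2 := lintegral_mono cs
    _ = (∫⁻ y, k y) * ∫⁻ x, ∫⁻ y, k y * h (x - y) ^ 2 := by
        rw [lintegral_const_mul]
        exact Measurable.lintegral_prod_right' (f := fun p : Space n × Space n =>
          k p.2 * h (p.1 - p.2) ^ 2) (by fun_prop)
    _ = (∫⁻ y, k y) * ∫⁻ y, ∫⁻ x, k y * h (x - y) ^ 2 := by
        rw [lintegral_lintegral_swap]
        fun_prop
    _ = (∫⁻ y, k y) * ∫⁻ y, k y * ∫⁻ x, h x ^ 2 := by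
        congr 2
        funext y
        rw [lintegral_const_mul _ (by fun_prop),
          lintegral_sub_right_eq_self (fun x => h x ^ 2) y]
    _ = _ := by
        rw [lintegral_mul_const _ hk]
        ring

/-- The pointwise product of Schwartz functions. -/
abbrev schwartzMul {n : ℕ} (b g : 𝓢(Space n, ℂ)) : 𝓢(Space n, ℂ) :=
  SchwartzMap.pairing (ContinuousLinearMap.mul ℂ ℂ) b g

/-- The rule "transform of a convolution is a product", inverted, expresses `𝓕⁻` of a product as a
convolution; the reflection 𝓕 f (y) = 𝓕⁻ f (-y) passes from `𝓕⁻` to `𝓕`. -/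
theorem fourier_schwartzMul_apply {n : ℕ} (b g : 𝓢(Space n, ℂ)) (x : Space n) :
    𝓕 (schwartzMul b g) x = ∫ y, 𝓕 b y * 𝓕 g (x - y) := by
  have h0 : ∀ (f : 𝓢(Space n, ℂ)) (y : Space n), 𝓕 f y = 𝓕⁻ f (-y) := fun f y => by
    rw [SchwartzMap.fourierInv_apply_eq]
    simp [SchwartzMap.fourier_coe]
  have h1 : 𝓕⁻ (schwartzMul b g) =
      SchwartzMap.convolution (ContinuousLinearMap.mul ℂ ℂ) (𝓕⁻ b) (𝓕⁻ g) := by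
    rw [← FourierTransform.fourierInv_fourier_eq (E := 𝓢(Space n, ℂ)) (F := 𝓢(Space n, ℂ))
      (SchwartzMap.convolution (ContinuousLinearMap.mul ℂ ℂ) (𝓕⁻ b) (𝓕⁻ g)), SchwartzMap.fourier_convolution]
    simp
  rw [h0, h1, SchwartzMap.convolution_apply, convolution_def,
    ← integral_neg_eq_self (μ := volume)]
  refine integral_congr_ae (Eventually.of_forall fun y => ?_)
  simp only [ContinuousLinearMap.mul_apply', h0]
  congr 2
  abel

/-- The weighted `L¹`-norm `∫ 2^{|t|/2} (1+|y|²)^{|t|/2} |𝓕 b (y)| dy`. -/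
def multiplierNorm {n : ℕ} (t : ℝ) (b : 𝓢(Space n, ℂ)) : ℝ :=
  2 ^ (|t| / 2) * ∫ y, ‖SchwartzMap.smulLeftCLM ℂ (fun x : Space n => (besselSymbol |t| x : ℂ))
    (𝓕 b) y‖

theorem multiplierNorm_nonneg {n : ℕ} (t : ℝ) (b : 𝓢(Space n, ℂ)) : 0 ≤ multiplierNorm t b :=
  mul_nonneg (by positivity) (integral_nonneg fun _ => norm_nonneg _)

/-- Peetre's inequality distributes the weight at x over y and x - y, so the weighted transform of b
g is dominated by the convolution of the weighted transforms, and Young's inequality applies. The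
explicit constant matters: it tends to 0 with b. -/
theorem norm_sobolevLift_mul_le {n : ℕ} (t : ℝ) (b g : 𝓢(Space n, ℂ)) :
    ‖sobolevLift t (schwartzMul b g)‖ ≤ multiplierNorm t b * ‖sobolevLift t g‖ := by
  rw [norm_sobolevLift, norm_sobolevLift]
  set S := fun t : ℝ => SchwartzMap.smulLeftCLM ℂ (fun x : Space n => (besselSymbol t x : ℂ))
    with hS
  set k : Space n → ENNReal := fun y => ENNReal.ofReal (2 ^ (|t| / 2)) * ‖S |t| (𝓕 b) y‖ₑ with hk
  set h : Space n → ENNReal := fun y => ‖S t (𝓕 g) y‖ₑ with hh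
  have hkm : Measurable k :=
    ((S |t| (𝓕 b)).continuous.measurable.enorm).const_mul _
  have hhm : Measurable h := (S t (𝓕 g)).continuous.measurable.enorm
  have hpt : ∀ x, ‖S t (𝓕 (schwartzMul b g)) x‖ₑ ≤ ∫⁻ y, k y * h (x - y) := by
    intro x
    rw [hS, SchwartzMap.smulLeftCLM_apply_apply (hasTemperateGrowth_besselSymbol t),
      fourier_schwartzMul_apply, enorm_smul]
    refine (mul_le_mul_right (enorm_integral_le_lintegral_enorm _) _).trans ?_
    rw [← lintegral_const_mul' _ _ (by simp)]
    refine lintegral_mono fun y => ?_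
    simp only [hk, hh, hS]
    rw [enorm_mul, ← ofReal_norm, ← ofReal_norm, ← ofReal_norm, ← ofReal_norm, ← ofReal_norm,
      norm_smulLeftCLM_besselSymbol, norm_smulLeftCLM_besselSymbol,
      Complex.norm_real, Real.norm_of_nonneg (besselSymbol_nonneg t x),
      ← ENNReal.ofReal_mul (by positivity), ← ENNReal.ofReal_mul (besselSymbol_nonneg t x),
      ← ENNReal.ofReal_mul (by positivity), ← ENNReal.ofReal_mul
        (mul_nonneg (by positivity) (mul_nonneg (besselSymbol_nonneg _ _) (norm_nonneg _)))]
    refine ENNReal.ofReal_le_ofReal ?_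
    calc _ ≤ (2 ^ (|t| / 2) * besselSymbol |t| y * besselSymbol t (x - y)) *
          (‖𝓕 b y‖ * ‖𝓕 g (x - y)‖) :=
          mul_le_mul_of_nonneg_right (besselSymbol_le_mul t x y) (by positivity)
      _ = _ := by ring
  have hY := (lintegral_mono fun x => pow_le_pow_left₀ zero_le (hpt x) 2).trans
    (lintegral_sq_convolution_le hkm hhm)
  have hkI : ∫⁻ y, k y = ENNReal.ofReal (multiplierNorm t b) := by
    rw [hk, lintegral_const_mul _ (S |t| (𝓕 b)).continuous.measurable.enorm, multiplierNorm,
      ENNReal.ofReal_mul (by positivity),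
      ← ofReal_integral_norm_eq_lintegral_enorm (S |t| (𝓕 b)).integrable]
  have hsq : ∀ f : 𝓢(Space n, ℂ), ENNReal.ofReal (‖f.toLp 2‖ ^ 2) = ∫⁻ x, ‖f x‖ₑ ^ 2 := by
    intro f
    rw [SchwartzMap.norm_toLp, ENNReal.ofReal_pow ENNReal.toReal_nonneg,
      ENNReal.ofReal_toReal (f.memLp 2 volume).eLpNorm_ne_top,
      eLpNorm_eq_lintegral_rpow_enorm_toReal (by norm_num) (by norm_num),
      ← ENNReal.rpow_natCast, ← ENNReal.rpow_mul]
    norm_num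
  rw [← hsq, ← hsq, hkI, ← ENNReal.ofReal_pow (multiplierNorm_nonneg t b),
    ← ENNReal.ofReal_mul (by positivity), ENNReal.ofReal_le_ofReal_iff (by positivity),
    ← mul_pow] at hY
  exact le_of_sq_le_sq hY (mul_nonneg (multiplierNorm_nonneg t b) (norm_nonneg _))

/-- The constant is a multiple of the norm of the image of b under a continuous linear map into L¹.
-/
theorem tendsto_multiplierNorm {n : ℕ} (t : ℝ) :
    Tendsto (multiplierNorm (n := n) t) (𝓝 0) (𝓝 0) := by
  have h1 : Tendsto (fun b : 𝓢(Space n, ℂ) => SchwartzMap.toLpCLM ℂ ℂ 1 volume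
      (SchwartzMap.smulLeftCLM ℂ (fun x : Space n => (besselSymbol |t| x : ℂ))
        (fourierCLM ℂ 𝓢(Space n, ℂ) b))) (𝓝 0) (𝓝 0) := by
    refine Continuous.tendsto' ?_ _ _ (by simp only [map_zero])
    fun_prop
  have h2 := (h1.norm.const_mul (2 ^ (|t| / 2) : ℝ))
  rw [norm_zero, mul_zero] at h2
  refine h2.congr fun b => ?_
  simp only [SchwartzMap.toLpCLM_apply]
  rw [SchwartzMap.norm_toLp_one]
  rfl

theorem norm_sobolevLift_le_succ {n : ℕ} (t : ℝ) (g : 𝓢(Space n, ℂ)) :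
    ‖sobolevLift t g‖ ≤ ‖sobolevLift (t + 1) g‖ := by
  rw [norm_sobolevLift, norm_sobolevLift, ← one_mul ‖SchwartzMap.toLp (SchwartzMap.smulLeftCLM ℂ
    (fun x : Space n => (besselSymbol (t + 1) x : ℂ)) (𝓕 g)) 2 volume‖]
  refine norm_toLp_two_le fun x => ?_
  rw [norm_smulLeftCLM_besselSymbol, norm_smulLeftCLM_besselSymbol, one_mul]
  refine mul_le_mul_of_nonneg_right ?_ (norm_nonneg _)
  exact Real.rpow_le_rpow_of_exponent_le (by nlinarith [sq_nonneg ‖x‖]) (by linarith)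

open LineDeriv in
-- On the Fourier side the derivative is multiplication by 2πi⟨x, m⟩, and the factor |x| is absorbed
-- by (1 + |x|²)^{1/2}, at the price of one Sobolev order.
theorem norm_sobolevLift_lineDeriv_le {n : ℕ} (t : ℝ) (m : Space n) (g : 𝓢(Space n, ℂ)) :
    ‖sobolevLift t (∂_{m} g : 𝓢(Space n, ℂ))‖ ≤ 2 * Real.pi * ‖m‖ * ‖sobolevLift (t + 1) g‖ := by
  rw [norm_sobolevLift, norm_sobolevLift]
  refine norm_toLp_two_le fun x => ?_
  rw [norm_smulLeftCLM_besselSymbol, norm_smulLeftCLM_besselSymbol,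
    SchwartzMap.fourier_lineDerivOp_eq, smul_apply, norm_smul,
    SchwartzMap.smulLeftCLM_apply_apply (by fun_prop), norm_smul]
  have h1 : ‖inner ℝ x m‖ ≤ ‖x‖ * ‖m‖ := norm_inner_le_norm x m
  have h2 : besselSymbol t x * ‖x‖ ≤ besselSymbol (t + 1) x := by
    unfold besselSymbol
    rw [add_div, Real.rpow_add (by positivity), ← Real.sqrt_eq_rpow]
    refine mul_le_mul_of_nonneg_left (Real.le_sqrt_of_sq_le (by linarith)) (by positivity)
  have h3 : ‖(2 * Real.pi * Complex.I : ℂ)‖ = 2 * Real.pi := by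
    simp [abs_of_pos Real.pi_pos]
  rw [h3]
  calc besselSymbol t x * (2 * Real.pi * (‖inner ℝ x m‖ * ‖𝓕 g x‖))
      ≤ besselSymbol t x * (2 * Real.pi * (‖x‖ * ‖m‖ * ‖𝓕 g x‖)) := by
        have := besselSymbol_nonneg t x
        gcongr
    _ = 2 * Real.pi * ‖m‖ * ((besselSymbol t x * ‖x‖) * ‖𝓕 g x‖) := by ring
    _ ≤ _ := by gcongr

/-! ### The geometry of a smooth boundary -/

section Geometry

variable {d : ℕ}

theorem inner_gradient_left {ρ : Space d → ℝ} (x v : Space d) :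
    inner ℝ (gradient ρ x) v = fderiv ℝ ρ x v := by
  rw [gradient, InnerProductSpace.toDual_symm_apply]

namespace IsLocalDefiningFunction

variable {Ω : Set (Space d)} {x : Space d} {ρ : Space d → ℝ}

theorem fderiv_ne (h : IsLocalDefiningFunction Ω x ρ) : fderiv ℝ ρ x ≠ 0 := fun h0 =>
  h.gradient_ne (by simp [gradient, h0])

theorem eventually_gradient_ne (h : IsLocalDefiningFunction Ω x ρ) :
    ∀ᶠ y in 𝓝 x, gradient ρ y ≠ 0 := by
  have hc : Continuous (gradient ρ) :=
    (InnerProductSpace.toDual ℝ (Space d)).symm.continuous.comp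
      (h.smooth.continuous_fderiv (by simp))
  exact hc.continuousAt.eventually_ne h.gradient_ne

theorem eventually_of_eq_zero (h : IsLocalDefiningFunction Ω x ρ) :
    ∀ᶠ y in 𝓝 x, ρ y = 0 → IsLocalDefiningFunction Ω y ρ := by
  filter_upwards [h.eventually_gradient_ne, h.mem_iff.eventually_nhds] with y h1 h2 h3
  exact ⟨h.smooth, h3, h1, h2⟩

/-- If x were not in the closure, ρ would be nonnegative near x and have a local minimum there,
against the nonvanishing gradient. -/
theorem mem_frontier (h : IsLocalDefiningFunction Ω x ρ) : x ∈ frontier Ω := by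
  refine ⟨?_, fun hx => ?_⟩
  · rw [mem_closure_iff_frequently]
    intro hne
    refine h.fderiv_ne (IsLocalMin.fderiv_eq_zero ?_)
    filter_upwards [hne, h.mem_iff] with y h1 h2
    rw [h.eq_zero]
    exact not_lt.1 fun h3 => h1 (h2.2 h3)
  · have := h.mem_iff.self_of_nhds.1 (interior_subset hx)
    rw [h.eq_zero] at this
    exact lt_irrefl _ this

theorem eq_zero_of_mem_frontier (h : IsLocalDefiningFunction Ω x ρ) :
    ∀ᶠ y in 𝓝 x, y ∈ frontier Ω → ρ y = 0 := by
  filter_upwards [h.mem_iff.eventually_nhds] with y hy hf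
  refine le_antisymm ?_ (not_lt.1 fun hlt => ?_)
  · have h1 : ∃ᶠ z in 𝓝 y, z ∈ Ω := mem_closure_iff_frequently.1 hf.1
    refine le_of_tendsto_of_frequently (h.smooth.continuous.tendsto y) ?_
    exact (h1.and_eventually hy).mono fun z hz => (hz.2.1 hz.1).le
  · refine hf.2 (mem_interior_iff_mem_nhds.2 ?_)
    filter_upwards [hy, (h.smooth.continuous.tendsto y).eventually (gt_mem_nhds hlt)] with z h1 h2
    exact h1.2 h2

theorem eventually_mem_frontier (h : IsLocalDefiningFunction Ω x ρ) :
    ∀ᶠ y in 𝓝 x, y ∈ frontier Ω → IsLocalDefiningFunction Ω y ρ := by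
  filter_upwards [h.eventually_of_eq_zero, h.eq_zero_of_mem_frontier] with y h1 h2 h3
  exact h1 (h2 h3)

/-- The derivative of a function that vanishes on the boundary is a multiple of the derivative of
the defining function. -/
theorem exists_fderiv_eq_smul (h : IsLocalDefiningFunction Ω x ρ) {f : Space d → ℝ}
    (hf : ContDiffAt ℝ 1 f x) (h0 : ∀ᶠ y in 𝓝 x, y ∈ frontier Ω → f y = 0) :
    ∃ c : ℝ, fderiv ℝ f x = c • fderiv ℝ ρ x := by
  -- Near x the level set of ρ lies in the boundary, where f vanishes; so x is a degenerate
  -- constrained extremum and Lagrange multipliers apply.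
  have hext : IsLocalExtrOn f {y | ρ y = ρ x} x := by
    left
    rw [IsMinFilter, eventually_nhdsWithin_iff]
    filter_upwards [h0, h.eventually_of_eq_zero] with y h1 h2 h3
    rw [h.eq_zero] at h3
    rw [h0.self_of_nhds h.mem_frontier, h1 (h2 h3).mem_frontier]
  obtain ⟨a, b, hab, he⟩ := hext.exists_multipliers_of_hasStrictFDerivAt_1d
    (h.smooth.contDiffAt.hasStrictFDerivAt (by simp)) (hf.hasStrictFDerivAt (by simp))
  have hb : b ≠ 0 := by
    rintro rfl
    have ha : a ≠ 0 := fun ha => hab (by simp [ha])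
    rw [zero_smul, add_zero, smul_eq_zero] at he
    exact he.elim ha h.fderiv_ne
  refine ⟨-(b⁻¹ * a), ?_⟩
  have : b • fderiv ℝ f x = -(a • fderiv ℝ ρ x) := by
    rw [eq_neg_iff_add_eq_zero, add_comm, he]
  calc fderiv ℝ f x = b⁻¹ • (b • fderiv ℝ f x) := by rw [smul_smul, inv_mul_cancel₀ hb, one_smul]
    _ = _ := by rw [this, smul_neg, smul_smul, neg_smul]

/-- This makes the outer normal independent of the defining function. The gradients are parallel by
the Lagrange argument; the factor is positive because both functions are negative on the same side.
-/
theorem normalized_gradient_eq {σ : Space d → ℝ} (h : IsLocalDefiningFunction Ω x ρ)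
    (h' : IsLocalDefiningFunction Ω x σ) :
    ‖gradient σ x‖⁻¹ • gradient σ x = ‖gradient ρ x‖⁻¹ • gradient ρ x := by
  obtain ⟨c, hc⟩ := h.exists_fderiv_eq_smul (h'.smooth.contDiffAt.of_le (by simp))
    h'.eq_zero_of_mem_frontier
  have hg : gradient σ x = c • gradient ρ x := by
    rw [gradient, hc, map_smul]; rfl
  have hc0 : c ≠ 0 := by
    rintro rfl
    exact h'.gradient_ne (by simp [hg])
  have hpos : 0 < c := by
    refine lt_of_le_of_ne (not_lt.1 fun hneg => ?_) hc0.symm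
    set v := gradient ρ x with hv
    have hline : HasDerivAt (fun s : ℝ => x + s • v) v 0 := by
      simpa using ((hasDerivAt_id (0 : ℝ)).smul_const v).const_add x
    have hd : ∀ τ : Space d → ℝ, ContDiff ℝ ∞ τ →
        HasDerivAt (fun s : ℝ => τ (x + s • v)) (inner ℝ (gradient τ x) v) 0 := by
      intro τ hτ
      have hτ' : HasFDerivAt τ (fderiv ℝ τ x) (x + (0 : ℝ) • v) := by
        simpa using (hτ.differentiable (by simp) x).hasFDerivAt
      rw [inner_gradient_left]
      exact hτ'.comp_hasDerivAt (0 : ℝ) hline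
    have hvv : 0 < inner ℝ v v := real_inner_self_pos.2 h.gradient_ne
    have h1 := eventually_nhdsWithin_sign_eq_of_deriv_pos (f := fun s : ℝ => ρ (x + s • v))
      (x₀ := 0) (by rw [(hd ρ h.smooth).deriv]; exact hvv) (by simp [h.eq_zero])
    have h2 := eventually_nhdsWithin_sign_eq_of_deriv_neg (f := fun s : ℝ => σ (x + s • v))
      (x₀ := 0) (by
        rw [(hd σ h'.smooth).deriv, hg, inner_smul_left]
        exact mul_neg_of_neg_of_pos hneg hvv) (by simp [h'.eq_zero])
    have ht : Tendsto (fun s : ℝ => x + s • v) (𝓝 0) (𝓝 x) := by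
      simpa using hline.continuousAt.tendsto
    have h3 := ht.eventually (h.mem_iff.and h'.mem_iff)
    -- For small s < 0 the point x + s v has ρ < 0, so it lies in Ω, whereas a negative factor c
    -- would give σ > 0 there.
    obtain ⟨s, ⟨hs1, hs2, hs3⟩, hs⟩ :=
      ((h1.and (h2.and h3)).filter_mono nhdsWithin_le_nhds |>.and
        (self_mem_nhdsWithin : Iio (0 : ℝ) ∈ 𝓝[<] 0)).exists
    have hs : s < 0 := hs
    rw [sub_zero, sign_neg hs, sign_eq_neg_one_iff] at hs1
    rw [zero_sub, sign_pos (neg_pos.2 hs : 0 < -s), sign_eq_one_iff] at hs2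
    exact lt_asymm hs2 (hs3.2.1 (hs3.1.2 hs1))
  rw [hg, norm_smul, smul_smul, Real.norm_of_nonneg hpos.le]
  congr 1
  field_simp

end IsLocalDefiningFunction

variable (Ω : SmoothDomain d)

theorem SmoothDomain.normal_eq {x : Ω.boundary} {ρ : Space d → ℝ}
    (h : IsLocalDefiningFunction Ω.carrier x ρ) :
    Ω.normal x = ‖gradient ρ x‖⁻¹ • gradient ρ x := by
  have hex : ∃ ν, IsOuterUnitNormal Ω.carrier x ν := ⟨_, ρ, h, rfl⟩
  obtain ⟨σ, hσ, e⟩ := hex.choose_spec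
  rw [SmoothDomain.normal, dif_pos hex, e, h.normalized_gradient_eq hσ]

theorem SmoothDomain.exists_definingFunction (x : Ω.boundary) :
    ∃ ρ, IsLocalDefiningFunction Ω.carrier x ρ :=
  Ω.smooth_frontier x x.2

theorem SmoothDomain.norm_normal (x : Ω.boundary) : ‖Ω.normal x‖ = 1 := by
  obtain ⟨ρ, h⟩ := Ω.exists_definingFunction x
  rw [Ω.normal_eq h, norm_smul, norm_inv, norm_norm, inv_mul_cancel₀]
  exact norm_ne_zero_iff.2 h.gradient_ne

/-- The derivative of a function that vanishes on the boundary vanishes in tangential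
directions. -/
theorem SmoothDomain.fderiv_eq_zero_of_inner_normal {F : Type*} [NormedAddCommGroup F]
    [NormedSpace ℝ F] {x : Ω.boundary} {f : Space d → F} (hf : ContDiffAt ℝ 1 f x)
    (h0 : ∀ᶠ y in 𝓝 (x : Space d), y ∈ frontier Ω.carrier → f y = 0) {v : Space d}
    (hv : inner ℝ (Ω.normal x) v = 0) : fderiv ℝ f x v = 0 := by
  obtain ⟨ρ, h⟩ := Ω.exists_definingFunction x
  have hv' : fderiv ℝ ρ x v = 0 := by
    rw [Ω.normal_eq h, inner_smul_left, inner_gradient_left, mul_eq_zero] at hv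
    refine hv.resolve_left ?_
    simpa using h.gradient_ne
  -- Continuous functionals reduce the vector valued case to the scalar one, where Df is a multiple
  -- of Dρ.
  refine SeparatingDual.eq_zero_of_forall_dual_eq_zero (R := ℝ) fun ℓ => ?_
  obtain ⟨c, hc⟩ := h.exists_fderiv_eq_smul (f := fun y => ℓ (f y))
    (ℓ.contDiff.contDiffAt.comp _ hf) (h0.mono fun y hy hm => by simp [hy hm])
  have := (ℓ.hasFDerivAt.comp (x : Space d) (hf.differentiableAt (by simp)).hasFDerivAt).fderiv
  have h2 : fderiv ℝ (fun y => ℓ (f y)) x v = ℓ (fderiv ℝ f x v) := by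
    change fderiv ℝ (ℓ ∘ f) x v = _
    rw [this]; rfl
  rw [← h2, hc]
  simp [hv']

/-- Smoothness of a function on a subset is a local property. -/
theorem exists_isSmoothExtension_of_local {S : Set (Space d)} {F : Type*} [NormedAddCommGroup F]
    [NormedSpace ℝ F] (hS : IsClosed S) {f : S → F}
    (h : ∀ x ∈ S, ∃ U ∈ 𝓝 x, ∃ g : Space d → F, ContDiffOn ℝ ∞ g U ∧
      ∀ (y) (hy : y ∈ S), y ∈ U → g y = f ⟨y, hy⟩) :
    ∃ g, IsSmoothExtension f g := by
  -- The admissible values at x form a convex set, a single point on S and everything off S, so a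
  -- partition of unity glues the local extensions.
  have := exists_contMDiffMap_forall_mem_convex_of_local (n := ⊤)
    (modelWithCornersSelf ℝ (Space d)) (M := Space d) (F := F)
    (t := fun x => {c | ∀ hx : x ∈ S, c = f ⟨x, hx⟩}) (fun x => ?_) (fun x => ?_)
  · obtain ⟨g, hg⟩ := this
    exact ⟨g, g.contMDiff.contDiff, fun x => hg x x.2⟩
  · intro a ha b hb s t hs ht hst hx
    rw [ha hx, hb hx, ← add_smul, hst, one_smul]
  · by_cases hx : x ∈ S
    · obtain ⟨U, hU, g, hg, e⟩ := h x hx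
      exact ⟨U, hU, g, hg.contMDiffOn, fun y hy hyS => e y hyS hy⟩
    · exact ⟨Sᶜ, hS.isOpen_compl.mem_nhds hx, 0, contMDiffOn_const, fun y hy hyS => (hy hyS).elim⟩

theorem SmoothDomain.exists_isSmoothExtension_normal :
    ∃ N : Space d → Space d, IsSmoothExtension (S := (Ω.boundary : Set (Space d))) Ω.normal N := by
  refine exists_isSmoothExtension_of_local Ω.boundary.isCompact.isClosed fun x hx => ?_
  obtain ⟨ρ, h⟩ := Ω.exists_definingFunction ⟨x, hx⟩
  obtain ⟨U, hU, ho, hxU⟩ := eventually_nhds_iff.1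
    (h.eventually_mem_frontier.and h.eventually_gradient_ne)
  refine ⟨U, ho.mem_nhds hxU, fun y => ‖gradient ρ y‖⁻¹ • gradient ρ y, ?_, fun y hy hyU =>
    (Ω.normal_eq (x := ⟨y, hy⟩) ((hU y hyU).1 hy)).symm⟩
  have hs : ContDiff ℝ ∞ (gradient ρ) :=
    (InnerProductSpace.toDual ℝ (Space d)).symm.contDiff.comp
      (h.smooth.fderiv_right (by simp))
  exact ((hs.contDiffOn.norm ℝ fun y hy => (hU y hy).2).inv
    fun y hy => norm_ne_zero_iff.2 (hU y hy).2).smul hs.contDiffOn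

end Geometry

/-! ### The Fréchet algebra of smooth functions -/

/-- The smooth complex functions on `Γ` as a subalgebra of all functions. -/
def smoothSubalgebra {d : ℕ} (Γ : Set (Space d)) : Subalgebra ℝ (Γ → ℂ) where
  carrier := {f | ∃ g, IsSmoothExtension f g}
  mul_mem' := by
    rintro f₁ f₂ ⟨g₁, h₁, e₁⟩ ⟨g₂, h₂, e₂⟩
    exact ⟨g₁ * g₂, h₁.mul h₂, fun x => by simp [e₁, e₂]⟩
  add_mem' := by
    rintro f₁ f₂ ⟨g₁, h₁, e₁⟩ ⟨g₂, h₂, e₂⟩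
    exact ⟨g₁ + g₂, h₁.add h₂, fun x => by simp [e₁, e₂]⟩
  algebraMap_mem' c := ⟨fun _ => (c : ℂ), contDiff_const, fun x => rfl⟩

/-- The algebra `C^∞(Γ, ℂ)`, which carries its Fréchet topology (below). -/
def SmoothAlgebra {d : ℕ} (Γ : TopologicalSpace.Compacts (Space d)) : Type :=
  smoothSubalgebra (Γ : Set (Space d))

namespace SmoothAlgebra

variable {d : ℕ} {Γ : TopologicalSpace.Compacts (Space d)}

instance : CommRing (SmoothAlgebra Γ) :=
  inferInstanceAs (CommRing (smoothSubalgebra (Γ : Set (Space d))))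

instance : Algebra ℝ (SmoothAlgebra Γ) :=
  inferInstanceAs (Algebra ℝ (smoothSubalgebra (Γ : Set (Space d))))

/-- Evaluation at a point. -/
def eval (x : Pts Γ) : SmoothAlgebra Γ →ₐ[ℝ] ℂ :=
  (Pi.evalAlgHom ℝ (fun _ : Pts Γ => ℂ) x).comp (smoothSubalgebra (Γ : Set (Space d))).val

instance : CoeFun (SmoothAlgebra Γ) (fun _ => Pts Γ → ℂ) := ⟨fun a x => eval x a⟩

theorem ext {a b : SmoothAlgebra Γ} (h : ∀ x, a x = b x) : a = b :=
  Subtype.ext (funext h)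

/-- The element of the algebra given by a smooth function. -/
def mk (f : Pts Γ → ℂ) (h : ∃ g, IsSmoothExtension f g) : SmoothAlgebra Γ := ⟨f, h⟩

@[simp] theorem mk_apply (f : Pts Γ → ℂ) (h) (x : Pts Γ) : (mk f h : SmoothAlgebra Γ) x = f x := rfl

theorem exists_extension (a : SmoothAlgebra Γ) : ∃ g, IsSmoothExtension (fun x => a x) g := a.2

/-- The bounds for the derivatives up to order `k` of the smooth extensions of `a`. -/
def bounds (k : ℕ) (a : SmoothAlgebra Γ) : Set ℝ :=
  {C | 0 ≤ C ∧ ∃ g, IsSmoothExtension (fun x => a x) g ∧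
    ∀ m ≤ k, ∀ x, ‖iteratedFDeriv ℝ m g x‖ ≤ C}

/-- A smooth function on the whole space with compact support that is `1` on `Γ`. -/
theorem exists_cutoff (Γ : TopologicalSpace.Compacts (Space d)) :
    ∃ b : Space d → ℝ, ContDiff ℝ ∞ b ∧ HasCompactSupport b ∧ ∀ x ∈ Γ, b x = 1 := by
  obtain ⟨R, hR, hΓ⟩ := Γ.isCompact.isBounded.subset_closedBall_lt 0 0
  let b : ContDiffBump (0 : Space d) := ⟨R, R + 1, hR, by linarith⟩
  exact ⟨b, b.contDiff, b.hasCompactSupport, fun x hx => b.one_of_mem_closedBall (hΓ hx)⟩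

theorem exists_bound_iteratedFDeriv {E F : Type*} [NormedAddCommGroup E] [NormedSpace ℝ E]
    [NormedAddCommGroup F] [NormedSpace ℝ F] {g : E → F} (hg : ContDiff ℝ ∞ g)
    (hc : HasCompactSupport g) (k : ℕ) :
    ∃ C, 0 ≤ C ∧ ∀ m ≤ k, ∀ x, ‖iteratedFDeriv ℝ m g x‖ ≤ C := by
  have hB : ∀ m : ℕ, ∃ C, ∀ x, ‖iteratedFDeriv ℝ m g x‖ ≤ C := fun m =>
    (hc.iteratedFDeriv m).exists_bound_of_continuous
      (hg.continuous_iteratedFDeriv (by exact_mod_cast le_top))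
  choose C hC using hB
  have hC0 : ∀ m, 0 ≤ C m := fun m => (norm_nonneg _).trans (hC m 0)
  refine ⟨∑ m ∈ Finset.range (k + 1), C m, Finset.sum_nonneg fun m _ => hC0 m,
    fun m hm x => (hC m x).trans ?_⟩
  exact Finset.single_le_sum (f := C) (fun m _ => hC0 m)
    (Finset.mem_range.2 (Nat.lt_succ_of_le hm))

theorem bounds_nonempty (k : ℕ) (a : SmoothAlgebra Γ) : (bounds k a).Nonempty := by
  obtain ⟨g, hg, e⟩ := a.exists_extension
  obtain ⟨b, hb, hbc, hb1⟩ := exists_cutoff Γ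
  obtain ⟨C, hC0, hC⟩ := exists_bound_iteratedFDeriv (hb.smul hg) hbc.smul_right k
  exact ⟨C, hC0, fun x => b x • g x, ⟨hb.smul hg, fun x => by simp [hb1 x x.2, e]⟩, hC⟩

theorem bounds_bddBelow (k : ℕ) (a : SmoothAlgebra Γ) : BddBelow (bounds k a) :=
  ⟨0, fun _ h => h.1⟩

/-- The seminorm `inf sup_{m ≤ k} sup_x |D^m g(x)|` over all smooth extensions `g`. -/
def kNorm (k : ℕ) : Seminorm ℝ (SmoothAlgebra Γ) :=
  Seminorm.ofSMulLE (fun a => sInf (bounds k a))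
    (by
      refine le_antisymm (csInf_le (bounds_bddBelow k _) ⟨le_rfl, 0, ⟨contDiff_const,
        fun x => by simp⟩, fun m _ x => ?_⟩) (le_csInf (bounds_nonempty k _) fun _ h => h.1)
      simp)
    (by
      intro r s
      refine le_of_forall_pos_le_add fun ε hε => ?_
      obtain ⟨A, ⟨hA0, g, ⟨hg, eg⟩, hA⟩, hAlt⟩ :=
        Real.lt_sInf_add_pos (bounds_nonempty k r) (half_pos hε)
      obtain ⟨B, ⟨hB0, h, ⟨hh, eh⟩, hB⟩, hBlt⟩ :=
        Real.lt_sInf_add_pos (bounds_nonempty k s) (half_pos hε)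
      have : sInf (bounds k (r + s)) ≤ A + B := by
        refine csInf_le (bounds_bddBelow k _) ⟨add_nonneg hA0 hB0, g + h,
          ⟨hg.add hh, fun x => by simp [eg, eh]⟩, fun m hm x => ?_⟩
        rw [iteratedFDeriv_add_apply (hg.of_le (by exact_mod_cast le_top)).contDiffAt
          (hh.of_le (by exact_mod_cast le_top)).contDiffAt]
        exact (norm_add_le _ _).trans (add_le_add (hA m hm x) (hB m hm x))
      linarith)
    (by
      intro c r
      refine le_of_forall_pos_le_add fun ε hε => ?_
      have hpos : 0 < ε / (‖c‖ + 1) := by positivity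
      obtain ⟨A, ⟨hA0, g, ⟨hg, eg⟩, hA⟩, hAlt⟩ :=
        Real.lt_sInf_add_pos (bounds_nonempty k r) hpos
      have h1 : sInf (bounds k (c • r)) ≤ ‖c‖ * A := by
        refine csInf_le (bounds_bddBelow k _) ⟨by positivity, c • g,
          ⟨hg.const_smul c, fun x => by simp [eg]⟩, fun m hm x => ?_⟩
        rw [iteratedFDeriv_const_smul_apply (hg.of_le (by exact_mod_cast le_top)).contDiffAt,
          norm_smul]
        exact mul_le_mul_of_nonneg_left (hA m hm x) (norm_nonneg c)
      have h2 : ‖c‖ * A ≤ ‖c‖ * (sInf (bounds k r) + ε / (‖c‖ + 1)) :=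
        mul_le_mul_of_nonneg_left hAlt.le (norm_nonneg c)
      have h3 : ‖c‖ * (ε / (‖c‖ + 1)) ≤ ε := by
        rw [← mul_div_assoc, div_le_iff₀ (by positivity)]
        nlinarith [norm_nonneg c]
      linarith [mul_add ‖c‖ (sInf (bounds k r)) (ε / (‖c‖ + 1))])

instance : TopologicalSpace (SmoothAlgebra Γ) :=
  (SeminormFamily.moduleFilterBasis (𝕜 := ℝ) (F := SmoothAlgebra Γ)
    (fun k : ℕ => kNorm k)).topology

theorem withSeminorms :
    WithSeminorms (𝕜 := ℝ) (E := SmoothAlgebra Γ) (fun k : ℕ => kNorm k) := ⟨rfl⟩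

instance : IsTopologicalAddGroup (SmoothAlgebra Γ) := withSeminorms.topologicalAddGroup

instance : ContinuousSMul ℝ (SmoothAlgebra Γ) := withSeminorms.continuousSMul

theorem kNorm_le {k : ℕ} {a : SmoothAlgebra Γ} {C : ℝ} (hC : 0 ≤ C) {g : Space d → ℂ}
    (hg : IsSmoothExtension (fun x => a x) g)
    (h : ∀ m ≤ k, ∀ x, ‖iteratedFDeriv ℝ m g x‖ ≤ C) : kNorm k a ≤ C :=
  csInf_le (bounds_bddBelow k a) ⟨hC, g, hg, h⟩

theorem exists_extension_of_kNorm_lt {k : ℕ} {a : SmoothAlgebra Γ} {C : ℝ} (h : kNorm k a < C) :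
    ∃ g, IsSmoothExtension (fun x => a x) g ∧ ∀ m ≤ k, ∀ x, ‖iteratedFDeriv ℝ m g x‖ ≤ C := by
  obtain ⟨A, ⟨_, g, hg, hA⟩, hlt⟩ := exists_lt_of_csInf_lt (bounds_nonempty k a) h
  exact ⟨g, hg, fun m hm x => (hA m hm x).trans hlt.le⟩

theorem norm_apply_le (a : SmoothAlgebra Γ) (x : Pts Γ) : ‖a x‖ ≤ kNorm 0 a := by
  refine le_of_forall_pos_le_add fun ε hε => ?_
  obtain ⟨g, hg, h⟩ := exists_extension_of_kNorm_lt (lt_add_of_pos_right (kNorm 0 a) hε)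
  have := h 0 le_rfl x
  rwa [norm_iteratedFDeriv_zero, hg.2] at this

/-- Leibniz's rule for the product of two nearly optimal extensions; 2^k bounds the sum of the
binomial coefficients. -/
theorem kNorm_mul_le (k : ℕ) (a b : SmoothAlgebra Γ) :
    kNorm k (a * b) ≤ 2 ^ k * kNorm k a * kNorm k b := by
  have key : ∀ A B : ℝ, kNorm k a < A → kNorm k b < B → kNorm k (a * b) ≤ 2 ^ k * A * B := by
    intro A B hA hB
    have hA0 := (apply_nonneg (kNorm k) a).trans hA.le
    have hB0 := (apply_nonneg (kNorm k) b).trans hB.le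
    obtain ⟨g, ⟨hg, eg⟩, hgA⟩ := exists_extension_of_kNorm_lt hA
    obtain ⟨h, ⟨hh, eh⟩, hhB⟩ := exists_extension_of_kNorm_lt hB
    refine kNorm_le (by positivity) ⟨hg.mul hh, fun x => by simp [eg, eh]⟩ fun m hm x => ?_
    refine (norm_iteratedFDeriv_mul_le hg hh x (n := m) (by exact_mod_cast le_top)).trans ?_
    calc _ ≤ ∑ i ∈ Finset.range (m + 1), (m.choose i : ℝ) * A * B := by
          refine Finset.sum_le_sum fun i hi => ?_
          have hi' : i ≤ m := Nat.lt_succ_iff.1 (Finset.mem_range.1 hi)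
          have := hgA i (hi'.trans hm) x
          have := hhB (m - i) ((Nat.sub_le _ _).trans hm) x
          gcongr
      _ = 2 ^ m * A * B := by
          rw [← Finset.sum_mul, ← Finset.sum_mul, ← Nat.cast_sum, Nat.sum_range_choose]
          push_cast; rfl
      _ ≤ _ := by gcongr; norm_num
  -- The infimum in the seminorm need not be attained, so the bound is proved with slack ε and ε is
  -- sent to 0.
  have ht : Tendsto (fun ε : ℝ => 2 ^ k * (kNorm k a + ε) * (kNorm k b + ε)) (𝓝[>] 0)
      (𝓝 (2 ^ k * (kNorm k a + 0) * (kNorm k b + 0))) :=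
    ((Continuous.tendsto (by fun_prop) 0).mono_left nhdsWithin_le_nhds)
  rw [add_zero, add_zero] at ht
  refine ge_of_tendsto ht ?_
  filter_upwards [self_mem_nhdsWithin] with ε hε
  exact key _ _ (lt_add_of_pos_right _ hε) (lt_add_of_pos_right _ hε)

theorem tendsto_iff {ι : Type*} {l : Filter ι} {f : ι → SmoothAlgebra Γ} {a : SmoothAlgebra Γ} :
    Tendsto f l (𝓝 a) ↔ ∀ k, Tendsto (fun i => kNorm k (f i - a)) l (𝓝 0) := by
  rw [withSeminorms.tendsto_nhds]
  refine forall_congr' fun k => ?_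
  rw [Metric.tendsto_nhds]
  simp [abs_of_nonneg]

instance : IsTopologicalRing (SmoothAlgebra Γ) where
  continuous_mul := by
    rw [continuous_iff_continuousAt]
    rintro ⟨a, b⟩
    refine tendsto_iff.2 fun k => ?_
    have h1 : Tendsto (fun p : SmoothAlgebra Γ × SmoothAlgebra Γ => kNorm k (p.1 - a))
      (𝓝 (a, b)) (𝓝 0) := tendsto_iff.1 (continuous_fst.tendsto (a, b)) k
    have h2 : Tendsto (fun p : SmoothAlgebra Γ × SmoothAlgebra Γ => kNorm k (p.2 - b))
      (𝓝 (a, b)) (𝓝 0) := tendsto_iff.1 (continuous_snd.tendsto (a, b)) k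
    have h3 : Tendsto (fun p : SmoothAlgebra Γ × SmoothAlgebra Γ =>
        2 ^ k * kNorm k (p.1 - a) * kNorm k (p.2 - b) + 2 ^ k * kNorm k (p.1 - a) * kNorm k b
          + 2 ^ k * kNorm k a * kNorm k (p.2 - b)) (𝓝 (a, b))
        (𝓝 (2 ^ k * 0 * 0 + 2 ^ k * 0 * kNorm k b + 2 ^ k * kNorm k a * 0)) := by
      exact (((h1.const_mul _).mul h2).add ((h1.const_mul _).mul_const _)).add (h2.const_mul _)
    simp only [mul_zero, zero_mul, add_zero] at h3
    refine squeeze_zero (fun _ => apply_nonneg _ _) (fun p => ?_) h3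
    have : p.1 * p.2 - a * b = (p.1 - a) * (p.2 - b) + (p.1 - a) * b + a * (p.2 - b) := by ring
    rw [this]
    exact (map_add_le_add _ _ _).trans (add_le_add ((map_add_le_add _ _ _).trans
      (add_le_add (kNorm_mul_le _ _ _) (kNorm_mul_le _ _ _))) (kNorm_mul_le _ _ _))

theorem continuous_eval (x : Pts Γ) : Continuous (eval x) := by
  rw [continuous_iff_continuousAt]
  intro a
  refine tendsto_iff_norm_sub_tendsto_zero.2 ?_
  refine squeeze_zero (fun _ => norm_nonneg _) (fun b => ?_) (tendsto_iff.1 tendsto_id 0)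
  rw [← map_sub]
  exact norm_apply_le _ x

/-- A smooth function is a unit if it has no zeros. -/
theorem isUnit_iff {a : SmoothAlgebra Γ} : IsUnit a ↔ ∀ x, a x ≠ 0 := by
  refine ⟨fun h x => (h.map (eval x)).ne_zero, fun h => ?_⟩
  obtain ⟨g, hg, e⟩ := a.exists_extension
  have : ∃ g, IsSmoothExtension (fun x => (a x)⁻¹) g := by
    refine exists_isSmoothExtension_of_local Γ.isCompact.isClosed fun x hx => ?_
    have hx0 : g x ≠ 0 := by rw [e ⟨x, hx⟩]; exact h _
    refine ⟨{y | g y ≠ 0}, hg.continuous.continuousAt.eventually_ne hx0, fun y => (g y)⁻¹,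
      hg.contDiffOn.inv fun y hy => hy, fun y hy _ => congrArg Inv.inv (e ⟨y, hy⟩)⟩
  exact IsUnit.of_mul_eq_one (mk _ this) (ext fun x => by simp [h x])

theorem eval_ringInverse (a : SmoothAlgebra Γ) (ha : IsUnit a) (x : Pts Γ) :
    (Ring.inverse a) x = (a x)⁻¹ := by
  have := congrArg (eval x) (Ring.mul_inverse_cancel a ha)
  rw [map_mul, map_one] at this
  exact eq_inv_of_mul_eq_one_right this

/-- Bounds for the derivatives of `1 / (1 + c)` for small `c`. -/
theorem exists_bound_inv (k : ℕ) : ∃ K : ℝ, 0 ≤ K ∧ ∀ c h : Space d → ℂ, ContDiff ℝ ∞ c →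
    ContDiff ℝ ∞ h → (∀ x, h x = 1 - c x * h x) →
    (∀ m ≤ k, ∀ x, ‖iteratedFDeriv ℝ m c x‖ ≤ 1 / 2) →
    ∀ m ≤ k, ∀ x, ‖iteratedFDeriv ℝ m h x‖ ≤ K := by
  induction k with
  | zero =>
    refine ⟨2, by norm_num, fun c h _ _ he hb m hm x => ?_⟩
    obtain rfl : m = 0 := Nat.le_zero.1 hm
    have h1 := hb 0 le_rfl x
    rw [norm_iteratedFDeriv_zero] at h1 ⊢
    have h2 : ‖h x‖ ≤ 1 + ‖c x‖ * ‖h x‖ := by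
      conv_lhs => rw [he x]
      exact (norm_sub_le _ _).trans (by rw [norm_one, norm_mul])
    nlinarith [norm_nonneg (h x)]
  | succ k ih =>
    obtain ⟨K, hK0, hK⟩ := ih
    -- Differentiate h = 1 - c h to order k + 1. The term carrying the top derivative of h has
    -- factor |c| ≤ 1/2 and is absorbed on the left; the others total at most 2^(k+1) K / 2. The
    -- summand K covers the lower orders.
    refine ⟨2 ^ (k + 1) * K + K, by positivity, fun c h hc hh he hb m hm x => ?_⟩
    have hKk := hK c h hc hh he (fun m hm => hb m (hm.trans (Nat.le_succ k)))
    rcases Nat.le_succ_iff.1 hm with hm' | rfl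
    · exact (hKk m hm' x).trans (le_add_of_nonneg_left (by positivity))
    have hch : ContDiff ℝ ∞ fun x => c x * h x := hc.mul hh
    have h1 : ‖iteratedFDeriv ℝ (k + 1) h x‖ =
        ‖iteratedFDeriv ℝ (k + 1) (fun x => c x * h x) x‖ := by
      have : h = (fun _ => (1 : ℂ)) - fun x => c x * h x := funext he
      conv_lhs => rw [this]
      rw [iteratedFDeriv_sub_apply contDiffAt_const
        (hch.of_le (by exact_mod_cast le_top)).contDiffAt, iteratedFDeriv_const_of_ne (by simp)]
      simp
    have h2 := norm_iteratedFDeriv_mul_le hc hh x (n := k + 1) (by exact_mod_cast le_top)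
    rw [← h1, Finset.sum_range_succ'] at h2
    have h3 : ∑ i ∈ Finset.range (k + 1), ((k + 1).choose (i + 1) : ℝ) *
        ‖iteratedFDeriv ℝ (i + 1) c x‖ * ‖iteratedFDeriv ℝ (k + 1 - (i + 1)) h x‖ ≤
        ∑ i ∈ Finset.range (k + 1), ((k + 1).choose (i + 1) : ℝ) * (1 / 2) * K := by
      refine Finset.sum_le_sum fun i hi => ?_
      have hi' := Finset.mem_range.1 hi
      have := hb (i + 1) (by omega) x
      have := hKk (k + 1 - (i + 1)) (by omega) x
      gcongr
    have h4 : (∑ i ∈ Finset.range (k + 1), ((k + 1).choose (i + 1) : ℝ)) ≤ 2 ^ (k + 1) := by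
      have := Nat.sum_range_choose (k + 1)
      rw [Finset.sum_range_succ'] at this
      have h5 : ∑ i ∈ Finset.range (k + 1), (k + 1).choose (i + 1) ≤ 2 ^ (k + 1) := by omega
      exact_mod_cast h5
    rw [← Finset.sum_mul, ← Finset.sum_mul] at h3
    have h5 := hb 0 (Nat.zero_le _) x
    simp only [Nat.choose_zero_right, Nat.cast_one, one_mul, Nat.sub_zero] at h2
    have h6 : ‖iteratedFDeriv ℝ 0 c x‖ * ‖iteratedFDeriv ℝ (k + 1) h x‖ ≤
        1 / 2 * ‖iteratedFDeriv ℝ (k + 1) h x‖ := by gcongr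
    have h7 := mul_le_mul_of_nonneg_right h4 hK0
    linarith

/-- Continuity of inversion at 1, one seminorm at a time. An extension g of c with |g| ≤ 1/2
everywhere makes 1/(1 + g) an extension of the inverse to the whole space, and (1 + c)⁻¹ - 1 = -c (1
+ c)⁻¹ is small with c. -/
theorem exists_kNorm_inverse_sub_one_le (k : ℕ) : ∃ K : ℝ, 0 ≤ K ∧ ∀ c : SmoothAlgebra Γ,
    kNorm k c < 1 / 2 → IsUnit (1 + c) ∧
      kNorm k (Ring.inverse (1 + c) - 1) ≤ 2 ^ k * kNorm k c * K := by
  obtain ⟨K, hK0, hK⟩ := exists_bound_inv (d := d) k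
  refine ⟨K, hK0, fun c hc => ?_⟩
  obtain ⟨g, ⟨hg, eg⟩, hgb⟩ := exists_extension_of_kNorm_lt hc
  have hne : ∀ x, 1 + g x ≠ 0 := fun x h0 => by
    have h1 := hgb 0 (Nat.zero_le _) x
    rw [norm_iteratedFDeriv_zero, eq_neg_of_add_eq_zero_right h0, norm_neg, norm_one] at h1
    norm_num at h1
  have hu : IsUnit (1 + c) := isUnit_iff.2 fun x => by
    have := hne x
    rwa [eg] at this
  refine ⟨hu, ?_⟩
  have hh : ContDiff ℝ ∞ fun x => (1 + g x)⁻¹ := (contDiff_const.add hg).inv hne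
  have hinv : kNorm k (Ring.inverse (1 + c)) ≤ K := by
    refine kNorm_le hK0 (g := fun x => (1 + g x)⁻¹) ⟨hh, fun x => ?_⟩
      (hK g _ hg hh (fun x => ?_) hgb)
    · rw [eval_ringInverse _ hu]
      change (1 + g x)⁻¹ = (eval x (1 + c))⁻¹
      rw [eg, map_add, map_one]
    · field_simp [hne x]
      ring
  have e : Ring.inverse (1 + c) - 1 = -(c * Ring.inverse (1 + c)) := by
    have := Ring.mul_inverse_cancel _ hu
    linear_combination this
  rw [e, map_neg_eq_map]
  exact (kNorm_mul_le _ _ _).trans (mul_le_mul_of_nonneg_left hinv (by positivity))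

/-- Translation to the unit element: b⁻¹ - a⁻¹ = a⁻¹ ((a⁻¹ b)⁻¹ - 1), with a⁻¹ b near 1. -/
theorem continuousAt_ringInverse {a : SmoothAlgebra Γ} (ha : IsUnit a) :
    ContinuousAt Ring.inverse a := by
  refine tendsto_iff.2 fun k => ?_
  obtain ⟨K, hK0, hK⟩ := exists_kNorm_inverse_sub_one_le (Γ := Γ) k
  have h1 : Tendsto (fun b : SmoothAlgebra Γ => Ring.inverse a * b - 1) (𝓝 a) (𝓝 0) := by
    refine Continuous.tendsto' (by fun_prop) _ _ ?_
    rw [Ring.inverse_mul_cancel a ha, sub_self]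
  have h2 : Tendsto (fun b : SmoothAlgebra Γ => kNorm k (Ring.inverse a * b - 1)) (𝓝 a) (𝓝 0) := by
    simpa using tendsto_iff.1 h1 k
  have h3 : Tendsto (fun b : SmoothAlgebra Γ => 2 ^ k * kNorm k (Ring.inverse a) *
      (2 ^ k * kNorm k (Ring.inverse a * b - 1) * K)) (𝓝 a) (𝓝 0) := by
    simpa using ((h2.const_mul (2 ^ k)).mul_const K).const_mul
      (2 ^ k * kNorm k (Ring.inverse a))
  refine squeeze_zero' (Eventually.of_forall fun _ => apply_nonneg _ _) ?_ h3
  filter_upwards [h2.eventually (gt_mem_nhds (by norm_num : (0 : ℝ) < 1 / 2))] with b hb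
  obtain ⟨hu, hle⟩ := hK _ hb
  rw [add_sub_cancel] at hu hle
  have hbu : IsUnit b := by
    have : a * (Ring.inverse a * b) = b := by
      rw [← mul_assoc, Ring.mul_inverse_cancel a ha, one_mul]
    exact this ▸ ha.mul hu
  have e : Ring.inverse b - Ring.inverse a =
      Ring.inverse a * (Ring.inverse (Ring.inverse a * b) - 1) := by
    have h4 := Ring.mul_inverse_cancel _ hu
    have h5 := Ring.mul_inverse_cancel _ hbu
    have h6 : Ring.inverse b =
        Ring.inverse a * Ring.inverse (Ring.inverse a * b) := by
      calc Ring.inverse b = Ring.inverse b * (Ring.inverse a * b *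
            Ring.inverse (Ring.inverse a * b)) := by rw [h4, mul_one]
        _ = (b * Ring.inverse b) * (Ring.inverse a * Ring.inverse (Ring.inverse a * b)) := by ring
        _ = _ := by rw [h5, one_mul]
    rw [h6, mul_sub, mul_one]
  rw [e]
  exact (kNorm_mul_le _ _ _).trans (mul_le_mul_of_nonneg_left hle (by positivity))

end SmoothAlgebra

/-! ### The tangential gradient on the reference surface -/

section Tangential

variable {d : ℕ}

theorem smoothExtension_spec {F : Type*} [NormedAddCommGroup F] [NormedSpace ℝ F]
    {S : Set (Space d)} {f : S → F} (h : ∃ g, IsSmoothExtension f g) :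
    IsSmoothExtension f (smoothExtension f) := by
  rw [smoothExtension, dif_pos h]
  exact h.choose_spec

theorem sum_apply_single {n : ℕ} {F : Type*} [AddCommGroup F] [Module ℝ F]
    (L : Space n →ₗ[ℝ] F) (v : Space n) :
    ∑ k, v k • L (EuclideanSpace.single k 1) = L v := by
  conv_rhs => rw [← (EuclideanSpace.basisFun (Fin n) ℝ).sum_repr v]
  simp

theorem tangentialGradient_eq_fderiv {S : Set (Space d)} (ν : S → Space d) (u : S → ℂ) (y : S)
    (i : Fin d) : tangentialGradient ν u y i =
      fderiv ℝ (smoothExtension u) y (EuclideanSpace.single i 1 - ν y i • ν y) := by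
  rw [map_sub, map_smul, tangentialGradient,
    ← ContinuousLinearMap.coe_coe (fderiv ℝ (smoothExtension u) (y : Space d)),
    ← sum_apply_single (fderiv ℝ (smoothExtension u) (y : Space d)).toLinearMap (ν y)]
  simp only [ContinuousLinearMap.coe_coe, Complex.real_smul]
  rw [mul_comm (∑ k, _)]
  simp only [mul_comm]

variable (Ω : SmoothDomain d)

/-- The orthogonal projection of the `i`-th unit vector onto the tangent space. -/
def SmoothDomain.tangentVec (i : Fin d) (x : Pts Ω.boundary) : Space d :=
  EuclideanSpace.single i 1 - Ω.normal x i • Ω.normal x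

theorem SmoothDomain.inner_normal_tangentVec (i : Fin d) (x : Pts Ω.boundary) :
    inner ℝ (Ω.normal x) (Ω.tangentVec i x) = 0 := by
  have h1 : inner ℝ (Ω.normal x) (EuclideanSpace.single i (1 : ℝ)) = Ω.normal x i := by
    simp [EuclideanSpace.inner_single_right]
  rw [tangentVec, inner_sub_right, inner_smul_right, real_inner_self_eq_norm_sq, Ω.norm_normal, h1]
  ring

/-- The `i`-th component of the tangential gradient of `f` on `Γ`. -/
def surfaceGradient (i : Fin d) (f : Pts Ω.boundary → ℂ) (x : Pts Ω.boundary) : ℂ :=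
  tangentialGradient (S := (Ω.boundary : Set (Space d))) Ω.normal f x i

variable {Ω}

/-- Two extensions differ by a function vanishing on Γ near x, whose derivative kills tangent
vectors. Hence any local C¹ extension may replace the chosen one, in particular one built from a
parametrization. -/
theorem surfaceGradient_eq_fderiv {f : Pts Ω.boundary → ℂ} (hf : ∃ g, IsSmoothExtension f g)
    (i : Fin d) (x : Pts Ω.boundary) {g : Space d → ℂ} (hg : ContDiffAt ℝ 1 g x)
    (he : ∀ᶠ y in 𝓝 (x : Space d), ∀ hy : y ∈ (Ω.boundary : Set (Space d)), g y = f ⟨y, hy⟩) :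
    surfaceGradient Ω i f x = fderiv ℝ g x (Ω.tangentVec i x) := by
  obtain ⟨h1, h2⟩ := smoothExtension_spec hf
  have h1' : ContDiffAt ℝ 1 (smoothExtension f) x := h1.contDiffAt.of_le (by simp)
  rw [surfaceGradient, tangentialGradient_eq_fderiv, ← sub_eq_zero]
  have h3 := Ω.fderiv_eq_zero_of_inner_normal (x := x) (f := smoothExtension f - g) (h1'.sub hg)
    (by
      filter_upwards [he] with y hy hyΓ
      rw [Pi.sub_apply, hy hyΓ, h2 ⟨y, hyΓ⟩, sub_self])
    (Ω.inner_normal_tangentVec i x)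
  rw [fderiv_sub (h1'.differentiableAt (by simp)) (hg.differentiableAt (by simp))] at h3
  exact h3

theorem surfaceGradient_eq_fderiv_extension {f : Pts Ω.boundary → ℂ} {g : Space d → ℂ}
    (hg : IsSmoothExtension f g) (i : Fin d) (x : Pts Ω.boundary) :
    surfaceGradient Ω i f x = fderiv ℝ g x (Ω.tangentVec i x) :=
  surfaceGradient_eq_fderiv ⟨g, hg⟩ i x (hg.1.contDiffAt.of_le (by simp))
    (Eventually.of_forall fun y hy => hg.2 ⟨y, hy⟩)

variable (Ω)

/-- Compact support is required so that all derivatives of the field are bounded on the whole space,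
as the seminorm estimates need. -/
theorem SmoothDomain.exists_isSmoothExtension_tangentVec (i : Fin d) :
    ∃ T : Space d → Space d, IsSmoothExtension (Ω.tangentVec i) T ∧ HasCompactSupport T := by
  obtain ⟨N, hN, e⟩ := Ω.exists_isSmoothExtension_normal
  obtain ⟨b, hb, hbc, hb1⟩ := SmoothAlgebra.exists_cutoff Ω.boundary
  have hNi : ContDiff ℝ ∞ fun x => N x i := (EuclideanSpace.proj (𝕜 := ℝ) i).contDiff.comp hN
  refine ⟨fun x => b x • (EuclideanSpace.single i 1 - N x i • N x),
    ⟨hb.smul (contDiff_const.sub (hNi.smul hN)), fun x => ?_⟩, hbc.smul_right⟩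
  simp only [hb1 x x.2, one_smul, e, tangentVec]

/-- The chosen smooth extension of the projected unit vectors. -/
def SmoothDomain.tangentField (i : Fin d) : Space d → Space d :=
  (Ω.exists_isSmoothExtension_tangentVec i).choose

theorem SmoothDomain.contDiff_tangentField (i : Fin d) : ContDiff ℝ ∞ (Ω.tangentField i) :=
  (Ω.exists_isSmoothExtension_tangentVec i).choose_spec.1.1

theorem SmoothDomain.tangentField_apply (i : Fin d) (x : Pts Ω.boundary) :
    Ω.tangentField i x = Ω.tangentVec i x :=
  (Ω.exists_isSmoothExtension_tangentVec i).choose_spec.1.2 x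

theorem SmoothDomain.hasCompactSupport_tangentField (i : Fin d) :
    HasCompactSupport (Ω.tangentField i) :=
  (Ω.exists_isSmoothExtension_tangentVec i).choose_spec.2

theorem isSmoothExtension_surfaceGradient {f : Pts Ω.boundary → ℂ} {g : Space d → ℂ}
    (hg : IsSmoothExtension f g) (i : Fin d) :
    IsSmoothExtension (surfaceGradient Ω i f) fun x => fderiv ℝ g x (Ω.tangentField i x) := by
  refine ⟨(hg.1.fderiv_right (m := ∞) (by simp)).clm_apply (Ω.contDiff_tangentField i),
    fun x => ?_⟩
  rw [surfaceGradient_eq_fderiv_extension hg, ← Ω.tangentField_apply]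

theorem exists_isSmoothExtension_surfaceGradient {f : Pts Ω.boundary → ℂ}
    (hf : ∃ g, IsSmoothExtension f g) (i : Fin d) :
    ∃ g, IsSmoothExtension (surfaceGradient Ω i f) g :=
  let ⟨_, hg⟩ := hf
  ⟨_, isSmoothExtension_surfaceGradient Ω hg i⟩

end Tangential

/-! ### Coordinates of deformations -/

namespace Deformation

variable {d : ℕ} {Γ : TopologicalSpace.Compacts (Space d)}

instance : IsTopologicalAddGroup (Deformation Γ) := withSeminorms.topologicalAddGroup

instance : ContinuousSMul ℝ (Deformation Γ) := withSeminorms.continuousSMul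

theorem exists_extension (r : Deformation Γ) : ∃ g, IsSmoothExtension r.toFun g := r.2

theorem exists_extension_of_kNorm_lt {k : ℕ} {r : Deformation Γ} {C : ℝ} (h : kNorm k r < C) :
    ∃ g, IsSmoothExtension r.toFun g ∧ ∀ m ≤ k, ∀ x, ‖iteratedFDeriv ℝ m g x‖ ≤ C := by
  obtain ⟨A, ⟨_, g, hg, hA⟩, hlt⟩ := exists_lt_of_csInf_lt (normBounds_nonempty k r) h
  exact ⟨g, hg, fun m hm x => (hA m hm x).trans hlt.le⟩

/-- The `i`-th coordinate of a vector, as a complex number. -/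
def complexCoord (i : Fin d) : Space d →L[ℝ] ℂ :=
  Complex.ofRealCLM.comp (EuclideanSpace.proj (𝕜 := ℝ) i)

@[simp] theorem complexCoord_apply (i : Fin d) (v : Space d) : complexCoord i v = (v i : ℂ) := rfl

theorem isSmoothExtension_coord {r : Deformation Γ} {g : Space d → Space d}
    (hg : IsSmoothExtension r.toFun g) (i : Fin d) :
    IsSmoothExtension (fun x => (r.toFun x i : ℂ)) fun x => complexCoord i (g x) :=
  ⟨(complexCoord i).contDiff.comp hg.1, fun x => by simp [hg.2]⟩

theorem exists_isSmoothExtension_coord (r : Deformation Γ) (i : Fin d) :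
    ∃ g, IsSmoothExtension (fun x => (r.toFun x i : ℂ)) g :=
  let ⟨_, hg⟩ := r.exists_extension
  ⟨_, isSmoothExtension_coord hg i⟩

end Deformation

section CoordDeriv

variable {d : ℕ} (Ω : SmoothDomain d)

open Deformation

theorem surfaceGradient_add {f g : Pts Ω.boundary → ℂ} (hf : ∃ g, IsSmoothExtension f g)
    (hg : ∃ f, IsSmoothExtension g f) (i : Fin d) :
    surfaceGradient Ω i (f + g) = surfaceGradient Ω i f + surfaceGradient Ω i g := by
  obtain ⟨F, hF⟩ := hf
  obtain ⟨G, hG⟩ := hg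
  funext x
  rw [surfaceGradient_eq_fderiv_extension (g := F + G)
      ⟨hF.1.add hG.1, fun x => by simp [hF.2, hG.2]⟩, Pi.add_apply,
    surfaceGradient_eq_fderiv_extension hF, surfaceGradient_eq_fderiv_extension hG,
    fderiv_add (hF.1.differentiable (by simp) _) (hG.1.differentiable (by simp) _)]
  rfl

/-- Real scalars serve the Fréchet spaces, complex scalars the Sobolev spaces. -/
theorem surfaceGradient_smul {𝕜 : Type*} [RCLike 𝕜] [NormedSpace 𝕜 ℂ] [SMulCommClass ℝ 𝕜 ℂ]
    (c : 𝕜) {f : Pts Ω.boundary → ℂ} (hf : ∃ g, IsSmoothExtension f g) (i : Fin d) :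
    surfaceGradient Ω i (c • f) = c • surfaceGradient Ω i f := by
  obtain ⟨F, hF⟩ := hf
  funext x
  rw [surfaceGradient_eq_fderiv_extension (g := c • F)
      ⟨hF.1.const_smul c, fun x => by simp [hF.2]⟩, Pi.smul_apply,
    surfaceGradient_eq_fderiv_extension hF,
    fderiv_const_smul (hF.1.differentiable (by simp) _)]
  rfl

/-- `r ↦ D_k r_j` as a linear map. -/
def coordDerivₗ (k j : Fin d) : Deformation Ω.boundary →ₗ[ℝ] SmoothAlgebra Ω.boundary where
  toFun r := SmoothAlgebra.mk (surfaceGradient Ω k fun x => (r.toFun x j : ℂ))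
    (exists_isSmoothExtension_surfaceGradient Ω (r.exists_isSmoothExtension_coord j) k)
  map_add' r s := SmoothAlgebra.ext fun x => by
    have e : (fun x => ((r + s).toFun x j : ℂ)) =
        (fun x => (r.toFun x j : ℂ)) + fun x => (s.toFun x j : ℂ) :=
      funext fun x => Complex.ofReal_add _ _
    simp only [map_add, SmoothAlgebra.mk_apply]
    rw [e, surfaceGradient_add Ω (r.exists_isSmoothExtension_coord j)
      (s.exists_isSmoothExtension_coord j)]
    rfl
  map_smul' c r := SmoothAlgebra.ext fun x => by
    have e : (fun x => ((c • r).toFun x j : ℂ)) = c • (fun x => (r.toFun x j : ℂ)) :=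
      funext fun x => (Complex.ofReal_mul _ _).trans (Complex.real_smul).symm
    simp only [map_smul, SmoothAlgebra.mk_apply]
    rw [e, surfaceGradient_smul Ω c (r.exists_isSmoothExtension_coord j)]
    rfl

/-- Leibniz's rule for x ↦ Dg(x) T(x) with the fixed tangent field T. One derivative is lost, which
is harmless for the Fréchet topology. -/
theorem exists_kNorm_coordDeriv_le (k j : Fin d) (m : ℕ) : ∃ C : ℝ, 0 ≤ C ∧
    ∀ r : Deformation Ω.boundary,
      SmoothAlgebra.kNorm m (coordDerivₗ Ω k j r) ≤ C * Deformation.kNorm (m + 1) r := by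
  obtain ⟨K, hK0, hK⟩ := SmoothAlgebra.exists_bound_iteratedFDeriv
    (Ω.contDiff_tangentField k) (Ω.hasCompactSupport_tangentField k) m
  refine ⟨2 ^ m * ‖complexCoord j‖ * K, by positivity, fun r => ?_⟩
  have key : ∀ A : ℝ, Deformation.kNorm (m + 1) r < A →
      SmoothAlgebra.kNorm m (coordDerivₗ Ω k j r) ≤ 2 ^ m * ‖complexCoord j‖ * K * A := by
    intro A hA
    have hA0 := (apply_nonneg (Deformation.kNorm (m + 1)) r).trans hA.le
    obtain ⟨g, hg, hgA⟩ := Deformation.exists_extension_of_kNorm_lt hA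
    have hg' := isSmoothExtension_coord hg j
    refine SmoothAlgebra.kNorm_le (by positivity)
      (isSmoothExtension_surfaceGradient Ω hg' k) fun l hl x => ?_
    refine (norm_iteratedFDeriv_clm_apply (hg'.1.fderiv_right (m := ∞) (by simp))
      (Ω.contDiff_tangentField k) x (n := l) (by exact_mod_cast le_top)).trans ?_
    calc _ ≤ ∑ i ∈ Finset.range (l + 1), (l.choose i : ℝ) * (‖complexCoord j‖ * A) * K := by
          refine Finset.sum_le_sum fun i hi => ?_
          have hi' : i ≤ l := Nat.lt_succ_iff.1 (Finset.mem_range.1 hi)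
          have h1 := hgA (i + 1) (by omega) x
          have h2 := hK (l - i) ((Nat.sub_le _ _).trans hl) x
          have h3 := (complexCoord j).norm_iteratedFDeriv_comp_left (x := x) (n := i + 1)
            (N := ∞) hg.1.contDiffAt (by exact_mod_cast le_top)
          rw [norm_iteratedFDeriv_fderiv]
          have h4 := h3.trans (mul_le_mul_of_nonneg_left h1 (norm_nonneg _))
          gcongr
          exact h4
      _ = 2 ^ l * (‖complexCoord j‖ * A) * K := by
          rw [← Finset.sum_mul, ← Finset.sum_mul, ← Nat.cast_sum, Nat.sum_range_choose]
          push_cast; rfl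
      _ ≤ 2 ^ m * (‖complexCoord j‖ * A) * K := by gcongr; norm_num
      _ = _ := by ring
  have ht : Tendsto (fun ε : ℝ => 2 ^ m * ‖complexCoord j‖ * K * (Deformation.kNorm (m + 1) r + ε))
      (𝓝[>] 0) (𝓝 (2 ^ m * ‖complexCoord j‖ * K * (Deformation.kNorm (m + 1) r + 0))) :=
    ((Continuous.tendsto (by fun_prop) 0).mono_left nhdsWithin_le_nhds)
  rw [add_zero] at ht
  refine ge_of_tendsto ht ?_
  filter_upwards [self_mem_nhdsWithin] with ε hε
  exact key _ (lt_add_of_pos_right _ hε)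

theorem Deformation.continuous_kNorm {Γ : TopologicalSpace.Compacts (Space d)} (k : ℕ) :
    Continuous (Deformation.kNorm (Γ := Γ) k) :=
  Deformation.withSeminorms.continuous_seminorm k

/-- `r ↦ D_k r_j` as a continuous linear map. -/
def coordDeriv (k j : Fin d) : Deformation Ω.boundary →L[ℝ] SmoothAlgebra Ω.boundary where
  toLinearMap := coordDerivₗ Ω k j
  cont := by
    refine continuous_of_continuousAt_zero (coordDerivₗ Ω k j) ?_
    refine SmoothAlgebra.tendsto_iff.2 fun m => ?_
    obtain ⟨C, hC0, hC⟩ := exists_kNorm_coordDeriv_le Ω k j m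
    have h1 : Tendsto (fun r : Deformation Ω.boundary => C * Deformation.kNorm (m + 1) r)
        (𝓝 0) (𝓝 0) := by
      simpa using ((Deformation.continuous_kNorm (Γ := Ω.boundary) (m + 1)).tendsto 0).const_mul C
    refine squeeze_zero (fun _ => apply_nonneg _ _) (fun r => ?_) h1
    rw [map_zero, sub_zero]
    exact hC r

end CoordDeriv

/-! ### Localization of products and tangential derivatives -/

namespace LocalPatch

open LineDeriv

variable {d : ℕ}

section Basic

variable {Γ : Set (Space d)} (p : LocalPatch Γ)

theorem exists_bump : ∃ χ : Space (d - 1) → ℝ, ContDiff ℝ ∞ χ ∧ HasCompactSupport χ ∧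
    tsupport χ ⊆ p.source ∧ ∀ y ∈ tsupport p.cutoff, χ y = 1 := by
  obtain ⟨L, hL, hKL, hLU⟩ := exists_compact_between p.hasCompactSupport_cutoff p.isOpen_source
    p.tsupport_cutoff
  obtain ⟨f, h0, h1, -⟩ := exists_contMDiffMap_zero_one_of_isClosed (n := ⊤)
    (modelWithCornersSelf ℝ (Space (d - 1))) (M := Space (d - 1)) (s := (interior L)ᶜ)
    (t := tsupport p.cutoff) isOpen_interior.isClosed_compl (isClosed_tsupport _)
    (disjoint_compl_left_iff_subset.2 hKL)
  have hs : tsupport f ⊆ L := closure_minimal (fun y hy => by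
    by_contra hyL
    exact hy (h0 fun hyi => hyL (interior_subset hyi))) hL.isClosed
  exact ⟨f, f.contMDiff.contDiff, hL.of_isClosed_subset (isClosed_tsupport _) hs, hs.trans hLU,
    fun y hy => h1 hy⟩

/-- The same parametrization, with a cutoff function that is `1` on the support of the given
cutoff function. -/
def bump : LocalPatch Γ :=
  { p with
    cutoff := p.exists_bump.choose
    contDiff_cutoff := p.exists_bump.choose_spec.1
    hasCompactSupport_cutoff := p.exists_bump.choose_spec.2.1
    tsupport_cutoff := p.exists_bump.choose_spec.2.2.1 }

theorem bump_cutoff {y : Space (d - 1)} (hy : y ∈ tsupport p.cutoff) : p.bump.cutoff y = 1 :=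
  p.exists_bump.choose_spec.2.2.2 y hy

/-- The same parametrization, with a directional derivative of the given cutoff function. -/
def derivPatch (m : Space (d - 1)) : LocalPatch Γ :=
  { p with
    cutoff := fun y => fderiv ℝ p.cutoff y m
    contDiff_cutoff := (p.contDiff_cutoff.fderiv_right (m := ∞) (by simp)).clm_apply contDiff_const
    hasCompactSupport_cutoff := p.hasCompactSupport_cutoff.fderiv_apply ℝ m
    tsupport_cutoff := (tsupport_fderiv_apply_subset ℝ m).trans p.tsupport_cutoff }

theorem toSchwartz_apply (f : smoothFun ℂ ℂ Γ) (y : Space (d - 1)) :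
    p.toSchwartz f y = p.localize f.1 y := rfl

theorem param_mem {y : Space (d - 1)} (hy : y ∈ p.source) : p.param y ∈ Γ ∧ p.param y ∈ p.target :=
  (p.image_param ▸ mem_image_of_mem p.param hy : p.param y ∈ Γ ∩ p.target)

theorem localize_of_mem (f : Γ → ℂ) {y : Space (d - 1)} (hy : y ∈ p.source) :
    p.localize f y = p.cutoff y * f ⟨p.param y, (p.param_mem hy).1⟩ := by
  rw [localize, dif_pos]

theorem localize_of_cutoff_eq_zero (f : Γ → ℂ) {y : Space (d - 1)} (hy : p.cutoff y = 0) :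
    p.localize f y = 0 := by
  rw [localize]
  split_ifs <;> simp [hy]

/-- The localization of a product. -/
theorem toSchwartz_mul {a f h : smoothFun ℂ ℂ Γ} (e : h.1 = a.1 * f.1) :
    p.toSchwartz h = schwartzMul (p.bump.toSchwartz a) (p.toSchwartz f) := by
  ext y
  simp only [SchwartzMap.pairing_apply_apply, ContinuousLinearMap.mul_apply', toSchwartz_apply]
  -- On the support of the cutoff the bump equals 1 and can be inserted in front of a; elsewhere
  -- both sides vanish.
  by_cases hy : y ∈ tsupport p.cutoff
  · have hy' := p.tsupport_cutoff hy
    rw [p.localize_of_mem _ hy', p.localize_of_mem _ hy', p.bump.localize_of_mem _ hy',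
      p.bump_cutoff hy, e]
    simp only [Pi.mul_apply, Complex.ofReal_one, one_mul]
    exact mul_left_comm _ _ _
  · have hy' := image_eq_zero_of_notMem_tsupport hy
    rw [p.localize_of_cutoff_eq_zero _ hy', p.localize_of_cutoff_eq_zero _ hy', mul_zero]

theorem contDiff_cutoff_smul {F : Type*} [NormedAddCommGroup F] [NormedSpace ℝ F]
    {f : Space (d - 1) → F} (hf : ContDiffOn ℝ ∞ f p.source) :
    ContDiff ℝ ∞ fun y => p.cutoff y • f y := by
  rw [contDiff_iff_contDiffAt]
  intro y
  by_cases hy : y ∈ tsupport p.cutoff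
  · exact p.contDiff_cutoff.contDiffAt.smul
      (hf.contDiffAt (p.isOpen_source.mem_nhds (p.tsupport_cutoff hy)))
  · have : (fun y => p.cutoff y • f y) =ᶠ[𝓝 y] fun _ => 0 := by
      filter_upwards [(notMem_tsupport_iff_eventuallyEq.1 hy)] with z hz
      simp [hz]
    exact contDiffAt_const.congr_of_eventuallyEq this

theorem hasCompactSupport_cutoff_smul {F : Type*} [NormedAddCommGroup F] [NormedSpace ℝ F]
    (f : Space (d - 1) → F) : HasCompactSupport fun y => p.cutoff y • f y :=
  p.hasCompactSupport_cutoff.smul_right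

end Basic

variable {Ω : SmoothDomain d} (p : LocalPatch (Ω.boundary : Set (Space d)))

/-- The coordinates of the `i`-th projected unit vector in the parametrization. -/
def coordField (i : Fin d) (y : Space (d - 1)) : Space (d - 1) :=
  fderiv ℝ p.coord (p.param y) (Ω.tangentField i (p.param y))

theorem contDiffOn_coordField (i : Fin d) : ContDiffOn ℝ ∞ (p.coordField i) p.source := by
  have hm : MapsTo p.param p.source p.target := fun y hy => (p.param_mem hy).2
  exact ((p.contDiffOn_coord.fderiv_of_isOpen p.isOpen_target (m := ∞) (by simp)).comp
    p.contDiffOn_param hm).clm_apply ((Ω.contDiff_tangentField i).comp_contDiffOn p.contDiffOn_param)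

/-- The coefficients of the tangential gradient in the parametrization, cut off. -/
def gradCoeff (i : Fin d) (k : Fin (d - 1)) : 𝓢(Space (d - 1), ℂ) :=
  (p.bump.hasCompactSupport_cutoff_smul fun y => (p.coordField i y k : ℂ)).toSchwartzMap
    (p.bump.contDiff_cutoff_smul (Complex.ofRealCLM.contDiff.comp_contDiffOn
      ((EuclideanSpace.proj (𝕜 := ℝ) k).contDiff.comp_contDiffOn (p.contDiffOn_coordField i))))

theorem gradCoeff_apply (i : Fin d) (k : Fin (d - 1)) {y : Space (d - 1)}
    (hy : y ∈ tsupport p.cutoff) : p.gradCoeff i k y = (p.coordField i y k : ℂ) := by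
  rw [gradCoeff, HasCompactSupport.toSchwartzMap_toFun, p.bump_cutoff hy]
  simp

/-- The tangential gradient in the parametrization. -/
theorem surfaceGradient_param {f : Pts Ω.boundary → ℂ} {g : Space d → ℂ}
    (hg : IsSmoothExtension f g) (i : Fin d) {y : Space (d - 1)} (hy : y ∈ p.source) :
    surfaceGradient Ω i f ⟨p.param y, (p.param_mem hy).1⟩ =
      fderiv ℝ (g ∘ p.param) y (p.coordField i y) := by
  have ht := (p.param_mem hy).2
  have hφ : ContDiffAt ℝ ∞ p.param y := p.contDiffOn_param.contDiffAt (p.isOpen_source.mem_nhds hy)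
  have hq : ContDiffAt ℝ ∞ p.coord (p.param y) :=
    p.contDiffOn_coord.contDiffAt (p.isOpen_target.mem_nhds ht)
  have hF : ContDiffAt ℝ ∞ (g ∘ p.param) (p.coord (p.param y)) := by
    rw [p.left_inv y hy]
    exact hg.1.contDiffAt.comp y hφ
  -- The extension used near the point is constant along the fibres of `coord`, so the chain rule
  -- brings out the derivative in the parameters.
  rw [surfaceGradient_eq_fderiv ⟨g, hg⟩ i _ (g := (g ∘ p.param) ∘ p.coord)
    ((hF.comp _ hq).of_le (by simp)) ?_, fderiv_comp _ (hF.differentiableAt (by simp))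
      (hq.differentiableAt (by simp)), p.left_inv y hy, coordField, ← Ω.tangentField_apply]
  · rfl
  · filter_upwards [p.isOpen_target.mem_nhds ht] with z hz hzΓ
    obtain ⟨y', hy', rfl⟩ : z ∈ p.param '' p.source := p.image_param ▸ ⟨hzΓ, hz⟩
    rw [Function.comp_apply, Function.comp_apply, p.left_inv y' hy', ← hg.2]

/-- The localization of the tangential gradient. -/
theorem toSchwartz_surfaceGradient (i : Fin d) {f h : smoothFun ℂ ℂ (Ω.boundary : Set (Space d))}
    (e : h.1 = surfaceGradient Ω i f.1) :
    p.toSchwartz h = ∑ k, schwartzMul (p.gradCoeff i k)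
      (∂_{EuclideanSpace.single k (1 : ℝ)} (p.toSchwartz f) -
        (p.derivPatch (EuclideanSpace.single k 1)).toSchwartz f) := by
  ext y
  obtain ⟨g, hg⟩ := f.2
  rw [sum_apply]
  simp only [SchwartzMap.pairing_apply_apply, ContinuousLinearMap.mul_apply', toSchwartz_apply,
    sub_apply, SchwartzMap.lineDerivOp_apply_eq_fderiv]
  have hloc : (p.toSchwartz f : Space (d - 1) → ℂ) =
      fun y => (p.cutoff y : ℂ) * (g ∘ p.param) y := p.localize_eq f.1 hg
  by_cases hy : y ∈ tsupport p.cutoff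
  · have hy' := p.tsupport_cutoff hy
    have hφ : DifferentiableAt ℝ (g ∘ p.param) y :=
      (hg.1.contDiffAt.comp y (p.contDiffOn_param.contDiffAt
        (p.isOpen_source.mem_nhds hy'))).differentiableAt (by simp)
    have hχ : HasFDerivAt (fun y => (p.cutoff y : ℂ))
        (Complex.ofRealCLM.comp (fderiv ℝ p.cutoff y)) y :=
      Complex.ofRealCLM.hasFDerivAt.comp y
        (p.contDiff_cutoff.differentiable (by simp) y).hasFDerivAt
    rw [p.localize_of_mem _ hy', e, p.surfaceGradient_param hg i hy', hloc]
    -- Product rule, χ ∂_k(f ∘ φ) = ∂_k(χ · f ∘ φ) - (∂_k χ) · f ∘ φ; the last term is again a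
    -- localization, with cutoff ∂_k χ.
    have hterm : ∀ k : Fin (d - 1), p.gradCoeff i k y *
        (fderiv ℝ (fun y => (p.cutoff y : ℂ) * (g ∘ p.param) y) y (EuclideanSpace.single k 1) -
          (p.derivPatch (EuclideanSpace.single k 1)).localize f.1 y) =
        p.cutoff y * (p.coordField i y k •
          fderiv ℝ (g ∘ p.param) y (EuclideanSpace.single k 1)) := by
      intro k
      have hprod : fderiv ℝ (fun y => (p.cutoff y : ℂ) * (g ∘ p.param) y) y = _ :=
        (hχ.mul hφ.hasFDerivAt).fderiv
      rw [p.gradCoeff_apply i k hy, hprod,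
        (p.derivPatch _).localize_eq f.1 hg, Complex.real_smul]
      simp [derivPatch]
      ring
    rw [Finset.sum_congr rfl fun k _ => hterm k, ← Finset.mul_sum]
    congr 1
    exact (sum_apply_single (fderiv ℝ (g ∘ p.param) y).toLinearMap (p.coordField i y)).symm
  · have h0 := image_eq_zero_of_notMem_tsupport hy
    rw [p.localize_of_cutoff_eq_zero _ h0]
    symm
    refine Finset.sum_eq_zero fun k _ => ?_
    have h1 : fderiv ℝ (p.toSchwartz f) y = 0 := by
      have : (p.toSchwartz f : Space (d - 1) → ℂ) =ᶠ[𝓝 y] fun _ => 0 := by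
        filter_upwards [(notMem_tsupport_iff_eventuallyEq.1 hy)] with z hz
        exact p.localize_of_cutoff_eq_zero _ hz
      rw [this.fderiv_eq]
      simp
    have h2 : (p.derivPatch (EuclideanSpace.single k 1)).localize f.1 y = 0 := by
      refine (p.derivPatch _).localize_of_cutoff_eq_zero _ ?_
      have : p.cutoff =ᶠ[𝓝 y] fun _ => 0 := notMem_tsupport_iff_eventuallyEq.1 hy
      simp [derivPatch, this.fderiv_eq]
    rw [h1, h2]
    simp

end LocalPatch

/-! ### Continuity of localizations -/

namespace LocalPatch

variable {d : ℕ} {Γ : TopologicalSpace.Compacts (Space d)} (p : LocalPatch (Γ : Set (Space d)))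

/-- Leibniz's rule and the bound for iterated derivatives of a composition, applied to χ · (g ∘ φ)
with a nearly optimal extension g. The weight |y|^k is at most R^k on the support. -/
theorem exists_seminorm_toSchwartz_le (k n : ℕ) : ∃ C : ℝ, 0 ≤ C ∧ ∀ a : SmoothAlgebra Γ,
    SchwartzMap.seminorm ℝ k n (p.toSchwartz ⟨a.1, a.2⟩) ≤ C * SmoothAlgebra.kNorm n a := by
  -- Cutting off the parametrization makes it smooth with bounded derivatives everywhere, without
  -- changing it where χ lives.
  set φ : Space (d - 1) → Space d := fun y => p.bump.cutoff y • p.param y with hφ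
  have hφs : ContDiff ℝ ∞ φ := p.bump.contDiff_cutoff_smul p.contDiffOn_param
  obtain ⟨K, hK0, hK⟩ := SmoothAlgebra.exists_bound_iteratedFDeriv hφs
    (p.bump.hasCompactSupport_cutoff_smul p.param) n
  have hχs : ContDiff ℝ ∞ fun y => (p.cutoff y : ℂ) :=
    Complex.ofRealCLM.contDiff.comp p.contDiff_cutoff
  have hχc : HasCompactSupport fun y => (p.cutoff y : ℂ) :=
    p.hasCompactSupport_cutoff.comp_left Complex.ofReal_zero
  obtain ⟨L, hL0, hL⟩ := SmoothAlgebra.exists_bound_iteratedFDeriv hχs hχc n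
  obtain ⟨R, hR0, hR⟩ := p.hasCompactSupport_cutoff.isBounded.subset_closedBall_lt 0 0
  -- With D ≥ 1 the uniform bound K is at most D^j for all j ≥ 1, the form required for the
  -- derivatives of the inner function.
  set D := max 1 K
  have hD1 : 1 ≤ D := le_max_left _ _
  refine ⟨R ^ k * (2 ^ n * L * (n.factorial * D ^ n)), by positivity, fun a => ?_⟩
  have key : ∀ A : ℝ, SmoothAlgebra.kNorm n a < A →
      SchwartzMap.seminorm ℝ k n (p.toSchwartz ⟨a.1, a.2⟩) ≤
        R ^ k * (2 ^ n * L * (n.factorial * D ^ n)) * A := by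
    intro A hA
    have hA0 := (apply_nonneg (SmoothAlgebra.kNorm n) a).trans hA.le
    obtain ⟨g, hg, hgA⟩ := SmoothAlgebra.exists_extension_of_kNorm_lt hA
    refine SchwartzMap.seminorm_le_bound ℝ k n _ (by positivity) fun y => ?_
    have hloc : (p.toSchwartz ⟨a.1, a.2⟩ : Space (d - 1) → ℂ) =
        fun y => (p.cutoff y : ℂ) * (g ∘ φ) y := by
      refine (p.localize_eq a.1 hg).trans (funext fun y => ?_)
      by_cases hy : y ∈ tsupport p.cutoff
      · simp [hφ, p.bump_cutoff hy]
      · simp [image_eq_zero_of_notMem_tsupport hy]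
    by_cases hy : y ∈ tsupport p.cutoff
    · have hyR : ‖y‖ ≤ R := by simpa using hR hy
      have hcomp : ∀ i ≤ n, ‖iteratedFDeriv ℝ i (g ∘ φ) y‖ ≤ n.factorial * A * D ^ n := by
        intro i hi
        refine (norm_iteratedFDeriv_comp_le (n := i) hg.1 hφs (by exact_mod_cast le_top) y
          (fun j hj => hgA j (hj.trans hi) _) (D := D) fun j hj1 hj => ?_).trans ?_
        · exact ((hK j (hj.trans hi) y).trans (le_max_right _ _)).trans
            (le_self_pow₀ hD1 (by omega))
        · gcongr
      have h1 := norm_iteratedFDeriv_mul_le hχs (hg.1.comp hφs) y (n := n)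
        (by exact_mod_cast le_top)
      have h2 : ∑ i ∈ Finset.range (n + 1), (n.choose i : ℝ) *
          ‖iteratedFDeriv ℝ i (fun y => (p.cutoff y : ℂ)) y‖ *
            ‖iteratedFDeriv ℝ (n - i) (g ∘ φ) y‖ ≤
          ∑ i ∈ Finset.range (n + 1), (n.choose i : ℝ) * L * (n.factorial * A * D ^ n) := by
        refine Finset.sum_le_sum fun i hi => ?_
        have h3 := hL i (Nat.lt_succ_iff.1 (Finset.mem_range.1 hi)) y
        have h4 := hcomp (n - i) (Nat.sub_le _ _)
        gcongr
      rw [← Finset.sum_mul, ← Finset.sum_mul, ← Nat.cast_sum, Nat.sum_range_choose] at h2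
      push_cast at h2
      rw [hloc]
      calc _ ≤ R ^ k * (2 ^ n * L * (n.factorial * A * D ^ n)) := by
            gcongr
            exact h1.trans h2
        _ = _ := by ring
    · have h0 : iteratedFDeriv ℝ n (p.toSchwartz ⟨a.1, a.2⟩) y = 0 := by
        have : (p.toSchwartz ⟨a.1, a.2⟩ : Space (d - 1) → ℂ) =ᶠ[𝓝 y] fun _ => 0 := by
          rw [hloc]
          filter_upwards [(notMem_tsupport_iff_eventuallyEq.1 hy)] with z hz
          simp [hz]
        rw [(this.iteratedFDeriv ℝ n).self_of_nhds]
        simp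
      rw [h0, norm_zero, mul_zero]
      positivity
  have ht : Tendsto (fun ε : ℝ => R ^ k * (2 ^ n * L * (n.factorial * D ^ n)) *
      (SmoothAlgebra.kNorm n a + ε)) (𝓝[>] 0) (𝓝 (R ^ k * (2 ^ n * L * (n.factorial * D ^ n)) *
      (SmoothAlgebra.kNorm n a + 0))) :=
    ((Continuous.tendsto (by fun_prop) 0).mono_left nhdsWithin_le_nhds)
  rw [add_zero] at ht
  refine ge_of_tendsto ht ?_
  filter_upwards [self_mem_nhdsWithin] with ε hε
  exact key _ (lt_add_of_pos_right _ hε)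

theorem tendsto_toSchwartz :
    Tendsto (fun a : SmoothAlgebra Γ => p.toSchwartz ⟨a.1, a.2⟩) (𝓝 0) (𝓝 0) := by
  rw [(schwartz_withSeminorms ℝ (Space (d - 1)) ℂ).tendsto_nhds]
  rintro ⟨k, n⟩ ε hε
  obtain ⟨C, hC0, hC⟩ := p.exists_seminorm_toSchwartz_le k n
  have h1 : Tendsto (fun a : SmoothAlgebra Γ => C * SmoothAlgebra.kNorm n a) (𝓝 0) (𝓝 0) := by
    simpa using ((SmoothAlgebra.withSeminorms.continuous_seminorm n).tendsto
      (0 : SmoothAlgebra Γ)).const_mul C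
  filter_upwards [h1.eventually (gt_mem_nhds hε)] with a ha
  rw [sub_zero]
  exact (hC a).trans_lt ha

end LocalPatch

/-! ### Operators on Sobolev spaces -/

section Operators

variable {d : ℕ} {Γ : Set (Space d)} {s t : ℝ}

namespace SmoothSobolev

theorem isUniformInducing_lift : IsUniformInducing (lift Γ t) := ⟨rfl⟩

/-- The topologies are given by one seminorm per patch, so it is enough to bound each target
seminorm by finitely many source seminorms. -/
theorem continuous_of_lift_le (A : SmoothSobolev Γ s →ₗ[ℂ] SmoothSobolev Γ t)
    (h : ∀ p, ∃ (Q : Finset (LocalPatch Γ)) (C : ℝ), ∀ u,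
      ‖lift Γ t (A u) p‖ ≤ C * ∑ q ∈ Q, ‖lift Γ s u q‖) : Continuous A := by
  refine continuous_of_continuousAt_zero A ?_
  rw [ContinuousAt, isUniformInducing_lift.isInducing.tendsto_nhds_iff, tendsto_pi_nhds]
  intro p
  obtain ⟨Q, C, hC⟩ := h p
  simp only [Function.comp_apply, map_zero, Pi.zero_apply]
  refine squeeze_zero_norm hC ?_
  have hl : Continuous (lift Γ s) := isUniformInducing_lift.uniformContinuous.continuous
  refine Continuous.tendsto' ?_ _ _ (by simp)
  exact continuous_const.mul (continuous_finsetSum _ fun q _ => ((continuous_apply q).comp hl).norm)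

end SmoothSobolev

namespace Sobolev

variable (Γ t) in
/-- The inclusion of the smooth functions, as a continuous linear map. -/
def coeCLM : SmoothSobolev Γ t →L[ℂ] Sobolev Γ t where
  toFun := (↑)
  map_add' := UniformSpace.Completion.coe_add
  map_smul' c f := UniformSpace.Completion.coe_smul c f
  cont := UniformSpace.Completion.continuous_coe _

theorem denseRange_coeCLM : DenseRange (coeCLM Γ t) := UniformSpace.Completion.denseRange_coe

theorem isUniformInducing_coeCLM : IsUniformInducing (coeCLM Γ t) :=
  UniformSpace.Completion.isUniformInducing_coe _

/-- The extension of a continuous linear map of smooth functions to the Sobolev spaces. -/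
def extendCLM (A : SmoothSobolev Γ s →ₗ[ℂ] SmoothSobolev Γ t) (hA : Continuous A) :
    Sobolev Γ s →L[ℂ] Sobolev Γ t :=
  ((coeCLM Γ t).comp ⟨A, hA⟩).extend (coeCLM Γ s)

theorem extendCLM_coe (A : SmoothSobolev Γ s →ₗ[ℂ] SmoothSobolev Γ t) (hA : Continuous A)
    (u : SmoothSobolev Γ s) : extendCLM A hA (u : Sobolev Γ s) = (A u : SmoothSobolev Γ t) :=
  ContinuousLinearMap.extend_eq _ denseRange_coeCLM isUniformInducing_coeCLM u

variable (Γ t) in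
/-- The local Bessel potentials on the Sobolev space. -/
def liftCLM : Sobolev Γ t →L[ℂ]
    (LocalPatch Γ → Lp ℂ 2 (volume : Measure (Space (d - 1)))) :=
  ContinuousLinearMap.extend ⟨SmoothSobolev.lift Γ t,
    SmoothSobolev.isUniformInducing_lift.uniformContinuous.continuous⟩ (coeCLM Γ t)

theorem liftCLM_coe (u : SmoothSobolev Γ t) :
    liftCLM Γ t (u : Sobolev Γ t) = SmoothSobolev.lift Γ t u :=
  ContinuousLinearMap.extend_eq _ denseRange_coeCLM isUniformInducing_coeCLM u

/-- The extension of a uniformly inducing map to the completion is again inducing; so convergence in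
H^t(Γ) can still be tested patch by patch. -/
theorem isInducing_liftCLM : IsInducing (liftCLM Γ t) := by
  have h := UniformSpace.Completion.isUniformInducing_extension
    (SmoothSobolev.isUniformInducing_lift (Γ := Γ) (t := t))
  have e : UniformSpace.Completion.extension (SmoothSobolev.lift Γ t) = liftCLM Γ t := by
    refine UniformSpace.Completion.ext (UniformSpace.Completion.continuous_extension)
      (liftCLM Γ t).continuous fun u => ?_
    rw [liftCLM_coe, UniformSpace.Completion.extension_coe
      SmoothSobolev.isUniformInducing_lift.uniformContinuous]
  rw [← e]
  exact h.isInducing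

theorem ext_clm {F : Type*} [TopologicalSpace F] [AddCommGroup F] [Module ℂ F] [T2Space F]
    {S T : Sobolev Γ s →L[ℂ] F} (h : ∀ u : SmoothSobolev Γ s, S u = T u) : S = T :=
  ContinuousLinearMap.ext fun u => congrFun
    (UniformSpace.Completion.ext S.continuous T.continuous h) u

end Sobolev

/-- Density of the smooth functions gives uniqueness, which removes the choice from the definition.
-/
theorem sobolevExtension_eq {A : (Γ → ℂ) → (Γ → ℂ)} {T : Sobolev Γ s →L[ℂ] Sobolev Γ t}
    (h : IsSobolevExtension A T) : sobolevExtension s t A = T := by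
  have hex : ∃ T : Sobolev Γ s →L[ℂ] Sobolev Γ t, IsSobolevExtension A T := ⟨T, h⟩
  rw [sobolevExtension, dif_pos hex]
  refine Sobolev.ext_clm fun u => ?_
  obtain ⟨v, hv, e⟩ := hex.choose_spec u
  obtain ⟨w, hw, e'⟩ := h u
  rw [e, e']
  congr 1
  exact Subtype.ext (hv.trans hw.symm)

theorem isSobolevExtension_sobolevExtension {A : (Γ → ℂ) → (Γ → ℂ)}
    {T : Sobolev Γ s →L[ℂ] Sobolev Γ t} (h : IsSobolevExtension A T) :
    IsSobolevExtension A (sobolevExtension s t A) := by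
  rwa [sobolevExtension_eq h]

end Operators

/-! ### Operator convergence, uniformly on bounded sets -/

section BoundedConvergence

variable {α ι E G : Type*} [AddCommGroup E] [Module ℂ E] [TopologicalSpace E]
  [NormedAddCommGroup G] [NormedSpace ℂ G]

/-- L sends a bounded set into some ball of radius K, on which T a is at most m a · K. -/
theorem tendsto_clm_normed_zero_of_norm_le {l : Filter α} {T : α → E →L[ℂ] G} {L : E →L[ℂ] G}
    {m : α → ℝ} (hm : Tendsto m l (𝓝 0)) (hm0 : ∀ a, 0 ≤ m a)
    (h : ∀ a u, ‖T a u‖ ≤ m a * ‖L u‖) : Tendsto T l (𝓝 0) := by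
  rw [(ContinuousLinearMap.hasBasis_nhds_zero_of_basis Metric.nhds_basis_ball).tendsto_right_iff]
  rintro ⟨B, ε⟩ ⟨hB, hε⟩
  obtain ⟨K, hK⟩ := (NormedSpace.isVonNBounded_iff' ℂ).1 (hB.image L)
  have h1 : Tendsto (fun a => m a * K) l (𝓝 0) := by simpa using hm.mul_const K
  filter_upwards [h1.eventually (gt_mem_nhds hε)] with a ha u hu
  rw [mem_ball_zero_iff]
  exact ((h a u).trans (mul_le_mul_of_nonneg_left (hK _ (mem_image_of_mem _ hu)) (hm0 a))).trans_lt
    ha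

theorem tendsto_clm_pi_zero {l : Filter α} {T : α → E →L[ℂ] (ι → G)}
    (h : ∀ p, Tendsto (fun a => (ContinuousLinearMap.proj p).comp (T a)) l
      (𝓝 (0 : E →L[ℂ] G))) : Tendsto T l (𝓝 0) := by
  have h1 : Tendsto (fun a p => (ContinuousLinearMap.proj (φ := fun _ : ι => G) p).comp (T a)) l
      (𝓝 (0 : ι → E →L[ℂ] G)) := tendsto_pi_nhds.2 h
  exact ((ContinuousLinearMap.piEquivL ℂ E (fun _ : ι => G)).continuous.tendsto' 0 0
    (map_zero _)).comp h1

/-- A criterion for convergence to zero, uniformly on bounded sets, of operators on a space whose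
topology is given by seminorms. -/
theorem tendsto_clm_zero_of_norm_le [IsTopologicalAddGroup E] [ContinuousConstSMul ℂ E]
    {l : Filter α} {T : α → E →L[ℂ] E} {L : E →L[ℂ] (ι → G)}
    (hL : IsInducing L) {m : ι → α → ℝ} (hm : ∀ p, Tendsto (m p) l (𝓝 0))
    (hm0 : ∀ p a, 0 ≤ m p a) (h : ∀ p a u, ‖L (T a u) p‖ ≤ m p a * ‖L u p‖) :
    Tendsto T l (𝓝 0) := by
  rw [(ContinuousLinearMap.isInducing_postcomp L hL).tendsto_nhds_iff,
    ContinuousLinearMap.comp_zero]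
  exact tendsto_clm_pi_zero fun p => tendsto_clm_normed_zero_of_norm_le
    (L := (ContinuousLinearMap.proj p).comp L) (hm p) (hm0 p) fun a u => h p a u

end BoundedConvergence

/-! ### Multiplication operators on H^t(Γ) -/

section Multiplication

variable {d : ℕ} {Γ : TopologicalSpace.Compacts (Space d)} (t : ℝ)

open Sobolev

/-- Multiplication by a smooth function, on smooth functions. -/
def smoothMul (a : SmoothAlgebra Γ) :
    SmoothSobolev (Γ : Set (Space d)) t →ₗ[ℂ] SmoothSobolev (Γ : Set (Space d)) t where
  toFun f := ⟨a.1 * f.1, (smoothSubalgebra _).mul_mem a.2 f.2⟩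
  map_add' f g := Subtype.ext (mul_add a.1 f.1 g.1)
  map_smul' c f := Subtype.ext (mul_smul_comm c a.1 f.1)

/-- Each patch seminorm is controlled by itself, with a constant depending only on the localization
of a; this is the form needed both for boundedness and for continuity in a. -/
theorem norm_lift_smoothMul_le (a : SmoothAlgebra Γ) (p : LocalPatch (Γ : Set (Space d)))
    (f : SmoothSobolev (Γ : Set (Space d)) t) :
    ‖SmoothSobolev.lift _ t (smoothMul t a f) p‖ ≤
      multiplierNorm t (p.bump.toSchwartz ⟨a.1, a.2⟩) * ‖SmoothSobolev.lift _ t f p‖ := by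
  refine le_trans (le_of_eq ?_) (norm_sobolevLift_mul_le t _ (p.toSchwartz f))
  exact congrArg norm (congrArg (sobolevLift t)
    (p.toSchwartz_mul (a := ⟨a.1, a.2⟩) (f := f) (h := smoothMul t a f) rfl))

theorem continuous_smoothMul (a : SmoothAlgebra Γ) : Continuous (smoothMul t a) :=
  SmoothSobolev.continuous_of_lift_le _ fun p => ⟨{p}, _, fun u => by
    rw [Finset.sum_singleton]
    exact norm_lift_smoothMul_le t a p u⟩

/-- Multiplication by a smooth function on the Sobolev space. -/
def sobolevMul (a : SmoothAlgebra Γ) :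
    Sobolev (Γ : Set (Space d)) t →L[ℂ] Sobolev (Γ : Set (Space d)) t :=
  extendCLM (smoothMul t a) (continuous_smoothMul t a)

theorem sobolevMul_coe (a : SmoothAlgebra Γ) (u : SmoothSobolev (Γ : Set (Space d)) t) :
    sobolevMul t a (u : Sobolev (Γ : Set (Space d)) t) = (smoothMul t a u : SmoothSobolev _ t) :=
  extendCLM_coe _ _ u

theorem isSobolevExtension_sobolevMul (a : SmoothAlgebra Γ) :
    IsSobolevExtension (fun f => a.1 * f) (sobolevMul t a) := fun u =>
  ⟨smoothMul t a u, rfl, sobolevMul_coe t a u⟩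

theorem mulOp_eq (a : SmoothAlgebra Γ) : mulOp t a.1 = sobolevMul t a :=
  sobolevExtension_eq (isSobolevExtension_sobolevMul t a)

theorem norm_liftCLM_sobolevMul_le (a : SmoothAlgebra Γ) (p : LocalPatch (Γ : Set (Space d)))
    (u : Sobolev (Γ : Set (Space d)) t) :
    ‖liftCLM _ t (sobolevMul t a u) p‖ ≤
      multiplierNorm t (p.bump.toSchwartz ⟨a.1, a.2⟩) * ‖liftCLM _ t u p‖ := by
  induction u using UniformSpace.Completion.induction_on with
  | hp =>
    have h : Continuous fun u : Sobolev (Γ : Set (Space d)) t => liftCLM _ t u p :=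
      (continuous_apply p).comp (liftCLM _ t).continuous
    exact isClosed_le (h.comp (sobolevMul t a).continuous).norm (continuous_const.mul h.norm)
  | ih u =>
    rw [sobolevMul_coe, liftCLM_coe, liftCLM_coe]
    exact norm_lift_smoothMul_le t a p u

theorem sobolevMul_add (a b : SmoothAlgebra Γ) :
    sobolevMul t (a + b) = sobolevMul t a + sobolevMul t b :=
  ext_clm fun u => by
    rw [add_apply, sobolevMul_coe, sobolevMul_coe, sobolevMul_coe,
      ← UniformSpace.Completion.coe_add]
    congr 1
    exact Subtype.ext (add_mul a.1 b.1 u.1)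

theorem sobolevMul_mul (a b : SmoothAlgebra Γ) :
    sobolevMul t (a * b) = (sobolevMul t a).comp (sobolevMul t b) :=
  ext_clm fun u => by
    rw [ContinuousLinearMap.comp_apply, sobolevMul_coe, sobolevMul_coe, sobolevMul_coe]
    congr 1
    exact Subtype.ext (mul_assoc a.1 b.1 u.1)

theorem sobolevMul_smul (c : ℝ) (a : SmoothAlgebra Γ) :
    sobolevMul t (c • a) = c • sobolevMul t a :=
  ext_clm fun u => by
    rw [smul_apply, sobolevMul_coe, sobolevMul_coe]
    change _ = (c : ℂ) • ((smoothMul t a u : SmoothSobolev (Γ : Set (Space d)) t) :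
      Sobolev (Γ : Set (Space d)) t)
    rw [← UniformSpace.Completion.coe_smul]
    congr 1
    refine Subtype.ext (funext fun x => ?_)
    exact smul_mul_assoc c (a.1 x) (u.1 x)

/-- As a → 0 in C^∞(Γ) its localizations tend to 0 in the Schwartz space, hence so do the multiplier
constants. This transfers differentiability from C^∞(Γ) to operators. -/
theorem continuous_sobolevMul : Continuous (sobolevMul (Γ := Γ) t) := by
  have hadd : ∀ a b, sobolevMul (Γ := Γ) t (a + b) = sobolevMul t a + sobolevMul t b :=
    sobolevMul_add t
  refine continuous_of_continuousAt_zero (AddMonoidHom.mk' (sobolevMul (Γ := Γ) t) hadd) ?_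
  rw [ContinuousAt, map_zero]
  exact tendsto_clm_zero_of_norm_le isInducing_liftCLM (fun p => (tendsto_multiplierNorm t).comp
    p.bump.tendsto_toSchwartz) (fun p a => multiplierNorm_nonneg _ _)
    fun p a u => norm_liftCLM_sobolevMul_le t a p u

/-- Multiplication as a continuous linear map from the smooth functions to the operators on
`H^t(Γ)`. -/
def sobolevMulCLM : SmoothAlgebra Γ →L[ℝ]
    (Sobolev (Γ : Set (Space d)) t →L[ℂ] Sobolev (Γ : Set (Space d)) t) where
  toFun := sobolevMul t
  map_add' := sobolevMul_add t
  map_smul' := sobolevMul_smul t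
  cont := continuous_sobolevMul t

end Multiplication

/-! ### The tangential gradient from H^{t+1}(Γ) to H^t(Γ) -/

section Gradient

variable {d : ℕ} (Ω : SmoothDomain d) (t : ℝ)

open Sobolev

/-- A component of the tangential gradient, on smooth functions. -/
def smoothGrad (i : Fin d) : SmoothSobolev (Ω.boundary : Set (Space d)) (t + 1) →ₗ[ℂ]
    SmoothSobolev (Ω.boundary : Set (Space d)) t where
  toFun f := ⟨surfaceGradient Ω i f.1, exists_isSmoothExtension_surfaceGradient Ω f.2 i⟩
  map_add' f g := Subtype.ext (surfaceGradient_add Ω f.2 g.2 i)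
  map_smul' c f := Subtype.ext (surfaceGradient_smul Ω c f.2 i)

open LineDeriv in
theorem continuous_smoothGrad (i : Fin d) : Continuous (smoothGrad Ω t i) := by
  classical
  refine SmoothSobolev.continuous_of_lift_le _ fun p => ?_
  set e : Fin (d - 1) → Space (d - 1) := fun k => EuclideanSpace.single k 1
  -- The patch p controls the differentiated localization, at the cost of one order; the patches
  -- with differentiated cutoff control the commutator terms.
  set Q : Finset (LocalPatch (Ω.boundary : Set (Space d))) :=
    insert p (Finset.univ.image fun k => p.derivPatch (e k))
  refine ⟨Q, ∑ k, multiplierNorm t (p.gradCoeff i k) * (2 * Real.pi * ‖e k‖ + 1), fun u => ?_⟩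
  have hq : ∀ q ∈ Q, ‖sobolevLift (t + 1) (q.toSchwartz u)‖ ≤
      ∑ q ∈ Q, ‖SmoothSobolev.lift _ (t + 1) u q‖ := fun q hq =>
    Finset.single_le_sum (f := fun q => ‖SmoothSobolev.lift _ (t + 1) u q‖)
      (fun _ _ => norm_nonneg _) hq
  have h1 : SmoothSobolev.lift _ t (smoothGrad Ω t i u) p = ∑ k, sobolevLift t
      (schwartzMul (p.gradCoeff i k) (∂_{e k} (p.toSchwartz u) -
        (p.derivPatch (e k)).toSchwartz u)) := by
    rw [← map_sum]
    exact congrArg (sobolevLift t)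
      (p.toSchwartz_surfaceGradient i (f := u) (h := smoothGrad Ω t i u) rfl)
  rw [h1, Finset.sum_mul]
  refine (norm_sum_le _ _).trans (Finset.sum_le_sum fun k _ => ?_)
  refine (norm_sobolevLift_mul_le t _ _).trans ?_
  rw [mul_assoc]
  refine mul_le_mul_of_nonneg_left ?_ (multiplierNorm_nonneg _ _)
  rw [map_sub, add_mul, one_mul]
  refine (norm_sub_le _ _).trans (add_le_add ?_ ?_)
  · refine (norm_sobolevLift_lineDeriv_le t _ _).trans ?_
    exact mul_le_mul_of_nonneg_left (hq p (Finset.mem_insert_self _ _)) (by positivity)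
  · exact (norm_sobolevLift_le_succ t _).trans (hq _ (Finset.mem_insert_of_mem
      (Finset.mem_image_of_mem _ (Finset.mem_univ k))))

/-- A component of the tangential gradient on `Γ`, from `H^{t+1}(Γ)` to `H^t(Γ)`. -/
def sobolevGrad (i : Fin d) : Sobolev (Ω.boundary : Set (Space d)) (t + 1) →L[ℂ]
    Sobolev (Ω.boundary : Set (Space d)) t :=
  extendCLM (smoothGrad Ω t i) (continuous_smoothGrad Ω t i)

theorem sobolevGrad_coe (i : Fin d) (u : SmoothSobolev (Ω.boundary : Set (Space d)) (t + 1)) :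
    sobolevGrad Ω t i (u : Sobolev (Ω.boundary : Set (Space d)) (t + 1)) =
      (smoothGrad Ω t i u : SmoothSobolev _ t) :=
  extendCLM_coe _ _ u

end Gradient

/-! ### Rules of the Gâteaux calculus -/

section GateauxRules

variable {X Y R : Type*} [AddCommGroup X] [Module ℝ X] [TopologicalSpace X]
  [AddCommGroup Y] [Module ℝ Y] [TopologicalSpace Y]

/-- The class `C^m` in the sense of `IsGateauxCm`, with the continuity of all derivatives made
explicit. -/
def IsContGateauxCm : ℕ → Set X → (X → Y) → Prop
  | 0, U, f => ContinuousOn f U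
  | m + 1, U, f => ContinuousOn f U ∧ ∃ f' : X → X →L[ℝ] Y, HasContGateauxDerivOn U f f' ∧
      ∀ ξ : X, IsContGateauxCm m U (fun r => f' r ξ)

/-- The explicit continuity clause of the stronger class is what the product and inverse rules
consume at each level of the induction; it is dropped only at the end. -/
theorem IsContGateauxCm.isGateauxCm {m : ℕ} {U : Set X} {f : X → Y}
    (h : IsContGateauxCm m U f) : IsGateauxCm m U f := by
  induction m generalizing f with
  | zero => exact h
  | succ m ih =>
    obtain ⟨-, f', hf', h'⟩ := h
    exact ⟨f', hf', fun ξ => ih (h' ξ)⟩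

theorem IsContGateauxCm.of_succ {m : ℕ} {U : Set X} {f : X → Y}
    (h : IsContGateauxCm (m + 1) U f) : IsContGateauxCm m U f := by
  induction m generalizing f with
  | zero => exact h.1
  | succ m ih =>
    obtain ⟨hc, f', hf', h'⟩ := h
    exact ⟨hc, f', hf', fun ξ => ih (h' ξ)⟩

section Congr

variable [ContinuousAdd X] [ContinuousSMul ℝ X]

theorem HasGateauxSemideriv.congr {U : Set X} (hU : IsOpen U) {f g : X → Y} (hfg : EqOn f g U)
    {r ξ : X} (hr : r ∈ U) {y : Y} (h : HasGateauxSemideriv f r ξ y) :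
    HasGateauxSemideriv g r ξ y := by
  have ht : Tendsto (fun s : ℝ => r + s • ξ) (𝓝[≠] 0) (𝓝 r) :=
    (Continuous.tendsto' (by fun_prop) _ _ (by simp)).mono_left nhdsWithin_le_nhds
  refine Tendsto.congr' ?_ h
  filter_upwards [ht.eventually (hU.mem_nhds hr)] with s hs
  rw [hfg hs, hfg hr]

theorem IsGateauxCm.congr {m : ℕ} {U : Set X} (hU : IsOpen U) {f g : X → Y} (hfg : EqOn f g U)
    (h : IsGateauxCm m U f) : IsGateauxCm m U g := by
  cases m with
  | zero => exact ContinuousOn.congr h hfg.symm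
  | succ m =>
    obtain ⟨f', hf', h'⟩ := h
    exact ⟨f', ⟨fun r hr ξ => (hf'.hasSemideriv r hr ξ).congr hU hfg hr, hf'.continuousOn⟩, h'⟩

end Congr

omit [TopologicalSpace X] in
theorem HasGateauxSemideriv.const (c : Y) (r ξ : X) :
    HasGateauxSemideriv (fun _ => c) r ξ 0 := by
  simp only [HasGateauxSemideriv, sub_self, smul_zero]
  exact tendsto_const_nhds

theorem HasGateauxSemideriv.clm (L : X →L[ℝ] Y) (r ξ : X) : HasGateauxSemideriv L r ξ (L ξ) := by
  refine tendsto_const_nhds.congr' ?_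
  filter_upwards [self_mem_nhdsWithin] with s hs
  rw [map_add, add_sub_cancel_left, map_smul, smul_smul, inv_mul_cancel₀ hs, one_smul]

/-- Used to differentiate the matrix identities that hold throughout U. -/
theorem HasGateauxSemideriv.eq_zero_of_eqOn [ContinuousAdd X] [ContinuousSMul ℝ X] [T2Space Y]
    {U : Set X} (hU : IsOpen U) {f : X → Y} {c : Y} (hf : EqOn f (fun _ => c) U) {r ξ : X}
    (hr : r ∈ U) {y : Y} (h : HasGateauxSemideriv f r ξ y) : y = 0 :=
  tendsto_nhds_unique (h.congr hU hf hr) (HasGateauxSemideriv.const c r ξ)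

theorem IsContGateauxCm.exists_hasGateauxSemideriv {U : Set X} {f : X → Y}
    (h : IsContGateauxCm 1 U f) {r : X} (hr : r ∈ U) (ξ : X) : ∃ y, HasGateauxSemideriv f r ξ y :=
  let ⟨_, _, hf', _⟩ := h
  ⟨_, hf'.hasSemideriv r hr ξ⟩

theorem IsContGateauxCm.const (m : ℕ) (U : Set X) (c : Y) :
    IsContGateauxCm m U (fun _ => c) := by
  induction m generalizing c with
  | zero => exact continuousOn_const
  | succ m ih =>
    refine ⟨continuousOn_const, fun _ => 0, ⟨fun r _ ξ => HasGateauxSemideriv.const c r ξ, ?_⟩,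
      fun ξ => ?_⟩
    · simp only [zero_apply]
      exact continuousOn_const
    · simp only [zero_apply]
      exact ih 0

theorem IsContGateauxCm.clm (m : ℕ) (U : Set X) (L : X →L[ℝ] Y) : IsContGateauxCm m U L := by
  cases m with
  | zero => exact L.continuous.continuousOn
  | succ m =>
    exact ⟨L.continuous.continuousOn, fun _ => L, ⟨fun r _ ξ => HasGateauxSemideriv.clm L r ξ,
      (L.continuous.comp continuous_snd).continuousOn⟩, fun ξ => IsContGateauxCm.const m U _⟩

omit [TopologicalSpace X] in
theorem HasGateauxSemideriv.clm_comp {Z : Type*} [AddCommGroup Z] [Module ℝ Z] [TopologicalSpace Z]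
    {f : X → Y} {r ξ : X} {y : Y} (h : HasGateauxSemideriv f r ξ y) (L : Y →L[ℝ] Z) :
    HasGateauxSemideriv (fun r => L (f r)) r ξ (L y) := by
  refine ((L.continuous.tendsto y).comp h).congr fun s => ?_
  simp

theorem IsContGateauxCm.clm_comp {Z : Type*} [AddCommGroup Z] [Module ℝ Z] [TopologicalSpace Z]
    {m : ℕ} {U : Set X} {f : X → Y} (h : IsContGateauxCm m U f) (L : Y →L[ℝ] Z) :
    IsContGateauxCm m U (fun r => L (f r)) := by
  induction m generalizing f with
  | zero => exact L.continuous.comp_continuousOn h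
  | succ m ih =>
    obtain ⟨hc, f', hf', h'⟩ := h
    exact ⟨L.continuous.comp_continuousOn hc, fun r => L.comp (f' r),
      ⟨fun r hr ξ => (hf'.hasSemideriv r hr ξ).clm_comp L,
        L.continuous.comp_continuousOn hf'.continuousOn⟩, fun ξ => ih (h' ξ)⟩

omit [TopologicalSpace X] in
theorem HasGateauxSemideriv.add [ContinuousAdd Y] {f g : X → Y} {r ξ : X} {y z : Y}
    (hf : HasGateauxSemideriv f r ξ y) (hg : HasGateauxSemideriv g r ξ z) :
    HasGateauxSemideriv (fun r => f r + g r) r ξ (y + z) := by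
  refine (Tendsto.add hf hg).congr fun s => ?_
  rw [← smul_add, add_sub_add_comm]

omit [TopologicalSpace X] in
theorem HasGateauxSemideriv.sum [ContinuousAdd Y] {ι : Type*} (s : Finset ι) {f : ι → X → Y}
    {r ξ : X} {y : ι → Y} (h : ∀ i ∈ s, HasGateauxSemideriv (f i) r ξ (y i)) :
    HasGateauxSemideriv (fun r => ∑ i ∈ s, f i r) r ξ (∑ i ∈ s, y i) := by
  classical
  induction s using Finset.induction_on with
  | empty => simpa using HasGateauxSemideriv.const 0 r ξ
  | insert a s ha ih =>
    simp only [Finset.sum_insert ha]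
    exact (h a (Finset.mem_insert_self a s)).add
      (ih fun i hi => h i (Finset.mem_insert_of_mem hi))

theorem IsContGateauxCm.add [IsTopologicalAddGroup Y] {m : ℕ} {U : Set X}
    {f g : X → Y} (hf : IsContGateauxCm m U f) (hg : IsContGateauxCm m U g) :
    IsContGateauxCm m U (fun r => f r + g r) := by
  induction m generalizing f g with
  | zero => exact ContinuousOn.add hf hg
  | succ m ih =>
    obtain ⟨hfc, f', hf', hf''⟩ := hf
    obtain ⟨hgc, g', hg', hg''⟩ := hg
    exact ⟨hfc.add hgc, fun r => f' r + g' r,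
      ⟨fun r hr ξ => (hf'.hasSemideriv r hr ξ).add (hg'.hasSemideriv r hr ξ),
        hf'.continuousOn.add hg'.continuousOn⟩, fun ξ => ih (hf'' ξ) (hg'' ξ)⟩

theorem IsContGateauxCm.sum [IsTopologicalAddGroup Y] {m : ℕ} {U : Set X} {ι : Type*}
    (s : Finset ι) {f : ι → X → Y} (hf : ∀ i ∈ s, IsContGateauxCm m U (f i)) :
    IsContGateauxCm m U (fun r => ∑ i ∈ s, f i r) := by
  classical
  induction s using Finset.induction_on with
  | empty => simpa using IsContGateauxCm.const m U 0
  | insert a s ha ih =>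
    simp only [Finset.sum_insert ha]
    exact (hf a (Finset.mem_insert_self a s)).add
      (ih fun i hi => hf i (Finset.mem_insert_of_mem hi))

omit [TopologicalSpace X] in
theorem HasGateauxSemideriv.tendsto [ContinuousAdd Y] [ContinuousSMul ℝ Y] {f : X → Y} {r ξ : X}
    {y : Y} (h : HasGateauxSemideriv f r ξ y) :
    Tendsto (fun s : ℝ => f (r + s • ξ)) (𝓝[≠] 0) (𝓝 (f r)) := by
  have h1 : Tendsto (fun s : ℝ => s) (𝓝[≠] 0) (𝓝 0) := tendsto_id.mono_left nhdsWithin_le_nhds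
  have h2 := (h1.smul h).const_add (f r)
  rw [zero_smul, add_zero] at h2
  refine h2.congr' ?_
  filter_upwards [self_mem_nhdsWithin] with s hs
  rw [smul_smul, mul_inv_cancel₀ hs, one_smul, add_sub_cancel]

variable [CommRing R] [Algebra ℝ R] [TopologicalSpace R] [IsTopologicalRing R]
  [ContinuousSMul ℝ R]

omit [TopologicalSpace X] in
theorem HasGateauxSemideriv.mul {f g : X → R} {r ξ : X} {y z : R}
    (hf : HasGateauxSemideriv f r ξ y) (hg : HasGateauxSemideriv g r ξ z) :
    HasGateauxSemideriv (fun r => f r * g r) r ξ (f r * z + g r * y) := by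
  -- With Δ the increment from r to r + sξ, Δ(f g) = f(r) Δg + g(r + sξ) Δf.
  have h := (Tendsto.const_mul (f r) hg).add (Tendsto.mul hg.tendsto hf)
  refine h.congr fun s => ?_
  rw [mul_smul_comm, mul_smul_comm, ← smul_add]
  congr 1
  ring

theorem IsContGateauxCm.mul {m : ℕ} {U : Set X} {f g : X → R} (hf : IsContGateauxCm m U f)
    (hg : IsContGateauxCm m U g) : IsContGateauxCm m U (fun r => f r * g r) := by
  induction m generalizing f g with
  | zero => exact ContinuousOn.mul hf hg
  | succ m ih =>
    -- The derivative f g' + g f' involves f and g undifferentiated, which enter the induction one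
    -- order lower.
    have hf1 := hf.of_succ
    have hg1 := hg.of_succ
    obtain ⟨hfc, f', hf', hf''⟩ := hf
    obtain ⟨hgc, g', hg', hg''⟩ := hg
    have hm : MapsTo Prod.fst (U ×ˢ (univ : Set X)) U := fun p hp => hp.1
    refine ⟨hfc.mul hgc, fun r => f r • g' r + g r • f' r,
      ⟨fun r hr ξ => (hf'.hasSemideriv r hr ξ).mul (hg'.hasSemideriv r hr ξ), ?_⟩,
      fun ξ => (ih hf1 (hg'' ξ)).add (ih hg1 (hf'' ξ))⟩
    exact ((hfc.comp continuousOn_fst hm).mul hg'.continuousOn).add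
      ((hgc.comp continuousOn_fst hm).mul hf'.continuousOn)

theorem IsContGateauxCm.prod {m : ℕ} {U : Set X} {ι : Type*} (s : Finset ι) {f : ι → X → R}
    (hf : ∀ i ∈ s, IsContGateauxCm m U (f i)) : IsContGateauxCm m U (fun r => ∏ i ∈ s, f i r) := by
  classical
  induction s using Finset.induction_on with
  | empty => simpa using IsContGateauxCm.const m U 1
  | insert a s ha ih =>
    simp only [Finset.prod_insert ha]
    exact (hf a (Finset.mem_insert_self a s)).mul
      (ih fun i hi => hf i (Finset.mem_insert_of_mem hi))

omit [TopologicalSpace X] in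
-- The difference quotient of the inverse is -f(r + sξ)⁻¹ f(r)⁻¹ times that of f, so continuity of
-- inversion at f(r) yields the limit.
theorem HasGateauxSemideriv.ringInverse {f : X → R} {r ξ : X} {y : R}
    (hf : HasGateauxSemideriv f r ξ y) (hu : IsUnit (f r))
    (hu' : ∀ᶠ s : ℝ in 𝓝[≠] 0, IsUnit (f (r + s • ξ)))
    (hc : ContinuousAt Ring.inverse (f r)) :
    HasGateauxSemideriv (fun r => Ring.inverse (f r)) r ξ (-(Ring.inverse (f r) ^ 2) * y) := by
  have h := Tendsto.mul ((hc.tendsto.comp hf.tendsto).neg.mul_const (Ring.inverse (f r))) hf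
  rw [show -(Ring.inverse (f r) ^ 2) * y = -Ring.inverse (f r) * Ring.inverse (f r) * y by ring]
  refine h.congr' ?_
  filter_upwards [hu'] with s hs
  simp only [Function.comp_apply]
  rw [mul_smul_comm]
  congr 1
  have h1 := Ring.mul_inverse_cancel _ hu
  have h2 := Ring.mul_inverse_cancel _ hs
  linear_combination (-Ring.inverse (f r)) * h2 + Ring.inverse (f (r + s • ξ)) * h1

theorem IsContGateauxCm.ringInverse [ContinuousAdd X] [ContinuousSMul ℝ X] {m : ℕ} {U : Set X}
    (hU : IsOpen U) {f : X → R} (hf : IsContGateauxCm m U f) (hu : ∀ r ∈ U, IsUnit (f r))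
    (hc : ∀ a : R, IsUnit a → ContinuousAt Ring.inverse a) :
    IsContGateauxCm m U (fun r => Ring.inverse (f r)) := by
  have hcont : ∀ {f : X → R}, ContinuousOn f U → (∀ r ∈ U, IsUnit (f r)) →
      ContinuousOn (fun r => Ring.inverse (f r)) U := fun hf hu r hr =>
    (hc _ (hu r hr)).comp_continuousWithinAt (hf r hr)
  induction m with
  | zero => exact hcont hf hu
  | succ m ih =>
    have hf1 := ih hf.of_succ
    obtain ⟨hfc, f', hf', hf''⟩ := hf
    have hm : MapsTo Prod.fst (U ×ˢ (univ : Set X)) U := fun p hp => hp.1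
    refine ⟨hcont hfc hu, fun r => -(Ring.inverse (f r) ^ 2) • f' r, ⟨fun r hr ξ => ?_, ?_⟩,
      fun ξ => ?_⟩
    · refine (hf'.hasSemideriv r hr ξ).ringInverse (hu r hr) ?_ (hc _ (hu r hr))
      have ht : Tendsto (fun s : ℝ => r + s • ξ) (𝓝[≠] 0) (𝓝 r) :=
        (Continuous.tendsto' (by fun_prop) _ _ (by simp)).mono_left nhdsWithin_le_nhds
      exact (ht.eventually (hU.mem_nhds hr)).mono fun s hs => hu _ hs
    · exact (((hcont hfc hu).comp continuousOn_fst hm).pow 2).neg.mul hf'.continuousOn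
    · have := (((IsContGateauxCm.const m U (-1 : R)).mul hf1).mul hf1).mul (hf'' ξ)
      convert this using 2
      simp only [smul_apply, smul_eq_mul]
      ring

variable {n : Type*} [Fintype n] [DecidableEq n]

theorem IsContGateauxCm.det {m : ℕ} {U : Set X} {A : X → Matrix n n R}
    (hA : ∀ i j, IsContGateauxCm m U fun r => A r i j) :
    IsContGateauxCm m U fun r => (A r).det := by
  simp only [Matrix.det_apply']
  exact IsContGateauxCm.sum _ fun σ _ => (IsContGateauxCm.const m U _).mul
    (IsContGateauxCm.prod _ fun i _ => hA _ _)

theorem IsContGateauxCm.adjugate {m : ℕ} {U : Set X} {A : X → Matrix n n R}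
    (hA : ∀ i j, IsContGateauxCm m U fun r => A r i j) (i j : n) :
    IsContGateauxCm m U fun r => (A r).adjugate i j := by
  simp only [Matrix.adjugate_apply]
  refine IsContGateauxCm.det fun k l => ?_
  simp only [Matrix.updateRow_apply]
  split_ifs
  · exact IsContGateauxCm.const m U _
  · exact hA k l

theorem IsContGateauxCm.matrix_inv [ContinuousAdd X] [ContinuousSMul ℝ X] {m : ℕ} {U : Set X}
    (hU : IsOpen U) {A : X → Matrix n n R} (hA : ∀ i j, IsContGateauxCm m U fun r => A r i j)
    (hu : ∀ r ∈ U, IsUnit (A r).det) (hc : ∀ a : R, IsUnit a → ContinuousAt Ring.inverse a)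
    (i j : n) : IsContGateauxCm m U fun r => (A r)⁻¹ i j := by
  simp only [Matrix.inv_def, Matrix.smul_apply, smul_eq_mul]
  exact (IsContGateauxCm.ringInverse hU (IsContGateauxCm.det hA) hu hc).mul
    (IsContGateauxCm.adjugate hA i j)

omit [DecidableEq n] in
theorem IsContGateauxCm.matrix_mul {m : ℕ} {U : Set X} {A B : X → Matrix n n R}
    (hA : ∀ i j, IsContGateauxCm m U fun r => A r i j)
    (hB : ∀ i j, IsContGateauxCm m U fun r => B r i j) (i j : n) :
    IsContGateauxCm m U fun r => (A r * B r) i j := by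
  simp only [Matrix.mul_apply]
  exact IsContGateauxCm.sum _ fun k _ => (hA i k).mul (hB k j)

end GateauxRules

/-! ### Rank one perturbations and cofactors -/

section Cofactor

open Matrix

variable {ι R : Type*} [Fintype ι] [DecidableEq ι] [CommRing R]

/-- Multilinearity: the rank one term is added one row at a time. -/
theorem det_add_vecMulVec (M : Matrix ι ι R) (u v : ι → R) :
    (M + vecMulVec u v).det = M.det + ∑ i, u i * (M.updateRow i v).det := by
  have key : ∀ s : Finset ι, (M + vecMulVec (fun i => if i ∈ s then u i else 0) v).det =
      M.det + ∑ i ∈ s, u i * (M.updateRow i v).det := by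
    intro s
    induction s using Finset.induction_on with
    | empty =>
      have : vecMulVec (fun _ => 0) v = (0 : Matrix ι ι R) := zero_vecMulVec v
      simp [this]
    | insert j s hj ih =>
      set N := M + vecMulVec (fun i => if i ∈ s then u i else 0) v with hN
      have h1 : M + vecMulVec (fun i => if i ∈ insert j s then u i else 0) v =
          N.updateRow j (N j + u j • v) := by
        ext i k
        by_cases hij : i = j
        · subst hij
          simp [hN, vecMulVec_apply, hj]
        · simp [hN, vecMulVec_apply, hij]
      -- Once row j is v, the multiples of v already added to the other rows do not change the
      -- determinant.
      have h2 : (N.updateRow j v).det = (M.updateRow j v).det := by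
        refine det_eq_of_forall_row_eq_smul_add_const (fun i => if i ∈ s then u i else 0) j
          (if_neg hj) fun i k => ?_
        by_cases hij : i = j
        · subst hij
          simp [hj]
        · simp [hN, vecMulVec_apply, hij]
      rw [h1, det_updateRow_add, det_updateRow_smul, updateRow_eq_self, h2, ih,
        Finset.sum_insert hj]
      ring
  simpa using key Finset.univ

theorem det_add_vecMulVec' (M : Matrix ι ι R) (u v : ι → R) :
    (M + vecMulVec u v).det = M.det + (v ᵥ* M.adjugate) ⬝ᵥ u := by
  rw [det_add_vecMulVec, dotProduct]
  congr 1
  refine Finset.sum_congr rfl fun i _ => ?_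
  rw [mul_comm, ← cramer_transpose_apply, cramer_eq_adjugate_mulVec, ← adjugate_transpose,
    mulVec_transpose]

/-- Expanding det(M + (u + b) vᵀ) around M and around M + u vᵀ, for all b, forces the two row
vectors to agree. Hence cof(Id + Dr) n only sees tangential derivatives. -/
theorem vecMul_adjugate_add_vecMulVec (M : Matrix ι ι R) (u v : ι → R) :
    v ᵥ* (M + vecMulVec u v).adjugate = v ᵥ* M.adjugate := by
  have h : ∀ b, (v ᵥ* (M + vecMulVec u v).adjugate) ⬝ᵥ b = (v ᵥ* M.adjugate) ⬝ᵥ b := by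
    intro b
    have h1 := det_add_vecMulVec' (M + vecMulVec u v) b v
    rw [add_assoc, ← add_vecMulVec, det_add_vecMulVec', det_add_vecMulVec', dotProduct_add,
      add_assoc, add_right_inj, add_right_inj] at h1
    exact h1.symm
  exact dotProduct_eq _ _ h

/-- A = J (1 - n nᵀ) kills n, so some b is outside its range, and A + b nᵀ is invertible since J is
injective on the complement of n. It differs from J by a term (·) nᵀ and so has the same nᵀ adj(·),
which cannot vanish for an invertible matrix. -/
theorem vecMul_adjugate_ne_zero {K : Type*} [Field K] {J : Matrix ι ι K} {n : ι → K}
    (hn : n ⬝ᵥ n = 1) (hJ : ∀ v, n ⬝ᵥ v = 0 → J *ᵥ v = 0 → v = 0) : n ᵥ* J.adjugate ≠ 0 := by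
  intro hw
  have hn0 : n ≠ 0 := by
    rintro rfl
    simp at hn
  set A := J * (1 - vecMulVec n n)
  have hA : ∀ v, A *ᵥ v = J *ᵥ (v - (n ⬝ᵥ v) • n) := fun v => by
    rw [← mulVec_mulVec, sub_mulVec, one_mulVec, vecMulVec_mulVec]
    simp
  have hAn : ¬ Function.Injective (mulVecLin A) := fun h => hn0 <| h <| by
    rw [map_zero, mulVecLin_apply, hA, hn]
    simp
  rw [LinearMap.injective_iff_surjective, Function.Surjective] at hAn
  push Not at hAn
  obtain ⟨b, hb⟩ := hAn
  have hM : J + vecMulVec (b - J *ᵥ n) n = A + vecMulVec b n := by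
    simp only [A, mul_sub, mul_one, mul_vecMulVec, sub_vecMulVec]
    abel
  have hdet : (A + vecMulVec b n).det ≠ 0 := by
    rw [← isUnit_iff_ne_zero, ← isUnit_iff_isUnit_det, ← mulVec_injective_iff_isUnit,
      ← coe_mulVecLin, injective_iff_map_eq_zero]
    intro a ha
    rw [mulVecLin_apply, add_mulVec, vecMulVec_mulVec] at ha
    have h0 : n ⬝ᵥ a = 0 := by
      by_contra h0
      refine hb (-(n ⬝ᵥ a)⁻¹ • a) ?_
      rw [map_smul, mulVecLin_apply, eq_neg_of_add_eq_zero_left ha]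
      simp [smul_smul, inv_mul_cancel₀ h0]
    refine hJ a h0 ?_
    rw [h0, hA, h0] at ha
    simpa using ha
  have h1 : n ᵥ* ((A + vecMulVec b n).adjugate * (A + vecMulVec b n)) = 0 := by
    rw [← vecMul_vecMul, ← hM, vecMul_adjugate_add_vecMulVec, hw, zero_vecMul]
  rw [adjugate_mul, vecMul_smul, vecMul_one] at h1
  exact hn0 ((smul_eq_zero.1 h1).resolve_left hdet)

variable (n : ι → R) (H : Matrix ι ι R)

/-- The vector `cof(H) n`. -/
def cofactorNormal : ι → R := n ᵥ* H.adjugate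

/-- The transpose of `H`, followed by the projection along `n`. -/
def tangentialTranspose : Matrix ι ι R := Hᵀ - vecMulVec n n

/-- The projection along `n`, followed by the inverse of `tangentialTranspose n H` whose range is
orthogonal to `cofactorNormal n H`. -/
def tangentialInverse : Matrix ι ι R :=
  (tangentialTranspose n H + vecMulVec n (cofactorNormal n H))⁻¹ * (1 - vecMulVec n n)

variable {n H} (hn : n ⬝ᵥ n = 1) (hH : H *ᵥ n = n)
include hn hH

theorem cofactorNormal_dotProduct : cofactorNormal n H ⬝ᵥ n = H.det := by
  have h : H.adjugate *ᵥ n = H.det • n := by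
    conv_lhs => rw [← hH]
    rw [mulVec_mulVec, adjugate_mul, smul_mulVec, one_mulVec]
  rw [cofactorNormal, ← dotProduct_mulVec, h, dotProduct_smul, hn, smul_eq_mul, mul_one]

/-- The transposed matrix is H + (w - n) nᵀ, whose determinant is det H + w·(w - n), and w·n = det
H. So w·w being a unit is exactly what makes the inverse exist. -/
theorem det_tangentialTranspose_add :
    (tangentialTranspose n H + vecMulVec n (cofactorNormal n H)).det =
      cofactorNormal n H ⬝ᵥ cofactorNormal n H := by
  have h : tangentialTranspose n H + vecMulVec n (cofactorNormal n H) =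
      (H + vecMulVec (cofactorNormal n H - n) n)ᵀ := by
    rw [tangentialTranspose, transpose_add, transpose_vecMulVec, vecMulVec_sub]
    abel
  rw [h, det_transpose, det_add_vecMulVec', ← cofactorNormal, dotProduct_sub,
    cofactorNormal_dotProduct hn hH]
  ring

theorem tangentialTranspose_mulVec_cofactorNormal :
    tangentialTranspose n H *ᵥ cofactorNormal n H = 0 := by
  have h : Hᵀ *ᵥ cofactorNormal n H = H.det • n := by
    rw [mulVec_transpose, cofactorNormal, vecMul_vecMul, adjugate_mul, vecMul_smul, vecMul_one]
  rw [tangentialTranspose, sub_mulVec, h, vecMulVec_mulVec, dotProduct_comm,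
    cofactorNormal_dotProduct hn hH]
  simp

omit [DecidableEq ι] in
theorem vecMul_tangentialTranspose : n ᵥ* tangentialTranspose n H = 0 := by
  rw [tangentialTranspose, vecMul_sub, vecMul_transpose, hH, vecMul_vecMulVec, hn]
  simp

theorem sub_vecMulVec_mul_tangentialTranspose :
    (1 - vecMulVec n n) * tangentialTranspose n H = tangentialTranspose n H := by
  rw [sub_mul, one_mul, vecMulVec_mul, vecMul_tangentialTranspose hn hH]
  simp

variable (hu : IsUnit (cofactorNormal n H ⬝ᵥ cofactorNormal n H))
include hu

theorem isUnit_det_tangentialTranspose_add :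
    IsUnit (tangentialTranspose n H + vecMulVec n (cofactorNormal n H)).det :=
  (det_tangentialTranspose_add hn hH).symm ▸ hu

theorem cofactorNormal_vecMul_tangentialInverse :
    cofactorNormal n H ᵥ* tangentialInverse n H = 0 := by
  have h : n ᵥ* (tangentialTranspose n H + vecMulVec n (cofactorNormal n H)) =
      cofactorNormal n H := by
    rw [vecMul_add, vecMul_tangentialTranspose hn hH, vecMul_vecMulVec, hn]
    simp
  conv_lhs => rw [← h]
  rw [tangentialInverse, vecMul_vecMul, ← mul_assoc,
    mul_nonsing_inv _ (isUnit_det_tangentialTranspose_add hn hH hu), one_mul, vecMul_sub, vecMul_one,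
    vecMul_vecMulVec, hn]
  simp

theorem tangentialTranspose_mul_tangentialInverse :
    tangentialTranspose n H * tangentialInverse n H = 1 - vecMulVec n n := by
  have h : (tangentialTranspose n H + vecMulVec n (cofactorNormal n H)) * tangentialInverse n H =
      1 - vecMulVec n n := by
    rw [tangentialInverse, ← mul_assoc,
      mul_nonsing_inv _ (isUnit_det_tangentialTranspose_add hn hH hu), one_mul]
  rwa [add_mul, vecMulVec_mul, cofactorNormal_vecMul_tangentialInverse hn hH hu, vecMulVec_zero,
    add_zero] at h

/-- With F = S + n wᵀ, S w = 0 gives F w = (w·w) n, hence F⁻¹ n = w / (w·w) and B S = F⁻¹ (F - n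
wᵀ). The result is the projection along w that defines the tangential gradient on Γ_r. -/
theorem tangentialInverse_mul_tangentialTranspose :
    tangentialInverse n H * tangentialTranspose n H =
      1 - Ring.inverse (cofactorNormal n H ⬝ᵥ cofactorNormal n H) •
        vecMulVec (cofactorNormal n H) (cofactorNormal n H) := by
  set F := tangentialTranspose n H + vecMulVec n (cofactorNormal n H) with hF
  have hFu := isUnit_det_tangentialTranspose_add hn hH hu
  have h1 : F *ᵥ cofactorNormal n H = (cofactorNormal n H ⬝ᵥ cofactorNormal n H) • n := by
    rw [add_mulVec, tangentialTranspose_mulVec_cofactorNormal hn hH, vecMulVec_mulVec]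
    simp
  have h2 : F⁻¹ *ᵥ n = Ring.inverse (cofactorNormal n H ⬝ᵥ cofactorNormal n H) •
      cofactorNormal n H := by
    have : F⁻¹ *ᵥ (F *ᵥ cofactorNormal n H) = cofactorNormal n H := by
      rw [mulVec_mulVec, nonsing_inv_mul _ hFu, one_mulVec]
    rw [h1, mulVec_smul] at this
    have h := congrArg (Ring.inverse (cofactorNormal n H ⬝ᵥ cofactorNormal n H) • ·) this
    simpa only [smul_smul, Ring.inverse_mul_cancel _ hu, one_smul] using h
  have h3 : tangentialTranspose n H = F - vecMulVec n (cofactorNormal n H) :=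
    eq_sub_of_add_eq hF.symm
  rw [tangentialInverse, mul_assoc, sub_vecMulVec_mul_tangentialTranspose hn hH, ← hF, h3, mul_sub,
    nonsing_inv_mul _ hFu, mul_vecMulVec, h2, smul_vecMulVec]

/-- The derivative of `tangentialInverse n H` is determined by the linearizations of the equations
that characterize `tangentialInverse n H` and `cofactorNormal n H`. -/
theorem eq_of_linearized {X B' : Matrix ι ι R} {w' : ι → R}
    (h1 : cofactorNormal n H ᵥ* B' + w' ᵥ* tangentialInverse n H = 0)
    (h2 : tangentialTranspose n H * B' + Xᵀ * tangentialInverse n H = 0)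
    (h3 : tangentialTranspose n H *ᵥ w' + Xᵀ *ᵥ cofactorNormal n H = 0) :
    B' = -(tangentialInverse n H * Xᵀ * tangentialInverse n H) +
      Ring.inverse (cofactorNormal n H ⬝ᵥ cofactorNormal n H) • vecMulVec (cofactorNormal n H)
        (((tangentialInverse n H * Xᵀ) *ᵥ cofactorNormal n H) ᵥ* tangentialInverse n H) := by
  have hB := tangentialInverse_mul_tangentialTranspose hn hH hu
  have hw := cofactorNormal_vecMul_tangentialInverse hn hH hu
  set w := cofactorNormal n H
  set B := tangentialInverse n H
  set c := Ring.inverse (w ⬝ᵥ w)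
  -- Applying B to the third equation determines w' up to a multiple of w, which is harmless because
  -- wᵀ B = 0.
  have e1 : w' ᵥ* B = -(((B * Xᵀ) *ᵥ w) ᵥ* B) := by
    have : w' = -((B * Xᵀ) *ᵥ w) + (c * (w ⬝ᵥ w')) • w := by
      have h := congrArg (B *ᵥ ·) h3
      simp only [mulVec_add, mulVec_mulVec, mulVec_zero, hB, sub_mulVec, one_mulVec, smul_mulVec,
        vecMulVec_mulVec] at h
      rw [← eq_neg_of_add_eq_zero_left h]
      simp [smul_smul]
    conv_lhs => rw [this]
    rw [add_vecMul, smul_vecMul, hw, neg_vecMul]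
    simp
  -- The second equation, multiplied by B, determines the part of B' projected along w; the first
  -- one supplies the missing row wᵀ B'.
  have e2 : B * (tangentialTranspose n H * B') + B * (Xᵀ * B) = 0 := by
    rw [← mul_add, h2, mul_zero]
  rw [← mul_assoc, hB, sub_mul, one_mul, smul_mul_assoc, vecMulVec_mul,
    eq_neg_of_add_eq_zero_left h1, e1, neg_neg, ← mul_assoc] at e2
  rw [← sub_eq_zero, ← e2]
  abel

end Cofactor

/-! ### The pulled back normal and gradient -/

section PulledBack

open Matrix hiding add_apply sub_apply

variable {d : ℕ} (Ω : SmoothDomain d)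

/-- The components of the normal of `Γ`. -/
def SmoothDomain.normalVec (i : Fin d) : SmoothAlgebra Ω.boundary :=
  SmoothAlgebra.mk (fun x => (Ω.normal x i : ℂ))
    (let ⟨N, hN⟩ := Ω.exists_isSmoothExtension_normal
    ⟨fun x => Deformation.complexCoord i (N x),
      (Deformation.complexCoord i).contDiff.comp hN.1, fun x => by simp [hN.2]⟩)

@[simp] theorem SmoothDomain.normalVec_apply (i : Fin d) (x : Pts Ω.boundary) :
    SmoothAlgebra.eval x (Ω.normalVec i) = (Ω.normal x i : ℂ) := rfl

theorem SmoothDomain.sum_normal_mul_normal (x : Pts Ω.boundary) :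
    ∑ i, Ω.normal x i * Ω.normal x i = 1 := by
  have h := real_inner_self_eq_norm_sq (Ω.normal x)
  rw [Ω.norm_normal, PiLp.inner_apply, one_pow] at h
  exact h

theorem SmoothDomain.normalVec_dotProduct : Ω.normalVec ⬝ᵥ Ω.normalVec = 1 := by
  refine SmoothAlgebra.ext fun x => ?_
  change SmoothAlgebra.eval x _ = SmoothAlgebra.eval x _
  rw [dotProduct, map_sum, map_one]
  simp only [map_mul, Ω.normalVec_apply]
  exact_mod_cast Ω.sum_normal_mul_normal x

/-- The matrix of the tangential derivatives of `Id + r`, completed by the identity in the normal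
direction. -/
def tangentJacobian (r : Deformation Ω.boundary) :
    Matrix (Fin d) (Fin d) (SmoothAlgebra Ω.boundary) :=
  1 + of fun j k => coordDeriv Ω k j r

variable {Ω}

theorem coordDeriv_apply {r : Deformation Ω.boundary} {g : Space d → Space d}
    (hg : IsSmoothExtension r.toFun g) (k j : Fin d) (x : Pts Ω.boundary) :
    SmoothAlgebra.eval x (coordDeriv Ω k j r) = (fderiv ℝ g x (Ω.tangentVec k x) j : ℂ) := by
  change surfaceGradient Ω k (fun x => (r.toFun x j : ℂ)) x = _
  rw [surfaceGradient_eq_fderiv_extension (Deformation.isSmoothExtension_coord hg j)]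
  exact congrArg (fun L : Space d →L[ℝ] ℂ => L (Ω.tangentVec k x))
    ((Deformation.complexCoord j).hasFDerivAt.comp (x : Space d)
      (hg.1.differentiable (by simp) _).hasFDerivAt).fderiv

theorem SmoothDomain.sum_normal_smul_tangentVec (x : Pts Ω.boundary) :
    ∑ k, Ω.normal x k • Ω.tangentVec k x = 0 := by
  simp only [SmoothDomain.tangentVec, smul_sub, Finset.sum_sub_distrib, smul_smul,
    ← Finset.sum_smul, Ω.sum_normal_mul_normal]
  rw [sub_eq_zero, one_smul]
  exact sum_apply_single LinearMap.id (Ω.normal x)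

/-- The normal combination Σ n_k D_k of the tangential derivatives vanishes, since the projected
unit vectors satisfy Σ n_k T_k = 0. -/
theorem tangentJacobian_mulVec_normalVec (r : Deformation Ω.boundary) :
    tangentJacobian Ω r *ᵥ Ω.normalVec = Ω.normalVec := by
  obtain ⟨g, hg⟩ := r.exists_extension
  rw [tangentJacobian, add_mulVec, one_mulVec, add_eq_left]
  refine funext fun j => SmoothAlgebra.ext fun x => ?_
  simp only [mulVec, dotProduct, of_apply, map_sum, map_mul, coordDeriv_apply hg,
    Ω.normalVec_apply, Pi.zero_apply, map_zero]
  have h := congrArg (fun v => fderiv ℝ g x v j) (SmoothDomain.sum_normal_smul_tangentVec x)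
  simp only [map_sum, map_smul, map_zero, PiLp.zero_apply, WithLp.ofLp_sum, Finset.sum_apply,
    PiLp.smul_apply, smul_eq_mul] at h
  rw [← Complex.ofReal_zero, ← h]
  push_cast
  exact Finset.sum_congr rfl fun k _ => mul_comm _ _

variable (Ω)

/-- The unnormalized normal `w_r`, with smooth complex valued functions as components. -/
def normalWVec (r : Deformation Ω.boundary) : Fin d → SmoothAlgebra Ω.boundary :=
  cofactorNormal Ω.normalVec (tangentJacobian Ω r)

variable {Ω}

theorem normalW_eq_vecMul (r : Deformation Ω.boundary) (x : Pts Ω.boundary) (i : Fin d) :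
    normalW Ω r x i = ((Ω.normal x).ofLp ᵥ* (r.jacobian x).adjugate) i := by
  rw [normalW, mulVec_transpose]

/-- The full Jacobian of the chosen extension differs from the tangential one by (∂_n g) nᵀ, which
drops out of the cofactor vector. -/
theorem normalWVec_apply (r : Deformation Ω.boundary) (i : Fin d) (x : Pts Ω.boundary) :
    SmoothAlgebra.eval x (normalWVec Ω r i) = (normalW Ω r x i : ℂ) := by
  have hg := smoothExtension_spec r.exists_extension
  set g := smoothExtension r.toFun
  set M : Matrix (Fin d) (Fin d) ℝ := 1 + of fun j k => fderiv ℝ g x (Ω.tangentVec k x) j with hM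
  have h1 : r.jacobian x = M + vecMulVec (fderiv ℝ g x (Ω.normal x)).ofLp (Ω.normal x).ofLp := by
    rw [Deformation.jacobian, hM, add_assoc]
    congr 1
    ext j k
    simp only [of_apply, Matrix.add_apply, vecMulVec_apply, SmoothDomain.tangentVec, map_sub, map_smul,
      PiLp.sub_apply, PiLp.smul_apply, smul_eq_mul]
    simp only [g]
    ring
  have h2 : (SmoothAlgebra.eval x).toRingHom.mapMatrix (tangentJacobian Ω r) =
      Complex.ofRealHom.mapMatrix M := by
    rw [tangentJacobian, hM, map_add, map_add, map_one, map_one]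
    congr 1
    ext j k
    exact coordDeriv_apply hg k j x
  rw [normalW_eq_vecMul, h1, vecMul_adjugate_add_vecMulVec, normalWVec, cofactorNormal]
  have h3 : ((SmoothAlgebra.eval x).toRingHom.mapMatrix (tangentJacobian Ω r).adjugate) =
      Complex.ofRealHom.mapMatrix M.adjugate := by
    rw [RingHom.map_adjugate, h2, RingHom.map_adjugate]
  simp only [vecMul, dotProduct, map_sum, map_mul, Complex.ofReal_sum, Complex.ofReal_mul]
  refine Finset.sum_congr rfl fun k _ => ?_
  exact congrArg _ (congrFun (congrFun h3 k) i)

/-- The components are real, so the bilinear w·w is the squared norm although the algebra is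
complex. -/
theorem sum_normalW_mul_normalW (r : Deformation Ω.boundary) (x : Pts Ω.boundary) :
    SmoothAlgebra.eval x (normalWVec Ω r ⬝ᵥ normalWVec Ω r) = ((‖normalW Ω r x‖ ^ 2 : ℝ) : ℂ) := by
  rw [← real_inner_self_eq_norm_sq, PiLp.inner_apply, dotProduct, map_sum]
  simp [normalWVec_apply, ← sq]

section Diffeo

variable {r : Deformation Ω.boundary} (hr : r.IsDiffeo)
include hr

theorem Deformation.IsDiffeo.injective : Function.Injective r.map := by
  obtain ⟨s, -, hs⟩ := hr
  intro x y h
  exact Subtype.ext (by rw [← hs x, ← hs y, h])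

theorem Deformation.IsDiffeo.pushforward_apply {F : Type*} (u : Pts Ω.boundary → F)
    (x : Pts Ω.boundary) : r.pushforward u ⟨r.map x, mem_range_self x⟩ = u x := by
  rw [Deformation.pushforward]
  congr 1
  exact hr.injective (mem_range_self x : r.map x ∈ range r.map).choose_spec

theorem Deformation.IsDiffeo.exists_isSmoothExtension_pushforward {F : Type*}
    [NormedAddCommGroup F] [NormedSpace ℝ F] {u : Pts Ω.boundary → F}
    (hu : ∃ g, IsSmoothExtension u g) : ∃ g, IsSmoothExtension (r.pushforward u) g := by
  obtain ⟨g, hg⟩ := hu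
  obtain ⟨s, hs, hsr⟩ := id hr
  refine ⟨g ∘ s, hg.1.comp hs, ?_⟩
  rintro ⟨_, x, rfl⟩
  rw [hr.pushforward_apply, Function.comp_apply, hsr, hg.2]

theorem normalN_apply (x : Pts Ω.boundary) :
    normalN Ω r x = ‖normalW Ω r x‖⁻¹ • normalW Ω r x := by
  rw [normalN, Deformation.pullback, deformedNormal, hr.pushforward_apply]

/-- Differentiating s ∘ (Id + r) = Id along Γ shows that Id + Dr is injective on tangent vectors,
and then the cofactor vector cannot vanish. -/
theorem normalW_ne_zero (x : Pts Ω.boundary) : normalW Ω r x ≠ 0 := by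
  intro h0
  refine vecMul_adjugate_ne_zero (J := r.jacobian x) (n := (Ω.normal x).ofLp)
    (Ω.sum_normal_mul_normal x) (fun v hv hJ => ?_)
    (funext fun i => by rw [← normalW_eq_vecMul, h0]; rfl)
  obtain ⟨s, hs, hsr⟩ := hr
  have hg := smoothExtension_spec r.exists_extension
  set g := smoothExtension r.toFun
  set V : Space d := WithLp.toLp 2 v
  have hV : inner ℝ (Ω.normal x) V = 0 := by
    rw [PiLp.inner_apply, ← hv, dotProduct]
    exact Finset.sum_congr rfl fun i _ => mul_comm _ _
  have hgd : DifferentiableAt ℝ g x := hg.1.differentiable (by simp) _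
  have hsd : ∀ y, DifferentiableAt ℝ s y := hs.differentiable (by simp)
  have hd : HasFDerivAt (fun y => s (y + g y) - y) ((fderiv ℝ s (x + g x)).comp
      (ContinuousLinearMap.id ℝ _ + fderiv ℝ g x) - ContinuousLinearMap.id ℝ _) (x : Space d) :=
    ((hsd _).hasFDerivAt.comp (x : Space d) ((hasFDerivAt_id _).add hgd.hasFDerivAt)).sub
      (hasFDerivAt_id _)
  have h1 := Ω.fderiv_eq_zero_of_inner_normal (x := x) (f := fun y => s (y + g y) - y)
    (((hs.comp (contDiff_id.add hg.1)).sub contDiff_id).contDiffAt.of_le (by simp))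
    (Eventually.of_forall fun y hy => by
      have := hsr ⟨y, hy⟩
      rw [Deformation.map] at this
      rw [hg.2 ⟨y, hy⟩, this, sub_self]) hV
  have h2 : V + fderiv ℝ g x V = 0 := by
    ext i
    have : _ = (0 : ℝ) := congrFun hJ i
    rw [Deformation.jacobian, add_mulVec, one_mulVec] at this
    rw [PiLp.add_apply, PiLp.zero_apply, ← this, Pi.add_apply]
    congr 1
    have h3 := sum_apply_single (fderiv ℝ g x).toLinearMap V
    rw [ContinuousLinearMap.coe_coe] at h3
    rw [← h3, WithLp.ofLp_sum, Finset.sum_apply, mulVec, dotProduct]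
    exact Finset.sum_congr rfl fun k _ => mul_comm _ _
  rw [hd.fderiv] at h1
  simp only [sub_apply, ContinuousLinearMap.comp_apply, add_apply, ContinuousLinearMap.id_apply, h2,
    map_zero, zero_sub, neg_eq_zero] at h1
  exact congrArg WithLp.ofLp h1

theorem isUnit_normalWVec_dotProduct : IsUnit (normalWVec Ω r ⬝ᵥ normalWVec Ω r) := by
  refine SmoothAlgebra.isUnit_iff.2 fun x => ?_
  change SmoothAlgebra.eval x _ ≠ 0
  rw [sum_normalW_mul_normalW]
  have := normalW_ne_zero hr x
  simp [this]

/-- N = w / √(w·w), and an extension of w·w stays positive near each point of Γ, where the square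
root is smooth; local smoothness suffices. -/
theorem exists_isSmoothExtension_normalN (i : Fin d) :
    ∃ g, IsSmoothExtension (fun x => (normalN Ω r x i : ℂ)) g := by
  obtain ⟨g, hg⟩ : ∃ g, IsSmoothExtension (fun x => SmoothAlgebra.eval x
    (normalWVec Ω r ⬝ᵥ normalWVec Ω r)) g := (normalWVec Ω r ⬝ᵥ normalWVec Ω r).exists_extension
  obtain ⟨f, hf⟩ : ∃ g, IsSmoothExtension (fun x => SmoothAlgebra.eval x (normalWVec Ω r i)) g :=
    (normalWVec Ω r i).exists_extension
  have hgx : ∀ x : Pts Ω.boundary, (g x).re = ‖normalW Ω r x‖ ^ 2 := fun x => by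
    rw [hg.2]
    beta_reduce
    rw [sum_normalW_mul_normalW, Complex.ofReal_re]
  have hre : ContDiff ℝ ∞ fun x => (g x).re := Complex.reCLM.contDiff.comp hg.1
  refine exists_isSmoothExtension_of_local Ω.boundary.isCompact.isClosed fun x hx => ?_
  have hpos : 0 < (g x).re := by
    rw [hgx ⟨x, hx⟩]
    exact pow_pos (norm_pos_iff.2 (normalW_ne_zero hr _)) 2
  refine ⟨_, hre.continuous.continuousAt.eventually (lt_mem_nhds hpos),
    fun y => ((Real.sqrt (g y).re)⁻¹ : ℝ) • f y, fun y hy => ?_, fun y hy _ => ?_⟩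
  · have hy' : (g y).re ≠ 0 := ne_of_gt hy
    exact (((hre.contDiffAt.sqrt hy').inv (Real.sqrt_pos.2 hy).ne').smul
      hf.1.contDiffAt).contDiffWithinAt
  · beta_reduce
    rw [hf.2 ⟨y, hy⟩, hgx ⟨y, hy⟩]
    beta_reduce
    rw [normalWVec_apply, Real.sqrt_sq (norm_nonneg _),
      normalN_apply hr]
    simp

/-- With q the full gradient of an extension V of the pushed forward function, the chain rule for u
= V ∘ (Id + r) gives ∇_Γ u = S q. The pulled back gradient is q projected along w, and this
projection is B S. -/
theorem pulledGradient_eq {u : Pts Ω.boundary → ℂ} (hu : ∃ g, IsSmoothExtension u g) (i : Fin d)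
    (x : Pts Ω.boundary) : pulledGradient Ω r i u x =
      ∑ k, SmoothAlgebra.eval x (tangentialInverse Ω.normalVec (tangentJacobian Ω r) i k) *
        surfaceGradient Ω k u x := by
  obtain ⟨g, hg⟩ := r.exists_extension
  have hV := smoothExtension_spec (hr.exists_isSmoothExtension_pushforward hu)
  set V := smoothExtension (r.pushforward u)
  have hVd : DifferentiableAt ℝ V (r.map x) := hV.1.differentiable (by simp) _
  have hgd : DifferentiableAt ℝ g x := hg.1.differentiable (by simp) _
  set L := fderiv ℝ V (r.map x) with hL
  set q : Fin d → ℂ := fun j => L (EuclideanSpace.single j 1) with hq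
  have hLq : ∀ v : Space d, L v = ∑ j, (v j : ℂ) * q j := fun v => by
    rw [← ContinuousLinearMap.coe_coe L, ← sum_apply_single]
    rfl
  have h1 : IsSmoothExtension u fun y => V (y + g y) :=
    ⟨hV.1.comp (contDiff_id.add hg.1), fun y => by
      beta_reduce
      rw [hg.2, ← hr.pushforward_apply u y, ← hV.2]
      rfl⟩
  have h2 : ∀ k, surfaceGradient Ω k u x = L (Ω.tangentVec k x + fderiv ℝ g x (Ω.tangentVec k x)) :=
    fun k => by
    have hVd' : HasFDerivAt V L (id (x : Space d) + g x) := by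
      rw [hg.2]
      exact hVd.hasFDerivAt
    rw [surfaceGradient_eq_fderiv_extension h1]
    exact congrArg (fun L : Space d →L[ℝ] ℂ => L (Ω.tangentVec k x))
      (hVd'.comp (x : Space d) ((hasFDerivAt_id _).add hgd.hasFDerivAt)).fderiv
  have h3 : ∀ k, surfaceGradient Ω k u x = ∑ j, SmoothAlgebra.eval x
      (tangentialTranspose Ω.normalVec (tangentJacobian Ω r) k j) * q j := fun k => by
    rw [h2, hLq]
    refine Finset.sum_congr rfl fun j _ => ?_
    congr 1
    rw [tangentialTranspose, Matrix.sub_apply, map_sub, transpose_apply, tangentJacobian,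
      Matrix.add_apply, map_add, of_apply, coordDeriv_apply hg, vecMulVec_apply, map_mul,
      Ω.normalVec_apply, Ω.normalVec_apply, PiLp.add_apply, Complex.ofReal_add,
      SmoothDomain.tangentVec, PiLp.sub_apply, PiLp.smul_apply, PiLp.single_apply,
      Matrix.one_apply]
    by_cases hjk : j = k <;> simp [hjk] <;> ring
  have h4 : pulledGradient Ω r i u x = q i - ((‖normalW Ω r x‖ ^ 2 : ℝ) : ℂ)⁻¹ *
      ∑ j, (normalW Ω r x i : ℂ) * (normalW Ω r x j : ℂ) * q j := by
    rw [pulledGradient, Deformation.pullback, tangentialGradient_eq_fderiv, deformedNormal,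
      hr.pushforward_apply, map_sub]
    congr 1
    rw [hLq, Finset.mul_sum]
    refine Finset.sum_congr rfl fun j _ => ?_
    simp only [PiLp.smul_apply, smul_eq_mul]
    push_cast
    ring
  have h5 := tangentialInverse_mul_tangentialTranspose Ω.normalVec_dotProduct
    (tangentJacobian_mulVec_normalVec r) (isUnit_normalWVec_dotProduct hr)
  have h6 : ∀ j, ∑ k, SmoothAlgebra.eval x
      (tangentialInverse Ω.normalVec (tangentJacobian Ω r) i k) * SmoothAlgebra.eval x
      (tangentialTranspose Ω.normalVec (tangentJacobian Ω r) k j) = (if i = j then 1 else 0) -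
      ((‖normalW Ω r x‖ ^ 2 : ℝ) : ℂ)⁻¹ * ((normalW Ω r x i : ℂ) * (normalW Ω r x j : ℂ)) := by
    intro j
    have h := congrArg (SmoothAlgebra.eval x) (congrFun (congrFun h5 i) j)
    rw [Matrix.mul_apply, map_sum, Matrix.sub_apply, map_sub, Matrix.smul_apply, smul_eq_mul,
      map_mul] at h
    simp only [map_mul] at h
    rw [h, vecMulVec_apply, map_mul, Matrix.one_apply]
    have h7 := SmoothAlgebra.eval_ringInverse _ (isUnit_normalWVec_dotProduct hr) x
    beta_reduce at h7
    rw [sum_normalW_mul_normalW] at h7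
    congr 1
    · split_ifs <;> simp
    · exact congrArg₂ _ h7 (congrArg₂ _ (normalWVec_apply r i x) (normalWVec_apply r j x))
  simp only [h3, Finset.mul_sum]
  rw [Finset.sum_comm]
  simp only [← mul_assoc, ← Finset.sum_mul, h6]
  rw [h4]
  simp only [sub_mul, Finset.sum_sub_distrib, ite_mul, one_mul, zero_mul, Finset.sum_ite_eq,
    Finset.mem_univ, if_true, Finset.mul_sum, mul_assoc]

end Diffeo

end PulledBack

/-! ### The pulled back gradient as a function of the deformation -/

section GradOp

open Matrix hiding add_apply sub_apply sum_apply
open Sobolev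

variable {d : ℕ}

instance {Γ : TopologicalSpace.Compacts (Space d)} : T2Space (SmoothAlgebra Γ) :=
  T2Space.of_injective_continuous (f := fun a x => SmoothAlgebra.eval x a)
    (fun _ _ h => SmoothAlgebra.ext (congrFun h))
    (continuous_pi fun x => SmoothAlgebra.continuous_eval x)

variable (Ω : SmoothDomain d)

/-- The matrix of the pulled back gradient with respect to the tangential gradient on `Γ`. -/
def gradMatrix (r : Deformation Ω.boundary) :
    Matrix (Fin d) (Fin d) (SmoothAlgebra Ω.boundary) :=
  tangentialInverse Ω.normalVec (tangentJacobian Ω r)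

variable (t : ℝ)

variable {Ω} in
-- The identity G(r) = B ∇_Γ on smooth functions exhibits the bounded extension: each summand is a
-- bounded D_k followed by a bounded multiplication.
theorem isSobolevExtension_pulledGradient {r : Deformation Ω.boundary} (hr : r.IsDiffeo)
    (i : Fin d) : IsSobolevExtension (pulledGradient Ω r i)
      (∑ k, (sobolevMul t (gradMatrix Ω r i k)).comp (sobolevGrad Ω t k)) := by
  intro u
  refine ⟨∑ k, smoothMul t (gradMatrix Ω r i k) (smoothGrad Ω t k u), ?_, ?_⟩
  · funext x
    refine Eq.trans ?_ (pulledGradient_eq hr u.2 i x).symm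
    have h : ∀ s : Finset (Fin d),
        (∑ k ∈ s, smoothMul t (gradMatrix Ω r i k) (smoothGrad Ω t k u)).toFun x =
        ∑ k ∈ s, (smoothMul t (gradMatrix Ω r i k) (smoothGrad Ω t k u)).toFun x := fun s =>
      map_sum ((LinearMap.proj x).comp (smoothFun ℂ ℂ (Ω.boundary : Set (Space d))).subtype) _ s
    rw [h]
    rfl
  · rw [sum_apply]
    refine Eq.trans ?_ (map_sum (coeCLM _ t) _ Finset.univ).symm
    exact Finset.sum_congr rfl fun k _ => by
      rw [ContinuousLinearMap.comp_apply, sobolevGrad_coe, sobolevMul_coe]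
      rfl

/-- The operator `u ↦ (a D_k u) e_i` as a function of `a`. -/
def gradSummand (i k : Fin d) : SmoothAlgebra Ω.boundary →L[ℝ]
    (Sobolev (Ω.boundary : Set (Space d)) (t + 1) →L[ℂ]
      VectorSobolev (Ω.boundary : Set (Space d)) t) :=
  (((ContinuousLinearMap.postcomp _ (ContinuousLinearMap.single ℂ
      (fun _ : Fin d => Sobolev (Ω.boundary : Set (Space d)) t) i)).comp
    (ContinuousLinearMap.precomp _ (sobolevGrad Ω t k))).restrictScalars ℝ).comp (sobolevMulCLM t)

theorem gradSummand_apply (i k : Fin d) (a : SmoothAlgebra Ω.boundary)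
    (u : Sobolev (Ω.boundary : Set (Space d)) (t + 1)) (j : Fin d) :
    gradSummand Ω t i k a u j = if j = i then sobolevMul t a (sobolevGrad Ω t k u) else 0 := by
  change (Pi.single i (sobolevMul t a (sobolevGrad Ω t k u)) :
    VectorSobolev (Ω.boundary : Set (Space d)) t) j = _
  rw [Pi.single_apply]

variable {Ω}

/-- Fixed continuous linear maps are applied to the entries of B(r), so differentiability only needs
to be shown in C^∞(Γ). -/
theorem gradOp_eq {r : Deformation Ω.boundary} (hr : r.IsDiffeo) :
    gradOp Ω t r = ∑ i, ∑ k, gradSummand Ω t i k (gradMatrix Ω r i k) := by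
  ext u j
  rw [gradOp, ContinuousLinearMap.pi_apply,
    sobolevExtension_eq (isSobolevExtension_pulledGradient t hr j)]
  simp only [sum_apply, Finset.sum_apply, gradSummand_apply, ContinuousLinearMap.comp_apply]
  simp

theorem isContGateauxCm_tangentJacobian (m : ℕ) (U : Set (Deformation Ω.boundary)) (j k : Fin d) :
    IsContGateauxCm m U fun r => tangentJacobian Ω r j k :=
  (IsContGateauxCm.const m U ((1 : Matrix (Fin d) (Fin d) (SmoothAlgebra Ω.boundary)) j k)).add
    (IsContGateauxCm.clm m U (coordDeriv Ω k j))

theorem isContGateauxCm_normalWVec (m : ℕ) (U : Set (Deformation Ω.boundary)) (i : Fin d) :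
    IsContGateauxCm m U fun r => normalWVec Ω r i := by
  simp only [normalWVec, cofactorNormal, vecMul, dotProduct]
  exact IsContGateauxCm.sum _ fun k _ => (IsContGateauxCm.const m U _).mul
    (IsContGateauxCm.adjugate (isContGateauxCm_tangentJacobian m U) k i)

theorem isContGateauxCm_gradMatrix (m : ℕ) {U : Set (Deformation Ω.boundary)} (hU : IsOpen U)
    (h : ∀ r ∈ U, r.IsDiffeo) (i k : Fin d) :
    IsContGateauxCm m U fun r => gradMatrix Ω r i k := by
  refine IsContGateauxCm.matrix_mul (B := fun _ => 1 - vecMulVec Ω.normalVec Ω.normalVec)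
    (IsContGateauxCm.matrix_inv hU (fun i j => ?_)
    (fun r hr => isUnit_det_tangentialTranspose_add Ω.normalVec_dotProduct
      (tangentJacobian_mulVec_normalVec r) (isUnit_normalWVec_dotProduct (h r hr)))
    fun a ha => SmoothAlgebra.continuousAt_ringInverse ha)
    (fun i j => IsContGateauxCm.const m U
      ((1 - vecMulVec Ω.normalVec Ω.normalVec : Matrix _ _ _) i j)) i k
  simp only [tangentialTranspose, Matrix.add_apply, transpose_apply,
    sub_eq_add_neg]
  exact ((isContGateauxCm_tangentJacobian m U j i).add (IsContGateauxCm.const m U _)).add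
    ((IsContGateauxCm.const m U _).mul (isContGateauxCm_normalWVec m U j))

theorem isGateauxSmooth_gradOp {U : Set (Deformation Ω.boundary)} (hU : IsOpen U)
    (h : ∀ r ∈ U, r.IsDiffeo) : IsGateauxSmooth U (gradOp Ω t) := fun m =>
  (IsContGateauxCm.sum _ fun i _ => IsContGateauxCm.sum _ fun k _ =>
    (isContGateauxCm_gradMatrix m hU h i k).clm_comp (gradSummand Ω t i k)).isGateauxCm.congr hU
    fun r hr => (gradOp_eq t (h r hr)).symm

end GradOp

/-! ### The derivative of the pulled back gradient -/

section Derivative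

open Matrix hiding add_apply sub_apply sum_apply neg_apply
open Sobolev

variable {d : ℕ} {Ω : SmoothDomain d} {U : Set (Deformation Ω.boundary)}

theorem hasGateauxSemideriv_tangentialTranspose (r ξ : Deformation Ω.boundary) (j k : Fin d) :
    HasGateauxSemideriv (fun r => tangentialTranspose Ω.normalVec (tangentJacobian Ω r) j k) r ξ
      (coordDeriv Ω j k ξ) := by
  have h := (HasGateauxSemideriv.const ((1 : Matrix (Fin d) (Fin d) (SmoothAlgebra Ω.boundary)) k j -
    vecMulVec Ω.normalVec Ω.normalVec j k) r ξ).add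
      (HasGateauxSemideriv.clm (coordDeriv Ω j k) r ξ)
  rw [zero_add] at h
  convert h using 2 with r
  simp only [tangentialTranspose, tangentJacobian, Matrix.sub_apply, transpose_apply,
    Matrix.add_apply, of_apply]
  ring

/-- The derivatives of B and w exist by smoothness; differentiating wᵀ B = 0, S B = 1 - n nᵀ and S w
= 0 then identifies B'. -/
theorem exists_hasGateauxSemideriv_gradMatrix (hU : IsOpen U) (h : ∀ r ∈ U, r.IsDiffeo)
    {r : Deformation Ω.boundary} (hr : r ∈ U) (ξ : Deformation Ω.boundary) :
    ∃ B' : Matrix (Fin d) (Fin d) (SmoothAlgebra Ω.boundary),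
      (∀ i k, HasGateauxSemideriv (fun r => gradMatrix Ω r i k) r ξ (B' i k)) ∧
      B' = -(gradMatrix Ω r * (of fun k i => coordDeriv Ω k i ξ) * gradMatrix Ω r) +
        Ring.inverse (normalWVec Ω r ⬝ᵥ normalWVec Ω r) • vecMulVec (normalWVec Ω r)
          (((gradMatrix Ω r * (of fun k i => coordDeriv Ω k i ξ)) *ᵥ normalWVec Ω r) ᵥ*
            gradMatrix Ω r) := by
  have h1 := fun i k =>
    (isContGateauxCm_gradMatrix 1 hU h i k).exists_hasGateauxSemideriv hr ξ
  have h2 := fun i =>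
    (isContGateauxCm_normalWVec 1 U i).exists_hasGateauxSemideriv hr ξ
  choose B' hB' using h1
  choose w' hw' using h2
  have hn := Ω.normalVec_dotProduct
  refine ⟨B', hB', ?_⟩
  refine eq_of_linearized hn (tangentJacobian_mulVec_normalVec r)
    (isUnit_normalWVec_dotProduct (h r hr)) (X := (of fun k i => coordDeriv Ω k i ξ)ᵀ) (w' := w')
    (funext fun k => ?_) (Matrix.ext fun i k => ?_) (funext fun i => ?_)
  · have hs := HasGateauxSemideriv.sum Finset.univ fun i _ => (hw' i).mul (hB' i k)
    refine Eq.trans ?_ (hs.eq_zero_of_eqOn hU (c := 0) (fun r hr => congrFun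
      (cofactorNormal_vecMul_tangentialInverse hn (tangentJacobian_mulVec_normalVec r)
        (isUnit_normalWVec_dotProduct (h r hr))) k) hr)
    rw [Finset.sum_add_distrib,
      Finset.sum_congr rfl fun i _ => mul_comm (gradMatrix Ω r i k) (w' i)]
    rfl
  · have hs := HasGateauxSemideriv.sum Finset.univ fun j _ =>
      (hasGateauxSemideriv_tangentialTranspose r ξ i j).mul (hB' j k)
    refine Eq.trans ?_ (hs.eq_zero_of_eqOn hU (fun r hr => congrFun (congrFun
      (tangentialTranspose_mul_tangentialInverse hn (tangentJacobian_mulVec_normalVec r)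
        (isUnit_normalWVec_dotProduct (h r hr))) i) k) hr)
    rw [Finset.sum_add_distrib,
      Finset.sum_congr rfl fun j _ => mul_comm (gradMatrix Ω r j k) (coordDeriv Ω i j ξ)]
    rfl
  · have hs := HasGateauxSemideriv.sum Finset.univ fun j _ =>
      (hasGateauxSemideriv_tangentialTranspose r ξ i j).mul (hw' j)
    refine Eq.trans ?_ (hs.eq_zero_of_eqOn hU (c := 0) (fun r hr => congrFun
      (tangentialTranspose_mulVec_cofactorNormal hn (tangentJacobian_mulVec_normalVec r)) i) hr)
    rw [Finset.sum_add_distrib,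
      Finset.sum_congr rfl fun j _ => mul_comm (normalWVec Ω r j) (coordDeriv Ω i j ξ)]
    rfl

/-- The components of the normal of the deformed surface, pulled back to `Γ`. -/
def normalNVec {r : Deformation Ω.boundary} (hr : r.IsDiffeo) (i : Fin d) :
    SmoothAlgebra Ω.boundary :=
  SmoothAlgebra.mk (fun x => (normalN Ω r x i : ℂ)) (exists_isSmoothExtension_normalN hr i)

/-- The derivative formula contains N only through such products, where the square root in the norm
disappears. -/
theorem normalNVec_mul {r : Deformation Ω.boundary} (hr : r.IsDiffeo) (i j : Fin d) :
    normalNVec hr i * normalNVec hr j = Ring.inverse (normalWVec Ω r ⬝ᵥ normalWVec Ω r) *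
      (normalWVec Ω r i * normalWVec Ω r j) := by
  refine SmoothAlgebra.ext fun x => ?_
  have h := SmoothAlgebra.eval_ringInverse _ (isUnit_normalWVec_dotProduct hr) x
  beta_reduce at h
  rw [sum_normalW_mul_normalW] at h
  change (normalN Ω r x i : ℂ) * (normalN Ω r x j : ℂ) = SmoothAlgebra.eval x _
  rw [map_mul, map_mul, h, normalWVec_apply, normalWVec_apply, normalN_apply hr,
    PiLp.smul_apply, PiLp.smul_apply, smul_eq_mul, smul_eq_mul]
  push_cast
  ring

theorem pulledGradientMatrix_eq {r : Deformation Ω.boundary} (hr : r.IsDiffeo)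
    (ξ : Deformation Ω.boundary) (j i : Fin d) : pulledGradientMatrix Ω r ξ j i =
      ((gradMatrix Ω r * of fun k i => coordDeriv Ω k i ξ) j i).1 := by
  funext x
  rw [pulledGradientMatrix, pulledGradient_eq hr (ξ.exists_isSmoothExtension_coord i)]
  change _ = SmoothAlgebra.eval x _
  rw [Matrix.mul_apply, map_sum]
  simp only [map_mul]
  rfl

theorem gradOp_apply (t : ℝ) {r : Deformation Ω.boundary} (hr : r.IsDiffeo)
    (u : Sobolev (Ω.boundary : Set (Space d)) (t + 1)) (i : Fin d) :
    gradOp Ω t r u i = ∑ k, sobolevMulCLM t (gradMatrix Ω r i k) (sobolevGrad Ω t k u) := by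
  rw [gradOp, ContinuousLinearMap.pi_apply,
    sobolevExtension_eq (isSobolevExtension_pulledGradient t hr i), sum_apply]
  rfl

theorem gradDeriv_eq (t : ℝ) {r : Deformation Ω.boundary} (hr : r.IsDiffeo)
    (ξ : Deformation Ω.boundary) (u : Sobolev (Ω.boundary : Set (Space d)) (t + 1)) (j : Fin d)
    {B' : Matrix (Fin d) (Fin d) (SmoothAlgebra Ω.boundary)}
    (hB' : B' = -(gradMatrix Ω r * (of fun k i => coordDeriv Ω k i ξ) * gradMatrix Ω r) +
        Ring.inverse (normalWVec Ω r ⬝ᵥ normalWVec Ω r) • vecMulVec (normalWVec Ω r)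
          (((gradMatrix Ω r * (of fun k i => coordDeriv Ω k i ξ)) *ᵥ normalWVec Ω r) ᵥ*
            gradMatrix Ω r)) :
    gradDeriv Ω t r ξ u j = ∑ l, sobolevMulCLM t (B' j l) (sobolevGrad Ω t l u) := by
  have hmul : ∀ (a b : SmoothAlgebra Ω.boundary) (v : Sobolev (Ω.boundary : Set (Space d)) t),
      sobolevMulCLM t a (sobolevMulCLM t b v) = sobolevMulCLM t (a * b) v := fun a b v =>
    (congrArg (fun T => T v) (sobolevMul_mul t a b)).symm
  set B := gradMatrix Ω r
  set G := B * of fun k i => coordDeriv Ω k i ξ with hG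
  set N := normalNVec hr with hN
  have e1 : ∀ i k, mulOp t (pulledGradientMatrix Ω r ξ i k) = sobolevMulCLM t (G i k) :=
    fun i k => by
      rw [pulledGradientMatrix_eq hr]
      exact mulOp_eq t _
  have e2 : mulOp t (fun x => (normalN Ω r x j : ℂ)) = sobolevMulCLM t (N j) := mulOp_eq t (N j)
  set c := Ring.inverse (normalWVec Ω r ⬝ᵥ normalWVec Ω r) with hc
  obtain ⟨v, hv⟩ : ∃ v : Fin d → SmoothAlgebra Ω.boundary, ∀ k, v k = ∑ i, G k i * N i :=
    ⟨_, fun _ => rfl⟩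
  have e3 : ∀ k, mulOp t (fun x => ∑ i, pulledGradientMatrix Ω r ξ k i x * (normalN Ω r x i : ℂ)) =
      sobolevMulCLM t (v k) := fun k => by
    rw [show (fun x => ∑ i, pulledGradientMatrix Ω r ξ k i x * (normalN Ω r x i : ℂ)) =
      (v k).1 from funext fun x => ?_]
    · exact mulOp_eq t _
    · change _ = SmoothAlgebra.eval x _
      rw [hv, map_sum]
      refine Finset.sum_congr rfl fun i _ => ?_
      rw [map_mul, pulledGradientMatrix_eq hr]
      rfl
  -- Trading w_j w_i / (w·w) for N_j N_i gives B' = -G B + N (G N)ᵀ B, the coefficient form of the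
  -- stated derivative.
  have e4 : ∀ l, B' j l = -(∑ i, G j i * B i l) + ∑ k, N j * (v k * B k l) := by
    intro l
    rw [hB']
    change -(∑ i, G j i * B i l) + c * (normalWVec Ω r j *
      ∑ k, (∑ i, G k i * normalWVec Ω r i) * B k l) = _
    congr 1
    rw [Finset.mul_sum, Finset.mul_sum]
    refine Finset.sum_congr rfl fun k _ => ?_
    rw [hv, ← mul_assoc (N j), Finset.mul_sum, Finset.sum_mul, Finset.sum_mul,
      Finset.mul_sum, Finset.mul_sum]
    refine Finset.sum_congr rfl fun i _ => ?_
    linear_combination (-(G k i * B k l)) * normalNVec_mul hr j i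
  have e5 : ∀ i, gradOp Ω t r u i = ∑ k, sobolevMulCLM t (B i k) (sobolevGrad Ω t k u) :=
    gradOp_apply t hr u
  simp only [gradDeriv, e1, e2, e3, e4, e5, map_sum, hmul, map_add, map_neg, add_apply, neg_apply,
    sum_apply, Finset.sum_add_distrib, Finset.sum_neg_distrib]
  rw [Finset.sum_comm, Finset.sum_comm (s := Finset.univ) (f := fun k l =>
    sobolevMulCLM t (N j * (v k * B k l)) (sobolevGrad Ω t l u))]

theorem exists_hasGateauxSemideriv_gradOp (t : ℝ) (hU : IsOpen U) (h : ∀ r ∈ U, r.IsDiffeo)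
    {r : Deformation Ω.boundary} (hr : r ∈ U) (ξ : Deformation Ω.boundary) :
    ∃ D : Sobolev (Ω.boundary : Set (Space d)) (t + 1) →L[ℂ]
        VectorSobolev (Ω.boundary : Set (Space d)) t,
      HasGateauxSemideriv (gradOp Ω t) r ξ D ∧ ∀ u, D u = gradDeriv Ω t r ξ u := by
  obtain ⟨B', hB', e⟩ := exists_hasGateauxSemideriv_gradMatrix hU h hr ξ
  refine ⟨∑ i, ∑ k, gradSummand Ω t i k (B' i k), ?_, fun u => funext fun j => ?_⟩
  · have hs := HasGateauxSemideriv.sum Finset.univ fun i _ => HasGateauxSemideriv.sum Finset.univ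
      fun k _ => (hB' i k).clm_comp (gradSummand Ω t i k)
    exact hs.congr hU (fun r hr => (gradOp_eq t (h r hr)).symm) hr
  · rw [gradDeriv_eq t (h r hr) ξ u j e]
    simp only [sum_apply, Finset.sum_apply, gradSummand_apply]
    rw [Finset.sum_comm]
    simp only [Finset.sum_ite_eq, Finset.mem_univ, if_true]
    rfl

end Derivative

/-! ### Small deformations -/

namespace Deformation

variable {d : ℕ} {Γ : TopologicalSpace.Compacts (Space d)}

theorem dInfty_summand_le (r s : Deformation Γ) (k : ℕ) :
    0 ≤ (1 / 2 : ℝ) ^ k * (kNorm k (s - r) / (1 + kNorm k (s - r))) ∧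
      (1 / 2 : ℝ) ^ k * (kNorm k (s - r) / (1 + kNorm k (s - r))) ≤ (1 / 2) ^ k := by
  have h : 0 ≤ kNorm k (s - r) := apply_nonneg _ _
  refine ⟨by positivity, mul_le_of_le_one_right (by positivity) ?_⟩
  rw [div_le_one (by positivity)]
  linarith

theorem summable_dInfty (r s : Deformation Γ) :
    Summable fun k : ℕ => (1 / 2 : ℝ) ^ k * (kNorm k (s - r) / (1 + kNorm k (s - r))) :=
  Summable.of_nonneg_of_le (fun k => (dInfty_summand_le r s k).1)
    (fun k => (dInfty_summand_le r s k).2) summable_geometric_two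

/-- The distance to 0 is a uniformly convergent sum of continuous functions, with geometric
majorant. -/
theorem isOpen_ball (ε : ℝ) : IsOpen (ball Γ ε) := by
  refine isOpen_lt ?_ continuous_const
  refine continuous_tsum (fun k => ?_) summable_geometric_two fun k r => ?_
  · have h : Continuous fun r : Deformation Γ => kNorm k (r - 0) :=
      (continuous_kNorm k).comp (continuous_id.sub continuous_const)
    exact continuous_const.mul (h.div (continuous_const.add h) fun r =>
      (add_pos_of_pos_of_nonneg one_pos (apply_nonneg _ _)).ne')
  · rw [Real.norm_of_nonneg (dInfty_summand_le 0 r k).1]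
    exact (dInfty_summand_le 0 r k).2

/-- The term k = 1 alone has weight 1/2, so a/(1 + a) < 1/3 for a = ‖r‖₁, that is, a < 1/2. -/
theorem kNorm_one_lt_of_mem_ball {r : Deformation Γ} (hr : r ∈ ball Γ (1 / 6)) :
    kNorm 1 r < 1 / 2 := by
  have h1 := ((summable_dInfty 0 r).le_tsum 1 fun k _ => (dInfty_summand_le 0 r k).1).trans_lt hr
  have h0 : 0 ≤ kNorm 1 r := apply_nonneg _ _
  rw [sub_zero, pow_one, ← mul_div_assoc, div_lt_iff₀ (by positivity)] at h1
  linarith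

/-- Some extension g is 1/2-Lipschitz on all of ℝ^d, so Id + g is a homeomorphism of ℝ^d. Its
derivative is invertible by the Neumann series, so the inverse is smooth and serves as the required
map s. -/
theorem isDiffeo_of_kNorm_one_lt {r : Deformation Γ} (h : kNorm 1 r < 1 / 2) : r.IsDiffeo := by
  obtain ⟨g, hg, hb⟩ := exists_extension_of_kNorm_lt h
  have hgd : ∀ x, HasFDerivAt g (fderiv ℝ g x) x := fun x =>
    (hg.1.differentiable (by simp) x).hasFDerivAt
  have hb1 : ∀ x, ‖fderiv ℝ g x‖ ≤ 1 / 2 := fun x => by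
    have := hb 1 le_rfl x
    rwa [norm_iteratedFDeriv_one] at this
  have hlip : LipschitzWith (1 / 2 : NNReal) g :=
    lipschitzWith_of_nnnorm_fderiv_le (hg.1.differentiable (by simp)) fun x => hb1 x
  have happ : ApproximatesLinearOn (fun x => x + g x)
      (ContinuousLinearEquiv.refl ℝ (Space d) : Space d →L[ℝ] Space d) univ (1 / 2 : NNReal) := by
    intro x _ y _
    have := hlip.dist_le_mul x y
    rw [dist_eq_norm, dist_eq_norm] at this
    refine le_of_eq_of_le (congrArg norm ?_) this
    change x + g x - (y + g y) - (x - y) = g x - g y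
    abel
  have hc : Subsingleton (Space d) ∨ (1 / 2 : NNReal) <
      ‖((ContinuousLinearEquiv.refl ℝ (Space d)).symm : Space d →L[ℝ] Space d)‖₊⁻¹ := by
    cases subsingleton_or_nontrivial (Space d) with
    | inl h => exact Or.inl h
    | inr h =>
      right
      have : ‖((ContinuousLinearEquiv.refl ℝ (Space d)).symm : Space d →L[ℝ] Space d)‖₊ = 1 :=
        NNReal.eq ContinuousLinearMap.norm_id
      rw [this, inv_one]
      exact NNReal.half_lt_self one_ne_zero
  set e := happ.toHomeomorph _ hc
  have hlt : ∀ x, ‖-fderiv ℝ g x‖ < 1 := fun x => by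
    rw [norm_neg]
    exact (hb1 x).trans_lt (by norm_num)
  have hs : ContDiff ℝ ∞ e.symm := by
    refine e.contDiff_symm (f₀' := fun x => ContinuousLinearEquiv.unitsEquiv ℝ (Space d)
      (Units.oneSub (-fderiv ℝ g x) (hlt x))) (fun x => ?_) (contDiff_id.add hg.1)
    have hx : ((1 : Space d →L[ℝ] Space d) - -fderiv ℝ g x) =
        ContinuousLinearMap.id ℝ (Space d) + fderiv ℝ g x := sub_neg_eq_add _ _
    exact ((hasFDerivAt_id x).add (hgd x)).congr_fderiv hx.symm
  refine ⟨e.symm, hs, fun x => ?_⟩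
  rw [map, ← hg.2]
  exact e.symm_apply_apply x

end Deformation

theorem exists_isAdmissibleRadius {d : ℕ} (Ω : SmoothDomain d) : ∃ ε, IsAdmissibleRadius Ω ε :=
  ⟨1 / 6, by norm_num, fun _ hr =>
    Deformation.isDiffeo_of_kNorm_one_lt (Deformation.kNorm_one_lt_of_mem_ball hr)⟩

end

end ShapeCalculus

/-! ### The main theorem -/

theorem mainTheorem4 {d : ℕ} (hd : 2 ≤ d) (Ω : SmoothDomain d) :
    -- `B^∞(0, ε)` consists of diffeomorphic deformations for small `ε`
    (∃ ε : ℝ, IsAdmissibleRadius Ω ε) ∧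
    ∀ ε : ℝ, IsAdmissibleRadius Ω ε → ∀ t : ℝ,
      -- multiplication by a smooth function is a bounded operator on `H^t(Γ)`
      (∀ a ∈ smoothFun ℂ ℂ (Ω.boundary : Set (Space d)),
        IsSobolevExtension (fun f => a * f) (mulOp t a)) ∧
      -- `N(r)` is smooth, and `G(r)` is the bounded extension of the pulled-back gradient
      (∀ r ∈ Deformation.ball Ω.boundary ε, ∀ i : Fin d,
        (fun x => (normalN Ω r x i : ℂ)) ∈
          smoothFun ℂ ℂ (Ω.boundary : Set (Space d)) ∧
        IsSobolevExtension (pulledGradient Ω r i)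
          (ContinuousLinearMap.proj (R := ℂ) i ∘L gradOp Ω t r)) ∧
      -- smoothness of `G`
      IsGateauxSmooth (Deformation.ball Ω.boundary ε) (gradOp Ω t) ∧
      -- the first derivative of `G`
      ∀ r ∈ Deformation.ball Ω.boundary ε, ∀ ξ : Deformation Ω.boundary,
        ∃ D : Sobolev (Ω.boundary : Set (Space d)) (t + 1) →L[ℂ]
            VectorSobolev (Ω.boundary : Set (Space d)) t,
          HasGateauxSemideriv (gradOp Ω t) r ξ D ∧ ∀ u, D u = gradDeriv Ω t r ξ u := by
  refine ⟨exists_isAdmissibleRadius Ω, fun ε hε t => ?_⟩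
  have hU := Deformation.isOpen_ball (Γ := Ω.boundary) ε
  refine ⟨fun a ha => ?_, fun r hr i => ⟨exists_isSmoothExtension_normalN (hε.2 r hr) i, ?_⟩,
    isGateauxSmooth_gradOp t hU hε.2,
    fun r hr ξ => exists_hasGateauxSemideriv_gradOp t hU hε.2 hr ξ⟩
  · exact isSobolevExtension_sobolevExtension
      (isSobolevExtension_sobolevMul t (SmoothAlgebra.mk a ha))
  · exact isSobolevExtension_sobolevExtension (isSobolevExtension_pulledGradient t (hε.2 r hr) i)
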